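/- **Setting.** Fix an integer $d\ge 1$. All random elements live on one probability space. For $1\le k\le d$ let $X_{ki}$ and $Y_{kj}$ ($i,j\ge 1$) be non-negative random variables (the two kinds of claim sizes on line $k$), where for each $k$ all $X_{ki}$ have the common distribution $F_k$ and all $Y_{kj}$ have the common distribution $G_k$. Let $0=\tau_{k0}\le\tau_{k1}\le\tau_{k2}\le\cdots$ and $0=\eta_{k0}\le\eta_{k1}\le\eta_{k2}\le\cdots$ be the arrival times of renewal processes $N^k_t=\sup\{m\ge 0:\tau_{km}\le t\}$ and $M^k_t=\sup\{n\ge 0:\eta_{kn}\le t\}$, that is, the inter-arrival times of each process are i.i.d., non-negative, finite, and not almost surely zero. Let $(R_t)_{t\ge 0}$ be a real Lévy process with càdlàg paths and mean $\mathbb E[R_1]\in(0,\infty]$, and let $c_1,\dots,c_d\ge 0$. Assume that the family $\{X_{ki},Y_{lj}:1\le k,l\le d,\ i,j\ge1\}$ (as a whole), the $2d$ renewal processes $N^1,\dots,N^d,M^1,\dots,M^d$, and the process $R$ are mutually independent. Write $\overline F(x)=1-F(x)$. Assume: * for some $0<\alpha<\infty$ all of $\overline{F_k},\overline{G_k}$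 $(1\le k\le d)$ are regularly varying of index $-\alpha$: $\lim_{x\to\infty}\overline F(yx)/\overline F(x)=y^{-\alpha}$ for every $y>0$; * these tails are mutually weakly equivalent: any two of $\overline{F_1},\dots,\overline{F_d},\overline{G_1},\dots,\overline{G_d}$ are $O(\cdot)$ of each other as $x\to\infty$; * any two distinct members $Z_1,Z_2$ of the family of claim sizes (of either kind, on any lines) are asymptotically independent: $$\lim_{x\to\infty}\frac{\mathbb P(Z_1>U_1(x),\,Z_2>U_2(x))}{\mathbb P(Z_1>U_1(x))}=0,\qquad U_i(x)=\inf\{y\in\mathbb R:1/\mathbb P(Z_i>y)\ge x\};$$ * the Laplace exponent $\phi(a)=\log\mathbb E[e^{-aR_1}]$ satisfies $\phi(\alpha^*)<0$ for some $\alpha^*>\alpha$. For $t\in[0,\infty]$ put $$S_t=\sum_{k=1}^d\Big(\sum_{i\ge 1}X_{ki}e^{-R_{\tau_{ki}}}\mathbf 1_{\{\tau_{ki}\le t\}}+\sum_{j\ge1}Y_{kj}e^{-R_{\eta_{kj}}}\mathbf 1_{\{\eta_{kj}\le t\}}\Big),\qquad D_t=S_t-\sum_{k=1}^d c_k\int_0^t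 e^{-R_s}\,ds,$$ $\lambda^k_t=\mathbb E[N^k_t]$, $\xi^k_t=\mathbb E[M^k_t]$, and $\Lambda=\{t\in[0,\infty]:\lambda^k_t>0\text{ and }\xi^k_t>0\text{ for all }1\le k\le d\}$. The integrals $\int_{0-}^t$ below are Lebesgue–Stieltjes integrals over $[0,t]$ (over $[0,\infty)$ if $t=\infty$), with the mass at $0$ included. For $f,g$ depending on $(x,t)$, "$f(x,t)\sim g(x,t)$ uniformly for $t\in\Delta$" means $\lim_{x\to\infty}\sup_{t\in\Delta}|f(x,t)/g(x,t)-1|=0$. **Theorem.** As $x\to\infty$: (i) uniformly for all $t\in\Lambda$, $$\mathbb P(S_t>x)\sim\sum_{k=1}^d\Big(\overline{F_k}(x)\int_{0-}^t e^{s\phi(\alpha)}\,d\lambda^k_s+\overline{G_k}(x)\int_{0-}^t e^{s\phi(\alpha)}\,d\xi^k_s\Big);$$ (ii) for every fixed $T\in\Lambda$, uniformly for all $t\in\Lambda\cap[T,\infty]$, $$\mathbb P(D_t>x)\sim\sum_{k=1}^d\Big(\overline{F_k}(x)\int_{0-}^t e^{s\phi(\alpha)}\,d\lambda^k_s+\overline{G_k}(x)\int_{0-}^t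 e^{s\phi(\alpha)}\,d\xi^k_s\Big).$$ -/

import Mathlib

open MeasureTheory ProbabilityTheory Filter Topology Set
open scoped NNReal ENNReal

namespace LevyRenewal

noncomputable section

/-! ### Tails, regular variation, asymptotic independence -/

/-- The tail `x ↦ F (x, ∞)` of a distribution `F` on the real line. -/
def tailProb (F : Measure ℝ) (x : ℝ) : ℝ := F.real (Ioi x)

/-- `f` is regularly varying at infinity with index `ρ`. -/
def RegVarying (f : ℝ → ℝ) (ρ : ℝ) : Prop :=
  ∀ y : ℝ, 0 < y → Tendsto (fun x => f (y * x) / f x) atTop (𝓝 (y ^ ρ))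

/-- The generalized inverse at `x` of the reciprocal tail of `F`, that is, the infimum of all `y`
with `1 / tailProb F y ≥ x`. -/
def tailQuantile (F : Measure ℝ) (x : ℝ) : ℝ := sInf {y : ℝ | x * tailProb F y ≤ 1}

variable {Ω : Type*} [MeasurableSpace Ω]

/-- The distribution on the real line of a non-negative random variable. -/
def lawOf (μ : Measure Ω) (Z : Ω → ℝ≥0) : Measure ℝ := μ.map (fun ω => (Z ω : ℝ))

/-- Asymptotic independence of two non-negative (unbounded) random variables. -/
def AsympIndep (μ : Measure Ω) (Z₁ Z₂ : Ω → ℝ≥0) : Prop :=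
  Tendsto (fun x : ℝ =>
      μ.real {ω | tailQuantile (lawOf μ Z₁) x < Z₁ ω ∧ tailQuantile (lawOf μ Z₂) x < Z₂ ω} /
        μ.real {ω | tailQuantile (lawOf μ Z₁) x < Z₁ ω})
    atTop (𝓝 0)

/-- `f(x, t) ∼ g(x, t)` as `x → ∞`, uniformly for `t ∈ Δ`: the supremum over `t ∈ Δ` of
`|f(x, t) / g(x, t) - 1|` tends to zero. -/
def UnifAsymp {T : Type*} (f g : ℝ → T → ℝ) (Δ : Set T) : Prop :=
  TendstoUniformlyOn (fun x t => f x t / g x t) (fun _ => 1) atTop Δ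

/-! ### Lévy processes -/

/-- Real-valued Lévy processes with (almost surely) càdlàg paths. -/
structure IsLevyProcess (μ : Measure Ω) (R : ℝ≥0 → Ω → ℝ) : Prop where
  measurable : ∀ t, Measurable (R t)
  start : ∀ᵐ ω ∂μ, R 0 ω = 0
  indep_increments : HasIndepIncrements R μ
  stationary : ∀ s h : ℝ≥0, IdentDistrib (fun ω => R (s + h) ω - R s ω) (R h) μ μ
  cadlag : ∀ᵐ ω ∂μ, ∀ t : ℝ≥0, ContinuousWithinAt (fun s => R s ω) (Ici t) t ∧
    ∃ l : ℝ, Tendsto (fun s => R s ω) (𝓝[<] t) (𝓝 l)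

/-- The Laplace exponent `φ(a) = log E[exp (-a R₁)]`. If the expectation is infinite, this
expression has the value `0` (so it is never negative in that case). -/
def laplaceExponent (μ : Measure Ω) (R : ℝ≥0 → Ω → ℝ) (a : ℝ) : ℝ :=
  Real.log (∫ ω, Real.exp (-a * R 1 ω) ∂μ)

/-! ### Renewal processes -/

/-- `0 = τ 0 ≤ τ 1 ≤ τ 2 ≤ ⋯` are the arrival times of a renewal process: the inter-arrival times
are independent, identically distributed, and not almost surely zero. (They may vanish with
positive probability.) -/
structure IsRenewalSequence (μ : Measure Ω) (τ : ℕ → Ω → ℝ≥0) : Prop where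
  measurable : ∀ i, Measurable (τ i)
  zero : ∀ ω, τ 0 ω = 0
  mono : ∀ ω, Monotone (fun i => τ i ω)
  indep : iIndepFun (fun i ω => τ (i + 1) ω - τ i ω) μ
  ident : ∀ i, IdentDistrib (fun ω => τ (i + 1) ω - τ i ω) (τ 1) μ μ
  nondegenerate : ¬ ∀ᵐ ω ∂μ, τ 1 ω = 0

/-- The counting process `N_t = sup {m : τ m ≤ t}`, for `t ∈ [0, ∞]`. -/
def renewalCount (τ : ℕ → Ω → ℝ≥0) (t : ℝ≥0∞) (ω : Ω) : ℝ≥0∞ :=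
  ⨆ (m : ℕ) (_ : (τ m ω : ℝ≥0∞) ≤ t), (m : ℝ≥0∞)

/-- The renewal function `E[N_t]`, for `t ∈ [0, ∞]`. -/
def renewalFunction (μ : Measure Ω) (τ : ℕ → Ω → ℝ≥0) (t : ℝ≥0∞) : ℝ≥0∞ :=
  ∫⁻ ω, renewalCount τ t ω ∂μ

/-- The Lebesgue-Stieltjes measure on `[0, ∞)` of the renewal function (with an atom at `0` of mass
`E[N_0]`), written as the sum of the laws of the arrival times `τ 1, τ 2, …`. -/
def renewalMeasure (μ : Measure Ω) (τ : ℕ → Ω → ℝ≥0) : Measure ℝ≥0 :=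
  Measure.sum (fun i : ℕ => μ.map (τ (i + 1)))

/-- The distribution function of `renewalMeasure` is the renewal function. -/
theorem renewalMeasure_apply {μ : Measure Ω} {τ : ℕ → Ω → ℝ≥0} (h : IsRenewalSequence μ τ)
    (t : ℝ≥0∞) : renewalMeasure μ τ {s : ℝ≥0 | (s : ℝ≥0∞) ≤ t} = renewalFunction μ τ t := by
  have hm : MeasurableSet {s : ℝ≥0 | (s : ℝ≥0∞) ≤ t} :=
    measurableSet_le measurable_coe_nnreal_ennreal measurable_const
  have key : ∀ ω, renewalCount τ t ω =
      ∑' i : ℕ, (τ (i + 1) ⁻¹' {s : ℝ≥0 | (s : ℝ≥0∞) ≤ t}).indicator (fun _ => (1 : ℝ≥0∞)) ω := by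
    intro ω
    apply le_antisymm
    · refine iSup₂_le fun m hmt => ?_
      calc (m : ℝ≥0∞) = ∑ i ∈ Finset.range m, (1 : ℝ≥0∞) := by simp
        _ ≤ ∑ i ∈ Finset.range m, (τ (i + 1) ⁻¹' {s : ℝ≥0 | (s : ℝ≥0∞) ≤ t}).indicator
              (fun _ => (1 : ℝ≥0∞)) ω := by
            refine Finset.sum_le_sum fun i hi => ?_
            have h1 : τ (i + 1) ω ≤ τ m ω := h.mono ω (by simpa using hi)
            have h2 : ω ∈ τ (i + 1) ⁻¹' {s : ℝ≥0 | (s : ℝ≥0∞) ≤ t} :=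
              le_trans (ENNReal.coe_le_coe.2 h1) hmt
            rw [indicator_of_mem h2]
        _ ≤ _ := ENNReal.sum_le_tsum _
    · rw [ENNReal.tsum_eq_iSup_nat]
      refine iSup_le fun n => ?_
      induction n with
      | zero => simp
      | succ n ih =>
        by_cases hn : (τ (n + 1) ω : ℝ≥0∞) ≤ t
        · refine le_trans ?_ (le_iSup₂_of_le (f := fun (m : ℕ) (_ : (τ m ω : ℝ≥0∞) ≤ t) =>
            (m : ℝ≥0∞)) (n + 1) hn le_rfl)
          calc _ ≤ ∑ i ∈ Finset.range (n + 1), (1 : ℝ≥0∞) :=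
                Finset.sum_le_sum fun i _ => indicator_le_self' (by simp) ω
            _ = _ := by simp
        · have h2 : ω ∉ τ (n + 1) ⁻¹' {s : ℝ≥0 | (s : ℝ≥0∞) ≤ t} := hn
          rw [Finset.sum_range_succ, indicator_of_notMem h2, add_zero]
          exact ih
  have hpre := fun i : ℕ => h.measurable (i + 1) hm
  rw [renewalMeasure, Measure.sum_apply _ hm, renewalFunction, lintegral_congr key,
    lintegral_tsum fun i => (measurable_const.indicator (hpre i)).aemeasurable]
  refine tsum_congr fun i => ?_
  rw [Measure.map_apply (h.measurable _) hm, lintegral_indicator_const (hpre i), one_mul]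

/-- The integral `∫_{0-}^t exp (s r) dE[N_s]` over the closed interval `[0, t]`
(over `[0, ∞)` if `t = ∞`). -/
def renewalIntegral (μ : Measure Ω) (τ : ℕ → Ω → ℝ≥0) (r : ℝ) (t : ℝ≥0∞) : ℝ :=
  ∫ s in {s : ℝ≥0 | (s : ℝ≥0∞) ≤ t}, Real.exp ((s : ℝ) * r) ∂(renewalMeasure μ τ)

/-! ### The insurance model

There are `d` lines of business. The claims of the first kind on line `k` are
`X k 0, X k 1, …`, and `X k i` arrives at time `τ k (i + 1)`; the claims of the second kind are
`Y k 0, Y k 1, …`, and `Y k j` arrives at time `η k (j + 1)`. -/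

variable {d : ℕ}

/-- The family of all claim sizes, of both kinds and on all lines. -/
def allClaims (X Y : Fin d → ℕ → Ω → ℝ≥0) : (Fin d × ℕ) ⊕ (Fin d × ℕ) → Ω → ℝ≥0
  | .inl p => X p.1 p.2
  | .inr p => Y p.1 p.2

/-- The sources of randomness of the model. -/
inductive Source (d : ℕ) : Type
  | claims : Source d
  | firstArrivals (k : Fin d) : Source d
  | secondArrivals (k : Fin d) : Source d
  | discount : Source d

/-- The sigma-algebra generated by each source: by all claim sizes together, by each of the `2 d`
renewal processes (equivalently, by its arrival times), and by the discount process
(equivalently, by `R`). -/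
@[reducible]
def sourceSigma (X Y : Fin d → ℕ → Ω → ℝ≥0) (τ η : Fin d → ℕ → Ω → ℝ≥0) (R : ℝ≥0 → Ω → ℝ) :
    Source d → MeasurableSpace Ω
  | .claims => MeasurableSpace.comap (fun ω a => allClaims X Y a ω) inferInstance
  | .firstArrivals k => MeasurableSpace.comap (fun ω i => τ k i ω) inferInstance
  | .secondArrivals k => MeasurableSpace.comap (fun ω j => η k j ω) inferInstance
  | .discount => MeasurableSpace.comap (fun ω t => R t ω) inferInstance

/-- Discounted value of the claims `X 0, X 1, …` that arrive by time `t`, as an element of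
`[0, ∞]`. -/
def discountedClaims (X : ℕ → Ω → ℝ≥0) (τ : ℕ → Ω → ℝ≥0) (R : ℝ≥0 → Ω → ℝ) (t : ℝ≥0∞) (ω : Ω) :
    ℝ≥0∞ :=
  ∑' i : ℕ, {s : ℝ≥0 | (s : ℝ≥0∞) ≤ t}.indicator
    (fun s => (X i ω : ℝ≥0∞) * ENNReal.ofReal (Real.exp (-R s ω))) (τ (i + 1) ω)

/-- The discounted aggregate claims of one line: both kinds together. -/
def lineClaims (X Y : Fin d → ℕ → Ω → ℝ≥0) (τ η : Fin d → ℕ → Ω → ℝ≥0) (R : ℝ≥0 → Ω → ℝ)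
    (k : Fin d) (t : ℝ≥0∞) (ω : Ω) : ℝ≥0∞ :=
  discountedClaims (X k) (τ k) R t ω + discountedClaims (Y k) (η k) R t ω

/-- The discounted aggregate claims `S_t` of all lines. -/
def aggregateClaims (X Y : Fin d → ℕ → Ω → ℝ≥0) (τ η : Fin d → ℕ → Ω → ℝ≥0) (R : ℝ≥0 → Ω → ℝ)
    (t : ℝ≥0∞) (ω : Ω) : ℝ≥0∞ :=
  ∑ k : Fin d, lineClaims X Y τ η R k t ω

/-- The integral of `exp (-R_s)` for `s` from `0` to `t`, as an element of `[0, ∞]`. -/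
def discountIntegral (R : ℝ≥0 → Ω → ℝ) (t : ℝ≥0∞) (ω : Ω) : ℝ≥0∞ :=
  ∫⁻ s in {s : ℝ | 0 ≤ s ∧ ENNReal.ofReal s ≤ t}, ENNReal.ofReal (Real.exp (-R s.toNNReal ω))

/-- The discounted loss of line `k` after premiums, received at the constant rate `c k`. It is a
real number unless one of the two terms is infinite. -/
def lineLoss (X Y : Fin d → ℕ → Ω → ℝ≥0) (τ η : Fin d → ℕ → Ω → ℝ≥0) (R : ℝ≥0 → Ω → ℝ)
    (c : Fin d → ℝ≥0) (k : Fin d) (t : ℝ≥0∞) (ω : Ω) : EReal :=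
  (lineClaims X Y τ η R k t ω : EReal) - ((c k * discountIntegral R t ω : ℝ≥0∞) : EReal)

/-- The discounted total loss `D_t` after premiums. -/
def totalLoss (X Y : Fin d → ℕ → Ω → ℝ≥0) (τ η : Fin d → ℕ → Ω → ℝ≥0) (R : ℝ≥0 → Ω → ℝ)
    (c : Fin d → ℝ≥0) (t : ℝ≥0∞) (ω : Ω) : EReal :=
  ∑ k : Fin d, lineLoss X Y τ η R c k t ω

/-- The set `Λ` of all `t ∈ [0, ∞]` at which all `2 d` renewal functions are positive. -/
def timeSet (μ : Measure Ω) (τ η : Fin d → ℕ → Ω → ℝ≥0) : Set ℝ≥0∞ :=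
  {t | ∀ k, 0 < renewalFunction μ (τ k) t ∧ 0 < renewalFunction μ (η k) t}

/-- The asymptotic expression for the tail probabilities at level `x` and time `t`. -/
def tailApprox (μ : Measure Ω) (F G : Fin d → Measure ℝ) (τ η : Fin d → ℕ → Ω → ℝ≥0) (r : ℝ)
    (x : ℝ) (t : ℝ≥0∞) : ℝ :=
  ∑ k : Fin d, (tailProb (F k) x * renewalIntegral μ (τ k) r t +
    tailProb (G k) x * renewalIntegral μ (η k) r t)

end

end LevyRenewal

open LevyRenewal

namespace LevyRenewal

/-! ### Regularly varying tails -/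

section RegVarying

variable {f : ℝ → ℝ} {α lo hi : ℝ}

/-! The governing principle is that of a single big claim. The total is a sum of claims Z with
weights θ = exp(-R_σ) 1{σ ≤ t}, where the arrival times σ and the process `R` are independent of the
claims, and for large x it exceeds x essentially only when one summand does. For one summand,
regular variation gives P(Zθ > x) ≈ P(Z > x) E[θ^α] (Breiman's lemma), and E[exp(-α R_σ); σ ≤ t] =
E[exp(φ(α) σ); σ ≤ t] because σ and `R` are independent. Summation over the arrivals produces the
renewal integrals.

The difficulty is uniformity in t, since the probability of an arrival by time t may be arbitrarily
small. Most errors are therefore measured against `firstTerm`, the sum over the lines of H(x)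
P(first arrival ≤ t), which is at most a constant times `mainTerm`, uniformly in x and t
(`exists_firstTerm_le`). Two facts make this possible. The error in Breiman's lemma is small
relative to w^lo + w^hi with lo < α < hi, uniformly in the weight w (`RegVarying.uniform_rpow`). And
the corresponding moments of the i-th weight are at most K P(first arrival ≤ t) q^i with q < 1,
which comes from `IsRenewalSequence.setLIntegral_exp_le` and the negativity of φ. The structure
`WeightedClaims` collects exactly these inputs.

For the upper bound (`measure_le_mainTerm`), geometric decay discards all but finitely many claims,
asymptotic independence makes it negligible that two of the others are large (`measure_pair_le`),
and otherwise one claim is nearly as large as the whole sum. The lower bound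
(`mainTerm_le_measure_add`) is Bonferroni's inequality for finitely many claims.

Premiums only decrease the loss, so the upper bound persists. For the lower bound, they total at
most a multiple J of the integral of exp(-R) over [0, ∞), which is almost surely finite
(`ae_lintegral_exp_lt_top`) and independent of the claims. A large sum together with J > M is
negligible, and J ≤ M is absorbed by raising x slightly (`mainTerm_le_measure_add_lt`). The error
here carries no factor P(first arrival ≤ t), which is why t stays above a fixed T. -/

theorem RegVarying.pos_of_antitone (hf : RegVarying f (-α)) (hanti : Antitone f)
    (hnn : ∀ x, 0 ≤ f x) (x : ℝ) : 0 < f x := by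
  have h := hf 1 one_pos
  simp only [one_mul, Real.one_rpow] at h
  have h1 : ∀ᶠ y in atTop, (1 / 2 : ℝ) < f y / f y := h.eventually (lt_mem_nhds (by norm_num))
  obtain ⟨y, hy, hxy⟩ := (h1.and (eventually_ge_atTop x)).exists
  have : f y ≠ 0 := fun h0 => by simp [h0] at hy; linarith
  exact lt_of_lt_of_le (lt_of_le_of_ne (hnn y) this.symm) (hanti hxy)

theorem exists_two_pow_near {x y : ℝ} (hy : 0 < y) (hxy : y ≤ x) :
    ∃ n : ℕ, 2 ^ n * y ≤ x ∧ x ≤ 2 ^ (n + 1) * y := by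
  obtain ⟨n, h1, h2⟩ := exists_nat_pow_near (one_le_div hy |>.2 hxy) (one_lt_two (α := ℝ))
  exact ⟨n, (le_div_iff₀ hy).1 h1, ((div_lt_iff₀ hy).1 h2).le⟩

/-- Iterating the one-step bound `f z ≤ 2 ^ hi * f (2 * z)`, valid eventually because `α < hi`,
crosses from `y` past `x` in dyadic steps. Monotonicity absorbs the overshoot, at the price of the
factor 2. -/
theorem RegVarying.le_rpow_mul (hf : RegVarying f (-α)) (hanti : Antitone f)
    (hnn : ∀ x, 0 ≤ f x) (hhi : α < hi) (hhi0 : 0 < hi) :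
    ∃ x₀ : ℝ, 0 < x₀ ∧ ∀ y, x₀ ≤ y → ∀ x, y ≤ x → f y ≤ (2 * (x / y)) ^ hi * f x := by
  have hpos := hf.pos_of_antitone hanti hnn
  have h2 : (2 : ℝ) ^ (-hi) < 2 ^ (-α) :=
    Real.rpow_lt_rpow_of_exponent_lt one_lt_two (by linarith)
  have h1 := ((hf 2 two_pos).eventually (lt_mem_nhds h2)).and (eventually_gt_atTop 0)
  obtain ⟨x₀, hx₀⟩ := eventually_atTop.1 h1
  refine ⟨max x₀ 1, by positivity, fun y hy x hxy => ?_⟩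
  have hstep : ∀ z, x₀ ≤ z → f z ≤ 2 ^ hi * f (2 * z) := by
    intro z hz
    have := (hx₀ z hz).1.le
    rw [le_div_iff₀ (hpos z), Real.rpow_neg two_pos.le, inv_mul_le_iff₀ (by positivity)] at this
    exact this
  have hy0 : 0 < y := lt_of_lt_of_le one_pos ((le_max_right _ _).trans hy)
  have hyx : x₀ ≤ y := (le_max_left _ _).trans hy
  have hiter : ∀ n : ℕ, f y ≤ (2 ^ n) ^ hi * f (2 ^ n * y) := by
    intro n
    induction n with
    | zero => simp
    | succ n ih =>
      have h1n : (1 : ℝ) ≤ 2 ^ n := one_le_pow₀ one_le_two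
      have := hstep (2 ^ n * y) (hyx.trans (by nlinarith))
      calc f y ≤ _ := ih
        _ ≤ (2 ^ n) ^ hi * (2 ^ hi * f (2 * (2 ^ n * y))) := by gcongr
        _ = _ := by
          rw [pow_succ, Real.mul_rpow (by positivity) two_pos.le]
          ring_nf
  obtain ⟨n, hn1, hn2⟩ := exists_two_pow_near hy0 hxy
  have hx0 : 0 < x := hy0.trans_le hxy
  calc f y ≤ _ := hiter (n + 1)
    _ ≤ (2 * (x / y)) ^ hi * f x := by
      refine mul_le_mul (Real.rpow_le_rpow (by positivity) ?_ hhi0.le) (hanti hn2) (hnn _)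
        (Real.rpow_nonneg (by positivity) _)
      rw [pow_succ, mul_comm]
      gcongr
      rwa [le_div_iff₀ hy0]

/-- The mirror image: each doubling gains at least `2 ^ lo` because `lo < α`, and the iteration
stops just before `y`. -/
theorem RegVarying.le_rpow_mul' (hf : RegVarying f (-α)) (hanti : Antitone f)
    (hnn : ∀ x, 0 ≤ f x) (hlo : lo < α) (hlo0 : 0 < lo) :
    ∃ x₀ : ℝ, 0 < x₀ ∧ ∀ x, x₀ ≤ x → ∀ y, x ≤ y → f y ≤ (2 * (x / y)) ^ lo * f x := by
  have hpos := hf.pos_of_antitone hanti hnn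
  have h2 : (2 : ℝ) ^ (-α) < 2 ^ (-lo) :=
    Real.rpow_lt_rpow_of_exponent_lt one_lt_two (by linarith)
  have h1 := ((hf 2 two_pos).eventually (gt_mem_nhds h2)).and (eventually_gt_atTop 0)
  obtain ⟨x₀, hx₀⟩ := eventually_atTop.1 h1
  refine ⟨max x₀ 1, by positivity, fun x hx y hxy => ?_⟩
  have hstep : ∀ z, x₀ ≤ z → 2 ^ lo * f (2 * z) ≤ f z := by
    intro z hz
    have := (hx₀ z hz).1.le
    rwa [div_le_iff₀ (hpos z), Real.rpow_neg two_pos.le, le_inv_mul_iff₀ (by positivity)] at this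
  have hx0 : 0 < x := lt_of_lt_of_le one_pos ((le_max_right _ _).trans hx)
  have hy0 : 0 < y := hx0.trans_le hxy
  have hxx : x₀ ≤ x := (le_max_left _ _).trans hx
  have hiter : ∀ n : ℕ, (2 ^ n) ^ lo * f (2 ^ n * x) ≤ f x := by
    intro n
    induction n with
    | zero => simp
    | succ n ih =>
      have h1n : (1 : ℝ) ≤ 2 ^ n := one_le_pow₀ one_le_two
      have := hstep (2 ^ n * x) (hxx.trans (by nlinarith))
      refine le_trans ?_ ih
      calc _ = (2 ^ n) ^ lo * (2 ^ lo * f (2 * (2 ^ n * x))) := by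
            rw [pow_succ, Real.mul_rpow (by positivity) two_pos.le]
            ring_nf
        _ ≤ _ := by gcongr
  obtain ⟨n, hn1, hn2⟩ := exists_two_pow_near hx0 hxy
  have h2n : (0 : ℝ) < 2 ^ n := by positivity
  calc f y ≤ f (2 ^ n * x) := hanti hn1
    _ ≤ ((2 ^ n) ^ lo)⁻¹ * f x := by
      rw [le_inv_mul_iff₀ (by positivity)]
      exact hiter n
    _ ≤ (2 * (x / y)) ^ lo * f x := by
      gcongr
      · exact hnn x
      · rw [← Real.inv_rpow h2n.le]
        refine Real.rpow_le_rpow (by positivity) ?_ hlo0.le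
        rw [inv_le_iff_one_le_mul₀ h2n, mul_comm, ← mul_assoc, ← mul_div_assoc, le_div_iff₀ hy0]
        rw [pow_succ] at hn2
        linarith

/-- A Potter bound that holds at all positive ratios. -/
theorem RegVarying.potter (hf : RegVarying f (-α)) (hanti : Antitone f)
    (hnn : ∀ x, 0 ≤ f x) (hle : ∀ x, f x ≤ 1) (hlo0 : 0 < lo) (hlo : lo < α) (hhi : α < hi) :
    ∃ C : ℝ, 0 < C ∧ ∃ x₀ : ℝ, 0 < x₀ ∧ ∀ x, x₀ ≤ x → ∀ w, 0 < w →
      f (x / w) ≤ C * f x * (w ^ lo + w ^ hi) := by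
  have hpos := hf.pos_of_antitone hanti hnn
  have hhi0 : 0 < hi := by linarith
  obtain ⟨x₁, hx₁, h1⟩ := hf.le_rpow_mul hanti hnn hhi hhi0
  obtain ⟨x₂, hx₂, h2⟩ := hf.le_rpow_mul' hanti hnn hlo hlo0
  -- The factor `1 / f x₁ ≥ 1` is needed only for weights so large that `x / w` falls below the
  -- threshold `x₁`.
  refine ⟨(1 / f x₁) * 2 ^ hi, mul_pos (by have := hpos x₁; positivity) (by positivity),
    max x₁ x₂, by positivity, fun x hx w hw => ?_⟩
  have hxx1 := (le_max_left _ _).trans hx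
  have hxx2 := (le_max_right _ _).trans hx
  have hx0 : 0 < x := hx₁.trans_le hxx1
  have hf1 : 1 ≤ 1 / f x₁ := (one_le_div (hpos _)).2 (hle _)
  have hwlo := Real.rpow_nonneg hw.le lo
  have hwhi := Real.rpow_nonneg hw.le hi
  have hfx := hnn x
  have h2hi : (2 : ℝ) ^ lo ≤ 2 ^ hi :=
    Real.rpow_le_rpow_of_exponent_le one_le_two (by linarith)
  rcases le_total w 1 with hw1 | hw1
  · have hxw : x ≤ x / w := by
      rw [le_div_iff₀ hw]; nlinarith
    calc f (x / w) ≤ (2 * (x / (x / w))) ^ lo * f x := h2 x hxx2 _ hxw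
      _ = 1 * 2 ^ lo * f x * w ^ lo := by
        rw [div_div_cancel₀ hx0.ne', Real.mul_rpow two_pos.le hw.le]; ring
      _ ≤ (1 / f x₁) * 2 ^ hi * f x * (w ^ lo + w ^ hi) := by
        gcongr
        linarith
  · have hxw : x / w ≤ x := div_le_self hx0.le hw1
    rcases le_total x₁ (x / w) with hc | hc
    · calc f (x / w) ≤ (2 * (x / (x / w))) ^ hi * f x := h1 _ hc _ hxw
        _ = 1 * 2 ^ hi * f x * w ^ hi := by
          rw [div_div_cancel₀ hx0.ne', Real.mul_rpow two_pos.le hw.le]; ring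
        _ ≤ (1 / f x₁) * 2 ^ hi * f x * (w ^ lo + w ^ hi) := by
          gcongr
          linarith
    -- Below the threshold regular variation says nothing about `f (x / w)`. The trivial bound 1
    -- suffices, since `f x` itself is at least a multiple of `(x / x₁) ^ (-hi)` and `x / x₁ ≤ w`.
    · calc f (x / w) ≤ 1 := hle _
        _ = (1 / f x₁) * f x₁ := by rw [one_div, inv_mul_cancel₀ (hpos _).ne']
        _ ≤ (1 / f x₁) * ((2 * (x / x₁)) ^ hi * f x) := by
          gcongr
          exact h1 x₁ le_rfl x hxx1
        _ ≤ (1 / f x₁) * ((2 * w) ^ hi * f x) := by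
          gcongr
          rw [div_le_iff₀ hw] at hc
          rw [div_le_iff₀ hx₁]
          linarith
        _ = (1 / f x₁) * 2 ^ hi * f x * w ^ hi := by
          rw [Real.mul_rpow two_pos.le hw.le]; ring
        _ ≤ (1 / f x₁) * 2 ^ hi * f x * (w ^ lo + w ^ hi) := by
          gcongr
          linarith

/-- Uniform convergence on compact sets of ratios. -/
theorem RegVarying.uniform_Icc (hf : RegVarying f (-α)) (hanti : Antitone f)
    (hnn : ∀ x, 0 ≤ f x) {m M ε : ℝ} (hm : 0 < m) (hε : 0 < ε) :
    ∀ᶠ x in atTop, ∀ w ∈ Icc m M, |f (x / w) - w ^ α * f x| ≤ ε * f x := by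
  have hpos := hf.pos_of_antitone hanti hnn
  have hlim : ∀ w : ℝ, 0 < w → Tendsto (fun x => f (x / w) / f x) atTop (𝓝 (w ^ α)) := by
    intro w hw
    have := hf w⁻¹ (by positivity)
    rw [Real.inv_rpow hw.le, Real.rpow_neg hw.le, inv_inv] at this
    simpa [div_eq_inv_mul] using this
  suffices H : ∀ s : Set ℝ, IsCompact s → s ⊆ Ioi 0 →
      ∀ᶠ x in atTop, ∀ w ∈ s, |f (x / w) - w ^ α * f x| ≤ ε * f x from
    H _ isCompact_Icc fun w hw => hm.trans_le hw.1
  intro s hs hs0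
  refine hs.induction_on (p := fun s => ∀ᶠ x in atTop, ∀ w ∈ s,
    |f (x / w) - w ^ α * f x| ≤ ε * f x) (by simp) (fun s t hst ht => ht.mono fun x hx w hw =>
      hx w (hst hw)) (fun s t h1 h2 => (h1.and h2).mono fun x hx w hw => hw.elim (hx.1 w) (hx.2 w))
    ?_
  intro w₀ hw₀s
  have hw₀ : 0 < w₀ := hs0 hw₀s
  have hc : ContinuousAt (fun w : ℝ => w ^ α) w₀ := Real.continuousAt_rpow_const _ _ (.inl hw₀.ne')
  obtain ⟨δ, hδ, hδ2⟩ := Metric.continuousAt_iff.1 hc (ε / 4) (by positivity)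
  set r := min (δ / 2) (w₀ / 2) with hr
  have hr0 : 0 < r := by positivity
  have hrδ : r < δ := (min_le_left _ _).trans_lt (by linarith)
  have hrw : r < w₀ := (min_le_right _ _).trans_lt (by linarith)
  -- The limits at the two endpoints control the whole interval, because `f` is monotone and `w ^ α`
  -- moves by less than `ε / 4` from its value at `w₀`.
  refine ⟨Icc (w₀ - r) (w₀ + r), mem_nhdsWithin_of_mem_nhds
    (Icc_mem_nhds (by linarith) (by linarith)), ?_⟩
  have e1 := (hlim (w₀ - r) (by linarith)).eventually
    (Metric.ball_mem_nhds _ (show 0 < ε / 4 by positivity))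
  have e2 := (hlim (w₀ + r) (by linarith)).eventually
    (Metric.ball_mem_nhds _ (show 0 < ε / 4 by positivity))
  filter_upwards [e1, e2, eventually_gt_atTop 0] with x h1 h2 hx0 w hw
  have hw0 : 0 < w := by linarith [hw.1]
  have d1 := hδ2 (x := w₀ - r) (by rw [Real.dist_eq, abs_lt]; constructor <;> linarith)
  have d2 := hδ2 (x := w₀ + r) (by rw [Real.dist_eq, abs_lt]; constructor <;> linarith)
  have d3 := hδ2 (x := w) (by rw [Real.dist_eq, abs_lt]; constructor <;> linarith [hw.1, hw.2])
  rw [Real.dist_eq, abs_lt] at h1 h2 d1 d2 d3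
  have m1 : f (x / (w₀ - r)) / f x ≤ f (x / w) / f x := by
    gcongr
    · exact (hpos x).le
    · exact hanti (div_le_div_of_nonneg_left hx0.le (by linarith) hw.1)
  have m2 : f (x / w) / f x ≤ f (x / (w₀ + r)) / f x := by
    gcongr
    · exact (hpos x).le
    · exact hanti (div_le_div_of_nonneg_left hx0.le hw0 hw.2)
  have key : |f (x / w) / f x - w ^ α| ≤ ε := by
    rw [abs_le]; constructor <;> linarith [d1.1, d1.2, d2.1, d2.2, d3.1, d3.2, h1.1, h1.2, h2.1, h2.2]
  have : f (x / w) - w ^ α * f x = (f (x / w) / f x - w ^ α) * f x := by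
    rw [sub_mul, div_mul_cancel₀ _ (hpos x).ne']
  rw [this, abs_mul, abs_of_pos (hpos x)]
  exact mul_le_mul_of_nonneg_right key (hnn x)

/-- The ratio of a regularly varying tail at all positive ratios, with an error that is small
relative to a sum of two powers. -/
theorem RegVarying.uniform_rpow (hf : RegVarying f (-α)) (hanti : Antitone f)
    (hnn : ∀ x, 0 ≤ f x) (hle : ∀ x, f x ≤ 1) (hlo0 : 0 < lo) (hlo : lo < α) (hhi : α < hi)
    {ε : ℝ} (hε : 0 < ε) :
    ∀ᶠ x in atTop, ∀ w, 0 < w → |f (x / w) - w ^ α * f x| ≤ ε * f x * (w ^ lo + w ^ hi) := by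
  -- Potter's bound at exponents strictly inside `(lo, hi)` leaves a positive power to spare: `w ^
  -- lo'` is small relative to `w ^ lo` near zero, and `w ^ hi'` relative to `w ^ hi` at infinity.
  -- Only a compact range of `w` then needs uniform convergence.
  set lo' := (lo + α) / 2
  set hi' := (hi + α) / 2
  have hlo1 : lo < lo' := by simp only [lo']; linarith
  have hlo2 : lo' < α := by simp only [lo']; linarith
  have hhi1 : hi' < hi := by simp only [hi']; linarith
  have hhi2 : α < hi' := by simp only [hi']; linarith
  obtain ⟨C, hC, x₀, hx₀, hP⟩ := hf.potter hanti hnn hle (hlo0.trans hlo1) hlo2 hhi2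
  have hm : ∀ᶠ m : ℝ in 𝓝[>] 0, (2 * C + 1) * m ^ (lo' - lo) < ε ∧ m < 1 ∧ 0 < m := by
    have h1 : Tendsto (fun m : ℝ => (2 * C + 1) * m ^ (lo' - lo)) (𝓝[>] 0) (𝓝 0) := by
      have : ContinuousAt (fun m : ℝ => (2 * C + 1) * m ^ (lo' - lo)) 0 :=
        continuousAt_const.mul (Real.continuousAt_rpow_const _ _ (.inr (by linarith)))
      have h := this.tendsto
      rw [Real.zero_rpow (by linarith), mul_zero] at h
      exact h.mono_left nhdsWithin_le_nhds
    exact (h1.eventually (gt_mem_nhds hε)).and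
      ((eventually_nhdsWithin_of_eventually_nhds (gt_mem_nhds one_pos)).and self_mem_nhdsWithin)
  obtain ⟨m, hm1, hm2, hm0⟩ := hm.exists
  have hM : ∀ᶠ M : ℝ in atTop, (2 * C + 1) * M ^ (-(hi - hi')) < ε ∧ 1 < M := by
    have h1 := (tendsto_rpow_neg_atTop (show 0 < hi - hi' by linarith)).const_mul (2 * C + 1)
    rw [mul_zero] at h1
    exact (h1.eventually (gt_mem_nhds hε)).and (eventually_gt_atTop 1)
  obtain ⟨M, hM1, hM2⟩ := hM.exists
  -- The tolerance includes `m ^ lo` so that on `[m, M]` the error is at most `ε * w ^ lo`.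
  have hunif := hf.uniform_Icc hanti hnn (M := M) hm0
    (show 0 < ε * m ^ lo by positivity)
  filter_upwards [hunif, eventually_ge_atTop x₀] with x hx hxx w hw
  have hfx := hnn x
  have hwlo := Real.rpow_nonneg hw.le lo
  have hwhi := Real.rpow_nonneg hw.le hi
  have hp := hP x hxx w hw
  have hfw := hnn (x / w)
  have hwα := Real.rpow_nonneg hw.le α
  have habs : |f (x / w) - w ^ α * f x| ≤ (C * (w ^ lo' + w ^ hi') + w ^ α) * f x := by
    rw [abs_le]
    constructor <;> nlinarith [mul_nonneg hwα hfx]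
  rcases le_total w m with hwm | hwm
  · refine habs.trans ?_
    have hw1 : w ≤ 1 := hwm.trans hm2.le
    have e1 : w ^ lo' ≤ m ^ (lo' - lo) * w ^ lo := by
      calc w ^ lo' = w ^ (lo' - lo) * w ^ lo := by rw [← Real.rpow_add hw]; ring_nf
        _ ≤ _ := by gcongr
    have e2 : w ^ hi' ≤ w ^ lo' := Real.rpow_le_rpow_of_exponent_ge hw hw1 (by linarith)
    have e3 : w ^ α ≤ w ^ lo' := Real.rpow_le_rpow_of_exponent_ge hw hw1 (by linarith)
    calc (C * (w ^ lo' + w ^ hi') + w ^ α) * f x ≤ (C * (w ^ lo' + w ^ lo') + w ^ lo') * f x := by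
          gcongr
      _ = (2 * C + 1) * w ^ lo' * f x := by ring
      _ ≤ (2 * C + 1) * (m ^ (lo' - lo) * w ^ lo) * f x := by gcongr
      _ = ((2 * C + 1) * m ^ (lo' - lo)) * f x * w ^ lo := by ring
      _ ≤ ε * f x * (w ^ lo + w ^ hi) := by gcongr; linarith
  rcases le_total w M with hwM | hwM
  · refine (hx w ⟨hwm, hwM⟩).trans ?_
    have : m ^ lo ≤ w ^ lo := by gcongr
    calc ε * m ^ lo * f x = ε * f x * m ^ lo := by ring
      _ ≤ ε * f x * (w ^ lo + w ^ hi) := by gcongr; linarith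
  · refine habs.trans ?_
    have hw1 : 1 ≤ w := hM2.le.trans hwM
    have e1 : w ^ hi' ≤ M ^ (-(hi - hi')) * w ^ hi := by
      calc w ^ hi' = w ^ (-(hi - hi')) * w ^ hi := by rw [← Real.rpow_add hw]; ring_nf
        _ ≤ _ := by
          gcongr ?_ * _
          exact Real.rpow_le_rpow_of_nonpos (by linarith) hwM (by linarith)
    have e2 : w ^ lo' ≤ w ^ hi' := Real.rpow_le_rpow_of_exponent_le hw1 (by linarith)
    have e3 : w ^ α ≤ w ^ hi' := Real.rpow_le_rpow_of_exponent_le hw1 (by linarith)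
    calc (C * (w ^ lo' + w ^ hi') + w ^ α) * f x ≤ (C * (w ^ hi' + w ^ hi') + w ^ hi') * f x := by
          gcongr
      _ = (2 * C + 1) * w ^ hi' * f x := by ring
      _ ≤ (2 * C + 1) * (M ^ (-(hi - hi')) * w ^ hi) * f x := by gcongr
      _ = ((2 * C + 1) * M ^ (-(hi - hi'))) * f x * w ^ hi := by ring
      _ ≤ ε * f x * (w ^ lo + w ^ hi) := by gcongr; linarith

end RegVarying

/-! ### Tails of probability measures -/

theorem tailProb_nonneg {H : Measure ℝ} (x : ℝ) : 0 ≤ tailProb H x := measureReal_nonneg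

theorem measure_lt_mul_zero {H : Measure ℝ} {x : ℝ} (hx : 0 < x) :
    H {z | x < z * ((0 : ℝ≥0) : ℝ)} = 0 := by
  simp [hx.not_gt]

theorem lawOf_apply {Ω : Type*} [MeasurableSpace Ω] {μ : Measure Ω} {Z : Ω → ℝ≥0}
    (hZ : Measurable Z) {s : Set ℝ} (hs : MeasurableSet s) :
    lawOf μ Z s = μ {ω | (Z ω : ℝ) ∈ s} :=
  Measure.map_apply hZ.coe_nnreal_real hs

section Tail

variable {H : Measure ℝ} [IsProbabilityMeasure H] {α lo hi : ℝ}

theorem tailProb_eq_one_sub_cdf (x : ℝ) : tailProb H x = 1 - cdf H x := by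
  rw [tailProb, cdf_eq_real, ← probReal_compl_eq_one_sub measurableSet_Iic, compl_Iic]

theorem tailProb_antitone : Antitone (tailProb H) := fun _ _ hxy =>
  measureReal_mono (Ioi_subset_Ioi hxy)

theorem tailProb_le_one (x : ℝ) : tailProb H x ≤ 1 := measureReal_le_one

theorem ofReal_tailProb (x : ℝ) : ENNReal.ofReal (tailProb H x) = H (Ioi x) :=
  ofReal_measureReal

theorem RegVarying.tailProb_pos (hf : RegVarying (tailProb H) (-α)) (x : ℝ) : 0 < tailProb H x :=
  hf.pos_of_antitone tailProb_antitone tailProb_nonneg x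

theorem tendsto_tailProb_atTop : Tendsto (tailProb H) atTop (𝓝 0) := by
  have := (tendsto_cdf_atTop H).const_sub 1
  rw [sub_self] at this
  exact this.congr fun x => (tailProb_eq_one_sub_cdf x).symm

theorem tailProb_tendsto_right (x : ℝ) : Tendsto (tailProb H) (𝓝[>] x) (𝓝 (tailProb H x)) := by
  have h := ((cdf H).right_continuous x).tendsto.const_sub 1
  simp_rw [← tailProb_eq_one_sub_cdf] at h
  exact h.mono_left (nhdsWithin_mono _ Ioi_subset_Ici_self)

/-- The infimum is attained because tails are right-continuous. Boundedness below is required since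
`sInf` of a set unbounded below is 0 by convention. -/
theorem mul_tailProb_tailQuantile_le {x : ℝ} (hx : 0 < x)
    (hbdd : BddBelow {y : ℝ | x * tailProb H y ≤ 1}) :
    x * tailProb H (tailQuantile H x) ≤ 1 := by
  have hne : {y : ℝ | x * tailProb H y ≤ 1}.Nonempty := by
    have h := (tendsto_tailProb_atTop (H := H)).const_mul x
    rw [mul_zero] at h
    obtain ⟨y, hy⟩ := (h.eventually (gt_mem_nhds one_pos)).exists
    exact ⟨y, hy.le⟩
  refine le_of_tendsto ((tailProb_tendsto_right (tailQuantile H x)).const_mul x) ?_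
  filter_upwards [self_mem_nhdsWithin] with y hy
  obtain ⟨z, hz, hzy⟩ := (csInf_lt_iff hbdd hne).1 (show sInf _ < y from hy)
  exact (mul_le_mul_of_nonneg_left (tailProb_antitone hzy.le) hx.le).trans hz

/-- The measure of a scaled tail set, for a non-negative scaling factor. -/
theorem measure_lt_mul_eq {x : ℝ} {w : ℝ≥0} (hw : w ≠ 0) :
    H {z | x < z * w} = ENNReal.ofReal (tailProb H (x / w)) := by
  rw [ofReal_tailProb]
  congr 1
  ext z
  have : (0 : ℝ) < w := by positivity
  simp [div_lt_iff₀ this]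

/-- The sum of two powers. -/
noncomputable def powSum (lo hi : ℝ) (w : ℝ≥0) : ℝ≥0∞ := (w : ℝ≥0∞) ^ lo + (w : ℝ≥0∞) ^ hi

theorem _root_.Measurable.powSum {Ω : Type*} [MeasurableSpace Ω] {f : Ω → ℝ≥0}
    (hf : Measurable f) : Measurable fun ω => powSum lo hi (f ω) := by
  unfold LevyRenewal.powSum; fun_prop

theorem powSum_eq_ofReal {w : ℝ≥0} (hw : w ≠ 0) :
    powSum lo hi w = ENNReal.ofReal ((w : ℝ) ^ lo + (w : ℝ) ^ hi) := by
  have : (0 : ℝ) < w := by positivity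
  rw [powSum, ENNReal.ofReal_add (by positivity) (by positivity),
    ← ENNReal.ofReal_rpow_of_pos this, ← ENNReal.ofReal_rpow_of_pos this,
    ENNReal.ofReal_coe_nnreal]

/-- The threshold for `x` is independent of `w`, so the bound may be integrated over the law of an
independent weight. -/
theorem RegVarying.measure_lt_mul_le (hf : RegVarying (tailProb H) (-α)) (hlo0 : 0 < lo)
    (hlo : lo < α) (hhi : α < hi) :
    ∃ C : ℝ≥0, ∀ᶠ x : ℝ in atTop, ∀ w : ℝ≥0,
      H {z | x < z * w} ≤ C * H (Ioi x) * powSum lo hi w := by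
  obtain ⟨C, hC, x₀, hx₀, hP⟩ := hf.potter tailProb_antitone tailProb_nonneg tailProb_le_one
    hlo0 hlo hhi
  refine ⟨C.toNNReal, ?_⟩
  filter_upwards [eventually_ge_atTop x₀] with x hx w
  have hx0 : 0 < x := hx₀.trans_le hx
  rcases eq_or_ne w 0 with rfl | hw
  · rw [measure_lt_mul_zero hx0]; exact zero_le
  · have hw0 : (0 : ℝ) < w := by positivity
    rw [measure_lt_mul_eq hw, powSum_eq_ofReal hw, ← ofReal_tailProb]
    change _ ≤ ENNReal.ofReal C * _ * _
    rw [← ENNReal.ofReal_mul hC.le,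
      ← ENNReal.ofReal_mul (mul_nonneg hC.le (tailProb_nonneg _))]
    exact ENNReal.ofReal_le_ofReal (hP x hx w hw0)

/-- A two-sided estimate, arranged as two sums because subtraction in `ℝ≥0∞` truncates. -/
theorem RegVarying.measure_lt_mul_approx (hf : RegVarying (tailProb H) (-α)) (hlo0 : 0 < lo)
    (hlo : lo < α) (hhi : α < hi) {ε : ℝ≥0} (hε : 0 < ε) :
    ∀ᶠ x : ℝ in atTop, ∀ w : ℝ≥0,
      H {z | x < z * w} ≤ H (Ioi x) * ((w : ℝ≥0∞) ^ α + ε * powSum lo hi w) ∧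
      H (Ioi x) * (w : ℝ≥0∞) ^ α ≤ H {z | x < z * w} + H (Ioi x) * (ε * powSum lo hi w) := by
  have hP := hf.uniform_rpow tailProb_antitone tailProb_nonneg tailProb_le_one hlo0 hlo hhi
    (NNReal.coe_pos.2 hε)
  filter_upwards [eventually_gt_atTop 0, hP] with x hx0 hP w
  rcases eq_or_ne w 0 with rfl | hw
  · rw [measure_lt_mul_zero hx0, ENNReal.coe_zero, ENNReal.zero_rpow_of_pos (by linarith)]
    simp
  · have hw0 : (0 : ℝ) < w := by positivity
    have h := abs_le.1 (hP w hw0)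
    have hx1 := tailProb_nonneg (H := H) x
    have hx2 := tailProb_nonneg (H := H) (x / w)
    have hs : 0 ≤ (w : ℝ) ^ lo + (w : ℝ) ^ hi := by positivity
    have hε' : (ε : ℝ≥0∞) = ENNReal.ofReal ε := (ENNReal.ofReal_coe_nnreal).symm
    have hwα : (w : ℝ≥0∞) ^ α = ENNReal.ofReal ((w : ℝ) ^ α) := by
      rw [← ENNReal.ofReal_rpow_of_pos hw0, ENNReal.ofReal_coe_nnreal]
    rw [measure_lt_mul_eq hw, powSum_eq_ofReal hw, ← ofReal_tailProb, hε', hwα,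
      ← ENNReal.ofReal_mul ε.coe_nonneg]
    rw [← ENNReal.ofReal_add (by positivity) (by positivity), ← ENNReal.ofReal_mul hx1,
      ← ENNReal.ofReal_mul hx1, ← ENNReal.ofReal_mul hx1,
      ← ENNReal.ofReal_add hx2 (by positivity)]
    constructor <;> apply ENNReal.ofReal_le_ofReal <;> nlinarith [h.1, h.2]

theorem RegVarying.measure_Ioi_mul_le (hf : RegVarying (tailProb H) (-α)) {s : ℝ} (hs : 0 < s)
    {r : ℝ} (hr : s ^ (-α) < r) :
    ∀ᶠ x : ℝ in atTop, H (Ioi (s * x)) ≤ ENNReal.ofReal r * H (Ioi x) := by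
  filter_upwards [(hf s hs).eventually (gt_mem_nhds hr)] with x hx
  rw [← ofReal_tailProb, ← ofReal_tailProb x,
    ← ENNReal.ofReal_mul ((Real.rpow_pos_of_pos hs _).trans hr).le]
  exact ENNReal.ofReal_le_ofReal ((div_lt_iff₀ (hf.tailProb_pos x)).1 hx).le

theorem RegVarying.le_measure_Ioi_mul (hf : RegVarying (tailProb H) (-α)) {s : ℝ} (hs : 0 < s)
    {r : ℝ} (hr0 : 0 ≤ r) (hr : r < s ^ (-α)) :
    ∀ᶠ x : ℝ in atTop, ENNReal.ofReal r * H (Ioi x) ≤ H (Ioi (s * x)) := by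
  filter_upwards [(hf s hs).eventually (lt_mem_nhds hr)] with x hx
  rw [← ofReal_tailProb, ← ofReal_tailProb (s * x), ← ENNReal.ofReal_mul hr0]
  exact ENNReal.ofReal_le_ofReal ((lt_div_iff₀ (hf.tailProb_pos x)).1 hx).le

end Tail

/-! ### Joint tails of asymptotically independent random variables -/

section Joint

variable {Ω : Type*} [MeasurableSpace Ω] {μ : Measure Ω} [IsProbabilityMeasure μ]

theorem isProbabilityMeasure_lawOf {Z : Ω → ℝ≥0} (hZ : Measurable Z) :
    IsProbabilityMeasure (lawOf μ Z) :=
  Measure.isProbabilityMeasure_map hZ.coe_nnreal_real.aemeasurable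

theorem tailQuantile_le_of_mul_le {Z : Ω → ℝ≥0} (hZ : Measurable Z) {x y : ℝ} (hx : 1 < x)
    (h : x * tailProb (lawOf μ Z) y ≤ 1) :
    tailQuantile (lawOf μ Z) x ≤ y ∧
      x * tailProb (lawOf μ Z) (tailQuantile (lawOf μ Z) x) ≤ 1 := by
  have := isProbabilityMeasure_lawOf (μ := μ) hZ
  -- On the negative half-line the tail is 1, so `1 < x` excludes all negative points from the set.
  have hb : BddBelow {y : ℝ | x * tailProb (lawOf μ Z) y ≤ 1} := by
    refine ⟨0, fun z hz => ?_⟩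
    by_contra! hz0
    have : tailProb (lawOf μ Z) z = 1 := by
      rw [tailProb, measureReal_def, lawOf_apply hZ measurableSet_Ioi]
      have : {ω | (Z ω : ℝ) ∈ Ioi z} = univ := by
        ext ω; simpa using hz0.trans_le (Z ω).2
      rw [this, measure_univ, ENNReal.toReal_one]
    rw [mem_ofPred_eq, this] at hz
    linarith
  exact ⟨csInf_le hb h, mul_tailProb_tailQuantile_le (by linarith) hb⟩

/-- Asymptotic independence speaks of two different quantile levels; the aim is a common level `y`.
With 1/x equal to a large enough multiple of the first tail at `y`, both quantiles at `x` lie at or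
below `y`, while the first tail at its quantile is at most 1/x, hence of the order of the first tail
at `y`. -/
theorem AsympIndep.joint_tail {Z₁ Z₂ : Ω → ℝ≥0} (h : AsympIndep μ Z₁ Z₂) (h1 : Measurable Z₁)
    (h2 : Measurable Z₂) (hpos : ∀ x, 0 < tailProb (lawOf μ Z₁) x)
    (hO : tailProb (lawOf μ Z₂) =O[atTop] tailProb (lawOf μ Z₁)) {ε : ℝ} (hε : 0 < ε) :
    ∀ᶠ y : ℝ in atTop,
      μ.real {ω | y < Z₁ ω ∧ y < Z₂ ω} ≤ ε * tailProb (lawOf μ Z₁) y := by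
  have p1 := isProbabilityMeasure_lawOf (μ := μ) h1
  have p2 := isProbabilityMeasure_lawOf (μ := μ) h2
  obtain ⟨K, hK1, hK⟩ := hO.exists_pos
  rw [Asymptotics.IsBigOWith_def] at hK
  set K' := max K 1
  have hK'0 : 0 < K' := lt_max_of_lt_left hK1
  have hlim : Tendsto (fun y => (K' * tailProb (lawOf μ Z₁) y)⁻¹) atTop atTop := by
    refine Tendsto.inv_tendsto_nhdsGT_zero (tendsto_nhdsWithin_iff.2 ⟨?_, ?_⟩)
    · simpa using (tendsto_tailProb_atTop (H := lawOf μ Z₁)).const_mul K'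
    · exact Eventually.of_forall fun y => mul_pos hK'0 (hpos y)
  have hev := h.eventually (gt_mem_nhds (show 0 < ε / K' by positivity))
  filter_upwards [hlim.eventually hev, hlim.eventually (eventually_gt_atTop 1), hK]
    with y hy hy1 hyK
  set x := (K' * tailProb (lawOf μ Z₁) y)⁻¹ with hx
  have hx0 : 0 < x := by linarith
  rw [Real.norm_of_nonneg (tailProb_nonneg _), Real.norm_of_nonneg (tailProb_nonneg _)] at hyK
  have hKx : x * (K' * tailProb (lawOf μ Z₁) y) = 1 :=
    inv_mul_cancel₀ (mul_pos hK'0 (hpos y)).ne'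
  have q1 := tailQuantile_le_of_mul_le (μ := μ) h1 (y := y) hy1 (by
    rw [← hKx]
    gcongr
    exact le_mul_of_one_le_left (hpos y).le (le_max_right _ _))
  have q2 := tailQuantile_le_of_mul_le (μ := μ) h2 (y := y) hy1 (by
    rw [← hKx]
    gcongr
    exact hyK.trans (mul_le_mul_of_nonneg_right (le_max_left _ _) (hpos y).le))
  have hden : μ.real {ω | tailQuantile (lawOf μ Z₁) x < Z₁ ω} =
      tailProb (lawOf μ Z₁) (tailQuantile (lawOf μ Z₁) x) := by
    rw [tailProb, measureReal_def, measureReal_def, lawOf_apply h1 measurableSet_Ioi]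
    rfl
  have hyy : μ.real {ω | tailQuantile (lawOf μ Z₁) x < Z₁ ω ∧
      tailQuantile (lawOf μ Z₂) x < Z₂ ω} <
      ε / K' * tailProb (lawOf μ Z₁) (tailQuantile (lawOf μ Z₁) x) := by
    rw [hden] at hy
    exact (div_lt_iff₀ (hpos _)).1 hy
  calc μ.real {ω | y < Z₁ ω ∧ y < Z₂ ω} ≤ μ.real {ω | tailQuantile (lawOf μ Z₁) x < Z₁ ω ∧
        tailQuantile (lawOf μ Z₂) x < Z₂ ω} :=
        measureReal_mono fun ω hω => ⟨q1.1.trans_lt hω.1, q2.1.trans_lt hω.2⟩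
    _ ≤ ε / K' * tailProb (lawOf μ Z₁) (tailQuantile (lawOf μ Z₁) x) := hyy.le
    _ ≤ ε / K' * (K' * tailProb (lawOf μ Z₁) y) := by
      gcongr
      have := q1.2.trans_eq hKx.symm
      exact le_of_mul_le_mul_left this hx0
    _ = ε * tailProb (lawOf μ Z₁) y := by
      field_simp

end Joint

/-! ### Randomly weighted sums of claims -/

section Preliminaries

variable {Ω : Type*} [MeasurableSpace Ω] {μ : Measure Ω}

theorem measure_lt_mul_of_indepFun [IsProbabilityMeasure μ] {Z θ : Ω → ℝ≥0} (hZ : Measurable Z)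
    (hθ : Measurable θ) (h : IndepFun Z θ μ) (x : ℝ) :
    μ {ω | x < Z ω * θ ω} = ∫⁻ ω, lawOf μ Z {z | x < z * θ ω} ∂μ := by
  have hp := isProbabilityMeasure_lawOf (μ := μ) hZ
  have h' : IndepFun (fun ω => (Z ω : ℝ)) θ μ := h.comp measurable_coe_nnreal_real measurable_id
  have hmap := (indepFun_iff_map_prod_eq_prod_map_map hZ.coe_nnreal_real.aemeasurable
    hθ.aemeasurable).1 h'
  have hs : MeasurableSet {p : ℝ × ℝ≥0 | x < p.1 * p.2} :=
    measurableSet_lt measurable_const (by fun_prop)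
  have : μ {ω | x < Z ω * θ ω} =
      (μ.map fun ω => ((Z ω : ℝ), θ ω)) {p : ℝ × ℝ≥0 | x < p.1 * p.2} :=
    (Measure.map_apply (hZ.coe_nnreal_real.prodMk hθ) hs).symm
  rw [this, hmap]
  have := Measure.isProbabilityMeasure_map (μ := μ) hθ.aemeasurable
  change (lawOf μ Z).prod _ _ = _
  rw [Measure.prod_apply_symm hs, lintegral_map (measurable_measure_prodMk_right hs) hθ]
  rfl

/-- Bonferroni's inequality in additive form. The pairs are ordered, so each intersection is counted
twice, which is harmless for an error term. -/
theorem sum_measure_le_measure_biUnion_add {ι : Type*} [DecidableEq ι] (A : Finset ι)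
    {E : ι → Set Ω} (hE : ∀ a, MeasurableSet (E a)) :
    ∑ a ∈ A, μ (E a) ≤ μ (⋃ a ∈ A, E a) + ∑ p ∈ A.offDiag, μ (E p.1 ∩ E p.2) := by
  induction A using Finset.induction_on with
  | empty => simp
  | insert a A ha ih =>
    have hU : MeasurableSet (⋃ b ∈ A, E b) := A.measurableSet_biUnion fun b _ => hE b
    have h1 : μ (E a ∩ ⋃ b ∈ A, E b) ≤ ∑ b ∈ A, μ (E a ∩ E b) := by
      rw [inter_iUnion₂]
      exact measure_biUnion_finset_le _ _
    have h2 : ∑ p ∈ A.offDiag, μ (E p.1 ∩ E p.2) + ∑ b ∈ A, μ (E a ∩ E b) ≤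
        ∑ p ∈ (insert a A).offDiag, μ (E p.1 ∩ E p.2) := by
      have h3 : ∑ b ∈ A, μ (E a ∩ E b) = ∑ p ∈ ({a} ×ˢ A : Finset _), μ (E p.1 ∩ E p.2) := by
        rw [Finset.sum_product]; simp
      rw [Finset.offDiag_insert ha, h3, ← Finset.sum_union]
      · exact Finset.sum_le_sum_of_subset Finset.subset_union_left
      · rw [Finset.disjoint_left]
        rintro ⟨b, c⟩ h4 h5
        simp only [Finset.mem_offDiag, Finset.mem_product, Finset.mem_singleton] at h4 h5
        exact ha (h5.1 ▸ h4.1)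
    rw [Finset.sum_insert ha, Finset.set_biUnion_insert]
    calc μ (E a) + ∑ b ∈ A, μ (E b)
        ≤ μ (E a) + (μ (⋃ b ∈ A, E b) + ∑ p ∈ A.offDiag, μ (E p.1 ∩ E p.2)) := by gcongr
      _ = (μ (E a ∪ ⋃ b ∈ A, E b) + μ (E a ∩ ⋃ b ∈ A, E b)) +
          ∑ p ∈ A.offDiag, μ (E p.1 ∩ E p.2) := by
        rw [measure_union_add_inter _ hU, add_assoc]
      _ ≤ (μ (E a ∪ ⋃ b ∈ A, E b) + ∑ b ∈ A, μ (E a ∩ E b)) +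
          ∑ p ∈ A.offDiag, μ (E p.1 ∩ E p.2) := by gcongr
      _ ≤ _ := by
        rw [add_assoc, add_comm (∑ b ∈ A, μ (E a ∩ E b))]
        gcongr

/-- If a finite sum of non-negative numbers is large and no two summands are, then one summand
is about as large as the sum. -/
theorem exists_lt_of_lt_sum {ι : Type*} (A : Finset ι) (v : ι → ℝ) {x δ κ : ℝ} (hx : 0 < x)
    (hδ1 : δ < 1) (hκ : 0 < κ) (hκA : κ * A.card ≤ δ / 2)
    (hsum : (1 - δ / 2) * x < ∑ a ∈ A, v a)
    (hpair : ∀ a ∈ A, ∀ b ∈ A, a ≠ b → κ * x < v a → ¬ κ * x < v b) :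
    ∃ a ∈ A, (1 - δ) * x < v a := by
  classical
  by_contra! hno
  have hc : (A.card : ℝ) * (κ * x) ≤ δ / 2 * x := by nlinarith
  -- At most one summand exceeds `κ * x`; the others together contribute at most `δ / 2 * x`.
  by_cases h : ∃ a ∈ A, κ * x < v a
  · obtain ⟨a, ha, hva⟩ := h
    have h1 : ∑ b ∈ A.erase a, v b ≤ (A.erase a).card • (κ * x) :=
      Finset.sum_le_card_nsmul _ _ _ fun b hb => not_lt.1
        (hpair a ha b (Finset.mem_of_mem_erase hb) (Finset.ne_of_mem_erase hb).symm hva)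
    have h2 : ((A.erase a).card : ℝ) ≤ A.card := by exact_mod_cast Finset.card_erase_le
    rw [nsmul_eq_mul] at h1
    have h3 : ((A.erase a).card : ℝ) * (κ * x) ≤ A.card * (κ * x) := by gcongr
    rw [← Finset.add_sum_erase A v ha] at hsum
    linarith [hno a ha]
  · push Not at h
    have h1 : ∑ b ∈ A, v b ≤ A.card • (κ * x) := Finset.sum_le_card_nsmul _ _ _ h
    rw [nsmul_eq_mul] at h1
    nlinarith

theorem powSum_mul_le {lo hi : ℝ} (hlo0 : 0 ≤ lo) (h : lo ≤ hi) {s : ℝ≥0} (hs : 1 ≤ s) (w : ℝ≥0) :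
    powSum lo hi (s * w) ≤ (s : ℝ≥0∞) ^ hi * powSum lo hi w := by
  have h1 : (1 : ℝ≥0∞) ≤ s := by exact_mod_cast hs
  rw [powSum, powSum, ENNReal.coe_mul, ENNReal.mul_rpow_of_nonneg _ _ hlo0,
    ENNReal.mul_rpow_of_nonneg _ _ (hlo0.trans h), mul_add]
  gcongr

theorem powSum_mono {lo hi : ℝ} (hlo0 : 0 ≤ lo) (h : lo ≤ hi) : Monotone (powSum lo hi) := by
  intro v w hvw
  have : 0 ≤ hi := hlo0.trans h
  unfold powSum
  gcongr

theorem rpow_le_powSum {lo β hi : ℝ} (h1 : lo ≤ β) (h2 : β ≤ hi) (w : ℝ≥0) :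
    (w : ℝ≥0∞) ^ β ≤ powSum lo hi w := by
  rcases le_total w 1 with hw | hw
  · exact (ENNReal.rpow_le_rpow_of_exponent_ge (by exact_mod_cast hw) h1).trans le_self_add
  · exact (ENNReal.rpow_le_rpow_of_exponent_le (by exact_mod_cast hw) h2).trans le_add_self

theorem powSum_zero {lo hi : ℝ} (hlo0 : 0 < lo) (hhi : 0 < hi) : powSum lo hi 0 = 0 := by
  simp [powSum, hlo0, hhi]

/-- Large values have small lower powers relative to higher ones. -/
theorem powSum_le_of_lt {lo hi β : ℝ} (h1 : lo ≤ hi) (h2 : hi ≤ β) {M w : ℝ≥0} (hM : 1 ≤ M)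
    (hw : M < w) : powSum lo hi w ≤ 2 * (M : ℝ≥0∞) ^ (hi - β) * (w : ℝ≥0∞) ^ β := by
  have hw1 : (1 : ℝ≥0∞) ≤ w := by exact_mod_cast hM.trans hw.le
  have hw0 : w ≠ 0 := (zero_lt_one.trans_le (hM.trans hw.le)).ne'
  have e : (w : ℝ≥0∞) ^ hi ≤ (M : ℝ≥0∞) ^ (hi - β) * (w : ℝ≥0∞) ^ β := by
    calc (w : ℝ≥0∞) ^ hi = (w : ℝ≥0∞) ^ (hi - β) * (w : ℝ≥0∞) ^ β := by
          rw [← ENNReal.rpow_add _ _ (by exact_mod_cast hw0) ENNReal.coe_ne_top]; ring_nf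
      _ ≤ _ := by
        gcongr ?_ * _
        rw [← neg_sub β hi, ENNReal.rpow_neg, ENNReal.rpow_neg, ENNReal.inv_le_inv]
        exact ENNReal.rpow_le_rpow (by exact_mod_cast hw.le) (by linarith)
  calc powSum lo hi w ≤ (w : ℝ≥0∞) ^ hi + (w : ℝ≥0∞) ^ hi := by
        unfold powSum
        gcongr
    _ ≤ _ := by
      rw [← two_mul, mul_assoc]
      gcongr

end Preliminaries

/-! ### Tails of geometric series and choice of truncation levels -/

section Series

theorem tsum_eq_sum_range_add_tsum_ite (f : ℕ → ℝ≥0∞) (N : ℕ) :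
    ∑' i, f i = ∑ i ∈ Finset.range N, f i + ∑' i, if N ≤ i then f i else 0 := by
  have h1 : ∑ i ∈ Finset.range N, f i = ∑' i, if i < N then f i else 0 := by
    rw [tsum_eq_sum (s := Finset.range N) fun i hi => if_neg (by simpa using hi)]
    exact Finset.sum_congr rfl fun i hi => (if_pos (by simpa using hi)).symm
  rw [h1, ← ENNReal.tsum_add]
  refine tsum_congr fun i => ?_
  by_cases h : i < N
  · simp [h, not_le.2 h]
  · simp [h, not_lt.1 h]

theorem exists_tsum_pow_ite_le {y : ℝ≥0} (hy : y < 1) {ε : ℝ≥0∞} (hε : 0 < ε) :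
    ∃ N : ℕ, ∑' i, (if N ≤ i then (y : ℝ≥0∞) ^ i else 0) ≤ ε := by
  have hfin : ∑' i, (y : ℝ≥0∞) ^ i ≠ ∞ := by
    rw [ENNReal.tsum_geometric]
    exact ENNReal.inv_ne_top.2 (tsub_pos_of_lt (by exact_mod_cast hy)).ne'
  obtain ⟨N, hN⟩ := ((ENNReal.tendsto_sum_nat_add _ hfin).eventually (gt_mem_nhds hε)).exists
  refine ⟨N, le_trans (le_of_eq ?_) hN.le⟩
  have h := Summable.sum_add_tsum_nat_add' (k := N)
    (f := fun i => if N ≤ i then (y : ℝ≥0∞) ^ i else 0) ENNReal.summable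
  rw [← h, Finset.sum_eq_zero fun i hi => if_neg (by simpa using hi), zero_add]
  simp

theorem tsum_pow_le_coe {y : ℝ≥0} (hy : y < 1) :
    ∑' i, (y : ℝ≥0∞) ^ i = ((1 - y)⁻¹ : ℝ≥0) := by
  rw [ENNReal.tsum_geometric, ENNReal.coe_inv (tsub_pos_of_lt hy).ne']
  simp

theorem exists_mul_rpow_neg_le (D : ℝ≥0) {γ : ℝ} (hγ : 0 < γ) {ε : ℝ≥0} (hε : 0 < ε) :
    ∃ M : ℝ≥0, 1 ≤ M ∧ (D : ℝ≥0∞) * (M : ℝ≥0∞) ^ (-γ) ≤ ε := by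
  have h := (tendsto_rpow_neg_atTop hγ).const_mul (D : ℝ)
  rw [mul_zero] at h
  obtain ⟨M, hM, hM1⟩ := ((h.eventually (gt_mem_nhds (NNReal.coe_pos.2 hε))).and
    (eventually_ge_atTop 1)).exists
  lift M to ℝ≥0 using by linarith
  refine ⟨M, by exact_mod_cast hM1, ?_⟩
  have hM0 : M ≠ 0 := by
    rintro rfl
    norm_num at hM1
  rw [← ENNReal.coe_rpow_of_ne_zero hM0]
  exact_mod_cast hM.le

end Series

/-! ### Weighted claims and the union bound -/

section Model

variable {Ω κ : Type*}

/-- Claims `Z j i`, with regularly varying and weakly equivalent tails and pairwise asymptotically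
independent, that arrive at times `σ j i` and have random weights `W j i`; the times and weights
are measurable with respect to a sigma-algebra `m` independent of the claims. -/
structure WeightedClaims (m : MeasurableSpace Ω) [mΩ : MeasurableSpace Ω] (μ : Measure Ω)
    (Z σ W : κ → ℕ → Ω → ℝ≥0) (H : κ → Measure ℝ) (α lo hi : ℝ) : Prop where
  le : m ≤ mΩ
  measurable_claim : ∀ j i, Measurable (Z j i)
  indep : Indep (MeasurableSpace.comap (fun ω (a : κ × ℕ) => Z a.1 a.2 ω) inferInstance) m μ
  law : ∀ j i, lawOf μ (Z j i) = H j
  regVarying : ∀ j, RegVarying (tailProb (H j)) (-α)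
  isBigO : ∀ j l, tailProb (H j) =O[atTop] tailProb (H l)
  asympIndep : ∀ a b : κ × ℕ, a ≠ b → AsympIndep μ (Z a.1 a.2) (Z b.1 b.2)
  measurable_time : ∀ j i, Measurable[m] (σ j i)
  time_le : ∀ j i ω, σ j 0 ω ≤ σ j i ω
  measurable_weight : ∀ j i, Measurable[m] (W j i)
  lo_pos : 0 < lo
  lo_lt : lo < α
  lt_hi : α < hi
  moment : ∃ K q : ℝ≥0, q < 1 ∧ ∀ j i (t : ℝ≥0∞),
    ∫⁻ ω in {ω | (σ j i ω : ℝ≥0∞) ≤ t}, powSum lo hi (W j i ω) ∂μ ≤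
      K * μ {ω | (σ j 0 ω : ℝ≥0∞) ≤ t} * (q : ℝ≥0∞) ^ i
  lower : ∃ c : ℝ≥0, 0 < c ∧ ∀ j (t : ℝ≥0∞), c * μ {ω | (σ j 0 ω : ℝ≥0∞) ≤ t} ≤
    ∑' i, ∫⁻ ω in {ω | (σ j i ω : ℝ≥0∞) ≤ t}, (W j i ω : ℝ≥0∞) ^ α ∂μ

/-- The weight, if the claim has arrived by time `t`, and zero otherwise. -/
noncomputable def cutWeight (σ W : κ → ℕ → Ω → ℝ≥0) (t : ℝ≥0∞) (j : κ) (i : ℕ) (ω : Ω) : ℝ≥0 :=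
  {ω | (σ j i ω : ℝ≥0∞) ≤ t}.indicator (W j i) ω

/-- A weighted sum of claims. -/
noncomputable def weightedSum [Fintype κ] (Z θ : κ → ℕ → Ω → ℝ≥0) (ω : Ω) : ℝ≥0∞ :=
  ∑ j, ∑' i, ((Z j i ω * θ j i ω : ℝ≥0) : ℝ≥0∞)

variable {m : MeasurableSpace Ω} [mΩ : MeasurableSpace Ω] {μ : Measure Ω}
  {Z σ W : κ → ℕ → Ω → ℝ≥0} {H : κ → Measure ℝ} {α lo hi : ℝ}

/-- The asymptotic tail of the weighted sum of the claims that have arrived by time `t`. -/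
noncomputable def mainTerm [Fintype κ] (μ : Measure Ω) (σ W : κ → ℕ → Ω → ℝ≥0) (H : κ → Measure ℝ)
    (α x : ℝ) (t : ℝ≥0∞) : ℝ≥0∞ :=
  ∑ j, H j (Ioi x) * ∑' i, ∫⁻ ω, (cutWeight σ W t j i ω : ℝ≥0∞) ^ α ∂μ

/-- A quantity of the order of `mainTerm`: only first arrivals are counted. -/
noncomputable def firstTerm [Fintype κ] (μ : Measure Ω) (σ : κ → ℕ → Ω → ℝ≥0) (H : κ → Measure ℝ)
    (x : ℝ) (t : ℝ≥0∞) : ℝ≥0∞ :=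
  ∑ j, H j (Ioi x) * μ {ω | (σ j 0 ω : ℝ≥0∞) ≤ t}

namespace WeightedClaims

theorem measurableSet_time (h : WeightedClaims m μ Z σ W H α lo hi) (t : ℝ≥0∞) (j : κ) (i : ℕ) :
    MeasurableSet[m] {ω | (σ j i ω : ℝ≥0∞) ≤ t} :=
  (measurable_coe_nnreal_ennreal.comp (h.measurable_time j i)) measurableSet_Iic

theorem measurable_cutWeight (h : WeightedClaims m μ Z σ W H α lo hi) (t : ℝ≥0∞) (j : κ) (i : ℕ) :
    Measurable[m] (cutWeight σ W t j i) :=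
  Measurable.indicator (h.measurable_weight j i) (h.measurableSet_time t j i)

theorem hi_pos (h : WeightedClaims m μ Z σ W H α lo hi) : 0 < hi :=
  h.lo_pos.trans (h.lo_lt.trans h.lt_hi)

theorem lintegral_cutWeight (h : WeightedClaims m μ Z σ W H α lo hi) (t : ℝ≥0∞) (j : κ) (i : ℕ)
    {g : ℝ≥0 → ℝ≥0∞} (hg : g 0 = 0) :
    ∫⁻ ω, g (cutWeight σ W t j i ω) ∂μ =
      ∫⁻ ω in {ω | (σ j i ω : ℝ≥0∞) ≤ t}, g (W j i ω) ∂μ := by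
  rw [← lintegral_indicator (h.le _ (h.measurableSet_time t j i))]
  refine lintegral_congr fun ω => ?_
  by_cases hω : (σ j i ω : ℝ≥0∞) ≤ t
  · simp [cutWeight, hω]
  · simp [cutWeight, hω, hg]

theorem indepFun (h : WeightedClaims m μ Z σ W H α lo hi) (j : κ) (i : ℕ) {θ : Ω → ℝ≥0}
    (hθ : Measurable[m] θ) : IndepFun (Z j i) θ μ := by
  rw [IndepFun_iff_Indep]
  refine indep_of_indep_of_le_left (indep_of_indep_of_le_right h.indep hθ.comap_le) ?_
  refine Measurable.comap_le ?_
  exact (measurable_pi_apply (j, i)).comp (comap_measurable fun ω (a : κ × ℕ) => Z a.1 a.2 ω)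

theorem isProbabilityMeasure [IsProbabilityMeasure μ] (h : WeightedClaims m μ Z σ W H α lo hi)
    (j : κ) : IsProbabilityMeasure (H j) :=
  h.law j 0 ▸ isProbabilityMeasure_lawOf (h.measurable_claim j 0)

theorem measure_lt_mul (h : WeightedClaims m μ Z σ W H α lo hi) [IsProbabilityMeasure μ]
    (j : κ) (i : ℕ) {θ : Ω → ℝ≥0} (hθ : Measurable[m] θ) (x : ℝ) :
    μ {ω | x < Z j i ω * θ ω} = ∫⁻ ω, H j {z | x < z * θ ω} ∂μ := by
  rw [measure_lt_mul_of_indepFun (h.measurable_claim j i) (hθ.mono h.le le_rfl)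
    (h.indepFun j i hθ), h.law]

variable [Fintype κ]

/-- The upper exponent `β` is left free above `α`: the union bound takes `hi`, whereas the
truncation of large weights needs an exponent strictly below `hi`. -/
theorem measure_lt_mul_le (h : WeightedClaims m μ Z σ W H α lo hi) [IsProbabilityMeasure μ]
    {β : ℝ} (hβ : α < β) :
    ∃ C : ℝ≥0, ∀ᶠ x : ℝ in atTop, ∀ j i, ∀ θ : Ω → ℝ≥0, Measurable[m] θ →
      μ {ω | x < Z j i ω * θ ω} ≤ C * H j (Ioi x) * ∫⁻ ω, powSum lo β (θ ω) ∂μ := by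
  have hp := h.isProbabilityMeasure
  choose C hC using fun j => (h.regVarying j).measure_lt_mul_le h.lo_pos h.lo_lt hβ
  refine ⟨∑ j, C j, ?_⟩
  filter_upwards [eventually_all.2 hC] with x hx j i θ hθ
  rw [h.measure_lt_mul j i hθ, ← lintegral_const_mul _
    (hθ.mono h.le le_rfl).powSum]
  refine lintegral_mono fun ω => (hx j (θ ω)).trans ?_
  gcongr
  exact Finset.single_le_sum (fun _ _ => zero_le) (Finset.mem_univ j)

/-- Breiman's lemma with an explicit error. One threshold for `x` serves every weight measurable in
`m`, hence every index and every time. -/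
theorem measure_lt_mul_approx (h : WeightedClaims m μ Z σ W H α lo hi) [IsProbabilityMeasure μ]
    {ε : ℝ≥0} (hε : 0 < ε) :
    ∀ᶠ x : ℝ in atTop, ∀ j i, ∀ θ : Ω → ℝ≥0, Measurable[m] θ →
      μ {ω | x < Z j i ω * θ ω} ≤
        H j (Ioi x) * (∫⁻ ω, (θ ω : ℝ≥0∞) ^ α ∂μ + ε * ∫⁻ ω, powSum lo hi (θ ω) ∂μ) ∧
      H j (Ioi x) * ∫⁻ ω, (θ ω : ℝ≥0∞) ^ α ∂μ ≤
        μ {ω | x < Z j i ω * θ ω} + H j (Ioi x) * (ε * ∫⁻ ω, powSum lo hi (θ ω) ∂μ) := by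
  have hp := h.isProbabilityMeasure
  have hC := fun j => (h.regVarying j).measure_lt_mul_approx h.lo_pos h.lo_lt h.lt_hi hε
  filter_upwards [eventually_all.2 hC] with x hx j i θ hθ
  have hθ' := hθ.mono h.le le_rfl
  have m1 : Measurable fun ω => powSum lo hi (θ ω) := hθ'.powSum
  have m2 : Measurable fun ω => (θ ω : ℝ≥0∞) ^ α := by fun_prop
  rw [h.measure_lt_mul j i hθ, ← lintegral_const_mul _ m1]
  constructor
  · rw [← lintegral_add_right _ (m1.const_mul _),
      ← lintegral_const_mul _ (by exact m2.add (m1.const_mul _))]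
    exact lintegral_mono fun ω => (hx j (θ ω)).1
  · rw [← lintegral_const_mul _ m2, ← lintegral_const_mul _ (m1.const_mul _),
      ← lintegral_add_right _ ((m1.const_mul _).const_mul _)]
    exact lintegral_mono fun ω => (hx j (θ ω)).2

/-- A union bound for the tail of a weighted sum of all claims. -/
theorem measure_weightedSum_le (h : WeightedClaims m μ Z σ W H α lo hi) [IsProbabilityMeasure μ]
    {r δ : ℝ≥0} (hr : 1 < r) (hδ : 0 < δ) (hδ1 : δ ≤ 1) :
    ∃ C : ℝ≥0, ∀ᶠ x : ℝ in atTop, ∀ θ : κ → ℕ → Ω → ℝ≥0, (∀ j i, Measurable[m] (θ j i)) →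
      μ {ω | ENNReal.ofReal (δ * x) < weightedSum Z θ ω} ≤
        ∑ j, H j (Ioi x) * (C * ∑' i, (r : ℝ≥0∞) ^ i * ∫⁻ ω, powSum lo hi (θ j i ω) ∂μ) := by
  obtain ⟨C, hC⟩ := h.measure_lt_mul_le h.lt_hi
  have hhi := h.hi_pos
  -- The i-th claim is allotted a share of the threshold proportional to `u ^ (-i)`. Scaling its
  -- weight by `u ^ i` costs `u ^ (i * hi) = r ^ i` in the moment.
  set u : ℝ≥0 := r ^ (1 / hi) with hu
  have hu1 : 1 < u := NNReal.one_lt_rpow hr (by positivity)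
  have hur : u ^ hi = r := by
    rw [hu, ← NNReal.rpow_mul, one_div_mul_cancel hhi.ne', NNReal.rpow_one]
  set n : ℝ≥0 := Fintype.card κ + 1 with hn
  have hu1' : 0 < u - 1 := tsub_pos_of_lt hu1
  -- This value makes the geometric shares of one line add up to `δ * x / n`. Taking `n` one larger
  -- than the number of lines keeps it positive when there are none.
  set s₀ : ℝ≥0 := n * u / (δ * (u - 1)) with hs₀
  have hs₀1 : 1 ≤ s₀ := by
    rw [hs₀, one_le_div (by positivity)]
    calc δ * (u - 1) ≤ 1 * u := by gcongr; exact tsub_le_self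
      _ ≤ n * u := by gcongr; simp [hn]
  have hs0 : (0 : ℝ) < s₀ := NNReal.coe_pos.2 (zero_lt_one.trans_le hs₀1)
  have hs1 : ∀ i : ℕ, 1 ≤ s₀ * u ^ i := fun i => one_le_mul_of_one_le_of_one_le hs₀1
    (one_le_pow₀ hu1.le)
  refine ⟨C * s₀ ^ hi, ?_⟩
  filter_upwards [hC, eventually_gt_atTop 0] with x hx hx0 θ hθ
  have hsub : {ω | ENNReal.ofReal (δ * x) < weightedSum Z θ ω} ⊆
      ⋃ j, ⋃ i : ℕ, {ω | x < Z j i ω * ((s₀ * u ^ i * θ j i ω : ℝ≥0) : ℝ)} := by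
    intro ω hω
    by_contra hno
    simp only [mem_iUnion, mem_ofPred_eq, not_exists, not_lt] at hno
    refine (lt_irrefl _ (lt_of_lt_of_le (mem_ofPred_eq ▸ hω) ?_))
    have hui : (u : ℝ)⁻¹ < 1 := inv_lt_one_of_one_lt₀ (by exact_mod_cast hu1)
    have hui0 : 0 ≤ (u : ℝ)⁻¹ := by positivity
    have hle : ∀ j i, ((Z j i ω * θ j i ω : ℝ≥0) : ℝ≥0∞) ≤
        ENNReal.ofReal (x / s₀ * (u : ℝ)⁻¹ ^ i) := by
      intro j i
      rw [← ENNReal.ofReal_coe_nnreal]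
      refine ENNReal.ofReal_le_ofReal ?_
      have := hno j i
      have hu0 : (0 : ℝ) < u := by positivity
      push_cast at this ⊢
      rw [inv_pow, ← div_eq_mul_inv, div_div, le_div_iff₀ (by positivity)]
      linarith
    have hsum : ∑' i : ℕ, ENNReal.ofReal (x / s₀ * (u : ℝ)⁻¹ ^ i) =
        ENNReal.ofReal (δ * x / n) := by
      rw [← ENNReal.ofReal_tsum_of_nonneg (fun i => by positivity)
        ((summable_geometric_of_lt_one hui0 hui).mul_left _), tsum_mul_left,
        tsum_geometric_of_lt_one hui0 hui]
      congr 1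
      have hu0 : (0 : ℝ) < u := by positivity
      have hu2 : (0 : ℝ) < u - 1 := by
        have : (1 : ℝ) < u := by exact_mod_cast hu1
        linarith
      have : (s₀ : ℝ) = n * u / (δ * (u - 1)) := by
        rw [hs₀]; push_cast [NNReal.coe_sub hu1.le]; rfl
      have hn0 : (0 : ℝ) < n := by positivity
      have hδ0 : (0 : ℝ) < δ := by positivity
      rw [this]
      field_simp
    calc weightedSum Z θ ω ≤ ∑ j : κ, ENNReal.ofReal (δ * x / n) :=
          Finset.sum_le_sum fun j _ => (ENNReal.tsum_le_tsum (hle j)).trans_eq hsum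
      _ = ENNReal.ofReal (Fintype.card κ * (δ * x / n)) := by
          rw [Finset.sum_const, nsmul_eq_mul, ENNReal.ofReal_mul (by positivity)]
          simp
      _ ≤ ENNReal.ofReal (δ * x) := by
          refine ENNReal.ofReal_le_ofReal ?_
          have hn0 : (0 : ℝ) < n := by positivity
          rw [← mul_div_assoc, div_le_iff₀ hn0, mul_comm]
          gcongr
          simp [hn]
  refine (measure_mono hsub).trans ((measure_iUnion_fintype_le _ _).trans ?_)
  refine Finset.sum_le_sum fun j _ => (measure_iUnion_le _).trans ?_
  rw [← ENNReal.tsum_mul_left, ← ENNReal.tsum_mul_left]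
  refine ENNReal.tsum_le_tsum fun i => ?_
  have hθi := hθ j i
  refine (hx j i _ (hθi.const_mul _)).trans ?_
  calc C * H j (Ioi x) * ∫⁻ ω, powSum lo hi (s₀ * u ^ i * θ j i ω) ∂μ
      ≤ C * H j (Ioi x) * ∫⁻ ω, ((s₀ * u ^ i : ℝ≥0) : ℝ≥0∞) ^ hi * powSum lo hi (θ j i ω) ∂μ := by
        gcongr with ω
        exact powSum_mul_le h.lo_pos.le (h.lo_lt.trans h.lt_hi).le (hs1 i) _
    _ = _ := by
        rw [lintegral_const_mul _ (hθi.mono h.le le_rfl).powSum,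
          ← ENNReal.coe_rpow_of_nonneg _ hhi.le, NNReal.mul_rpow, ← NNReal.rpow_natCast,
          ← NNReal.rpow_mul, mul_comm (i : ℝ), NNReal.rpow_mul, hur, NNReal.rpow_natCast]
        push_cast
        ring

end WeightedClaims

end Model

/-! ### Large weights and pairs of large claims -/

namespace WeightedClaims

variable {Ω κ : Type*} {m : MeasurableSpace Ω} [mΩ : MeasurableSpace Ω]
  {μ : Measure Ω}
  {Z σ W : κ → ℕ → Ω → ℝ≥0} {H : κ → Measure ℝ} {α lo hi : ℝ}

theorem lintegral_powSum_cutWeight (h : WeightedClaims m μ Z σ W H α lo hi) (t : ℝ≥0∞) (j : κ)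
    (i : ℕ) : ∫⁻ ω, powSum lo hi (cutWeight σ W t j i ω) ∂μ =
      ∫⁻ ω in {ω | (σ j i ω : ℝ≥0∞) ≤ t}, powSum lo hi (W j i ω) ∂μ :=
  h.lintegral_cutWeight t j i (powSum_zero h.lo_pos h.hi_pos)

theorem measure_time_le (h : WeightedClaims m μ Z σ W H α lo hi) (t : ℝ≥0∞) (j : κ) (i : ℕ) :
    μ {ω | (σ j i ω : ℝ≥0∞) ≤ t} ≤ μ {ω | (σ j 0 ω : ℝ≥0∞) ≤ t} :=
  measure_mono fun ω hω => le_trans (ENNReal.coe_le_coe.2 (h.time_le j i ω)) hω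

theorem exists_tsum_moment_le (h : WeightedClaims m μ Z σ W H α lo hi) :
    ∃ D : ℝ≥0, ∀ j t, ∑' i, ∫⁻ ω, powSum lo hi (cutWeight σ W t j i ω) ∂μ ≤
      D * μ {ω | (σ j 0 ω : ℝ≥0∞) ≤ t} := by
  obtain ⟨K, q, hq, hK⟩ := h.moment
  refine ⟨K * (1 - q)⁻¹, fun j t => ?_⟩
  calc _ ≤ ∑' i, K * μ {ω | (σ j 0 ω : ℝ≥0∞) ≤ t} * (q : ℝ≥0∞) ^ i :=
        ENNReal.tsum_le_tsum fun i => (h.lintegral_powSum_cutWeight t j i).trans_le (hK j i t)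
    _ = _ := by
      rw [ENNReal.tsum_mul_left, tsum_pow_le_coe hq]
      push_cast
      ring

theorem measurableSet_lt_mul (h : WeightedClaims m μ Z σ W H α lo hi) (x : ℝ) (t : ℝ≥0∞) (j : κ)
    (i : ℕ) : MeasurableSet {ω | x < Z j i ω * cutWeight σ W t j i ω} := by
  have h1 := h.measurable_claim j i
  have h2 := (h.measurable_cutWeight t j i).mono h.le le_rfl
  exact measurableSet_lt measurable_const (by fun_prop)

variable [Fintype κ]

theorem mul_measure_le_firstTerm (x : ℝ) (t : ℝ≥0∞) (j : κ) :
    H j (Ioi x) * μ {ω | (σ j 0 ω : ℝ≥0∞) ≤ t} ≤ firstTerm μ σ H x t :=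
  Finset.single_le_sum (f := fun j => H j (Ioi x) * μ {ω | (σ j 0 ω : ℝ≥0∞) ≤ t})
    (fun _ _ => zero_le) (Finset.mem_univ j)

/-- This turns errors relative to first arrivals into errors relative to the main term, uniformly in
`x` and `t`; it is where the `lower` bound enters. -/
theorem exists_firstTerm_le (h : WeightedClaims m μ Z σ W H α lo hi) :
    ∃ D : ℝ≥0, 0 < D ∧ ∀ x t, firstTerm μ σ H x t ≤ D * mainTerm μ σ W H α x t := by
  obtain ⟨c, hc, h1⟩ := h.lower
  refine ⟨c⁻¹, by positivity, fun x t => ?_⟩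
  have hα : 0 < α := h.lo_pos.trans h.lo_lt
  rw [firstTerm, mainTerm, Finset.mul_sum]
  refine Finset.sum_le_sum fun j _ => ?_
  have h2 := h1 j t
  rw [mul_left_comm]
  gcongr
  have h3 : ∀ i, ∫⁻ ω, (cutWeight σ W t j i ω : ℝ≥0∞) ^ α ∂μ =
      ∫⁻ ω in {ω | (σ j i ω : ℝ≥0∞) ≤ t}, (W j i ω : ℝ≥0∞) ^ α ∂μ := fun i =>
    h.lintegral_cutWeight t j i (g := fun w => (w : ℝ≥0∞) ^ α) (by simp [hα])
  simp_rw [h3]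
  calc μ {ω | (σ j 0 ω : ℝ≥0∞) ≤ t}
      = ((c⁻¹ : ℝ≥0) : ℝ≥0∞) * (c * μ {ω | (σ j 0 ω : ℝ≥0∞) ≤ t}) := by
        rw [← mul_assoc, ← ENNReal.coe_mul, inv_mul_cancel₀ hc.ne', ENNReal.coe_one, one_mul]
    _ ≤ _ := by gcongr

variable [IsProbabilityMeasure μ]

/-- Weights above a high level contribute little to the tail of a weighted claim. -/
theorem measure_lt_mul_truncated_le (h : WeightedClaims m μ Z σ W H α lo hi) {δ ε : ℝ≥0}
    (hδ : 0 < δ) (hδ1 : δ ≤ 1) (hε : 0 < ε) :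
    ∃ M : ℝ≥0, 1 ≤ M ∧ ∀ᶠ x : ℝ in atTop, ∀ j i t,
      μ {ω | δ * x < Z j i ω * cutWeight σ W t j i ω ∧ M < W j i ω} ≤
        ε * (H j (Ioi x) * μ {ω | (σ j 0 ω : ℝ≥0∞) ≤ t}) := by
  obtain ⟨K, q, hq, hK⟩ := h.moment
  have hhi := h.hi_pos
  -- Between `α` and `hi` there is room on both sides: Potter's bound holds with exponent `β`, and
  -- for weights above `M` the passage from `β` to `hi` gains `M ^ (β - hi)`.
  set β := (α + hi) / 2
  have hβ : α < β := by have := h.lt_hi; simp only [β]; linarith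
  have hβ' : β < hi := by have := h.lt_hi; simp only [β]; linarith
  have hlo0 := h.lo_pos
  have hlo := h.lo_lt
  obtain ⟨C, hC⟩ := h.measure_lt_mul_le hβ
  obtain ⟨M, hM, hM'⟩ := exists_mul_rpow_neg_le (C * δ⁻¹ ^ β * 2 * K) (sub_pos.2 hβ') hε
  refine ⟨M, hM, ?_⟩
  filter_upwards [hC] with x hx j i t
  have hmW := h.measurable_weight j i
  have hms : MeasurableSet[m] {ω | M < W j i ω} := hmW measurableSet_Ioi
  have hcut := h.measurable_cutWeight t j i
  have hθ : Measurable[m] ({ω | M < W j i ω}.indicator (cutWeight σ W t j i)) :=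
    Measurable.indicator hcut hms
  -- The restriction to large weights is moved into the weight, which stays measurable in `m` and
  -- hence independent of the claim.
  have hsub : {ω | δ * x < Z j i ω * cutWeight σ W t j i ω ∧ M < W j i ω} ⊆
      {ω | x < Z j i ω *
        ((δ⁻¹ * {ω | M < W j i ω}.indicator (cutWeight σ W t j i) ω : ℝ≥0) : ℝ)} := by
    rintro ω ⟨h1, h2⟩
    have hδ' : (0 : ℝ) < δ := by positivity
    rw [mem_ofPred_eq, indicator_of_mem (show ω ∈ {ω | M < W j i ω} from h2)]
    push_cast
    rw [mul_left_comm, inv_mul_eq_div, lt_div_iff₀ hδ']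
    linarith
  refine (measure_mono hsub).trans ((hx j i _ (hθ.const_mul _)).trans ?_)
  have hpt : ∀ ω, powSum lo β (δ⁻¹ * {ω | M < W j i ω}.indicator (cutWeight σ W t j i) ω) ≤
      ((δ⁻¹ : ℝ≥0) : ℝ≥0∞) ^ β * (2 * (M : ℝ≥0∞) ^ (β - hi)) *
        powSum lo hi (cutWeight σ W t j i ω) := by
    intro ω
    refine (powSum_mul_le hlo0.le (hlo.trans hβ).le ((one_le_inv₀ hδ).2 hδ1) _).trans ?_
    rw [mul_assoc]
    refine mul_le_mul' le_rfl ?_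
    by_cases hω : M < W j i ω
    · rw [indicator_of_mem (show ω ∈ {ω | M < W j i ω} from hω)]
      by_cases ht : (σ j i ω : ℝ≥0∞) ≤ t
      · have : cutWeight σ W t j i ω = W j i ω := by simp [cutWeight, ht]
        rw [this]
        refine (powSum_le_of_lt (hlo.trans hβ).le hβ'.le hM hω).trans ?_
        gcongr
        exact le_add_self
      · have : cutWeight σ W t j i ω = 0 := by simp [cutWeight, ht]
        rw [this, powSum_zero hlo0 (hlo0.trans (hlo.trans hβ))]
        exact zero_le
    · rw [indicator_of_notMem (show ω ∉ {ω | M < W j i ω} from hω),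
        powSum_zero hlo0 (hlo0.trans (hlo.trans hβ))]
      exact zero_le
  have hint : ∫⁻ ω, powSum lo hi (cutWeight σ W t j i ω) ∂μ ≤
      K * μ {ω | (σ j 0 ω : ℝ≥0∞) ≤ t} := by
    rw [h.lintegral_powSum_cutWeight]
    refine (hK j i t).trans (mul_le_of_le_one_right zero_le ?_)
    exact pow_le_one₀ zero_le (by exact_mod_cast hq.le)
  calc _ ≤ C * H j (Ioi x) * ∫⁻ ω, ((δ⁻¹ : ℝ≥0) : ℝ≥0∞) ^ β * (2 * (M : ℝ≥0∞) ^ (β - hi)) *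
        powSum lo hi (cutWeight σ W t j i ω) ∂μ := by gcongr with ω; exact hpt ω
    _ ≤ C * H j (Ioi x) * (((δ⁻¹ : ℝ≥0) : ℝ≥0∞) ^ β * (2 * (M : ℝ≥0∞) ^ (β - hi)) *
        (K * μ {ω | (σ j 0 ω : ℝ≥0∞) ≤ t})) := by
      rw [lintegral_const_mul _ (hcut.mono h.le le_rfl).powSum]
      gcongr
    _ = (((C * δ⁻¹ ^ β * 2 * K : ℝ≥0) : ℝ≥0∞) * (M : ℝ≥0∞) ^ (-(hi - β))) *
        (H j (Ioi x) * μ {ω | (σ j 0 ω : ℝ≥0∞) ≤ t}) := by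
      rw [neg_sub, ← ENNReal.coe_rpow_of_nonneg _ (hlo0.trans (hlo.trans hβ)).le]
      push_cast
      ring
    _ ≤ _ := by gcongr

/-- Two distinct weighted claims are unlikely to be large simultaneously. -/
theorem measure_pair_le (h : WeightedClaims m μ Z σ W H α lo hi) {δ ε : ℝ≥0}
    (hδ : 0 < δ) (hδ1 : δ ≤ 1) (hε : 0 < ε) {a b : κ × ℕ} (hab : a ≠ b) :
    ∀ᶠ x : ℝ in atTop, ∀ t,
      μ ({ω | δ * x < Z a.1 a.2 ω * cutWeight σ W t a.1 a.2 ω} ∩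
        {ω | δ * x < Z b.1 b.2 ω * cutWeight σ W t b.1 b.2 ω}) ≤ ε * firstTerm μ σ H x t := by
  have hp := h.isProbabilityMeasure
  obtain ⟨M, hM, hM'⟩ := h.measure_lt_mul_truncated_le hδ hδ1 (show 0 < ε / 3 by positivity)
  have hM0 : (0 : ℝ) < M := NNReal.coe_pos.2 (zero_lt_one.trans_le hM)
  have hδ0 : (0 : ℝ) < δ := by positivity
  -- If both weights are at most `M`, both claims exceed `s * x`, and only the joint tail of the
  -- claims matters. The constant `r` below eventually bounds the ratio of the tails at `s * x` and
  -- `x`.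
  set s : ℝ := δ / M with hs
  have hs0 : 0 < s := by positivity
  set r : ℝ := s ^ (-α) + 1 with hr
  have hr0 : 0 < r := by positivity
  have hj := (h.asympIndep a b hab).joint_tail (h.measurable_claim _ _) (h.measurable_claim _ _)
    (fun x => by rw [h.law]; exact (h.regVarying a.1).tailProb_pos x)
    (by rw [h.law, h.law]; exact h.isBigO _ _) (show 0 < (ε / 3 : ℝ) / r by positivity)
  rw [h.law] at hj
  have hj' := (tendsto_id.const_mul_atTop hs0).eventually hj
  filter_upwards [hM', hj', (h.regVarying a.1).measure_Ioi_mul_le hs0 (lt_add_one (s ^ (-α))),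
    eventually_gt_atTop 0] with x hxM hxj hxr hx0 t
  have hsub : {ω | δ * x < Z a.1 a.2 ω * cutWeight σ W t a.1 a.2 ω} ∩
      {ω | δ * x < Z b.1 b.2 ω * cutWeight σ W t b.1 b.2 ω} ⊆
      ({ω | δ * x < Z a.1 a.2 ω * cutWeight σ W t a.1 a.2 ω ∧ M < W a.1 a.2 ω} ∪
      {ω | δ * x < Z b.1 b.2 ω * cutWeight σ W t b.1 b.2 ω ∧ M < W b.1 b.2 ω}) ∪
      ({ω | s * x < Z a.1 a.2 ω ∧ s * x < Z b.1 b.2 ω} ∩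
        {ω | (σ a.1 a.2 ω : ℝ≥0∞) ≤ t}) := by
    rintro ω ⟨h1, h2⟩
    by_cases ha : M < W a.1 a.2 ω
    · exact Or.inl (Or.inl ⟨h1, ha⟩)
    by_cases hb : M < W b.1 b.2 ω
    · exact Or.inl (Or.inr ⟨h2, hb⟩)
    have key : ∀ c : κ × ℕ, δ * x < Z c.1 c.2 ω * cutWeight σ W t c.1 c.2 ω →
        ¬ M < W c.1 c.2 ω → s * x < Z c.1 c.2 ω ∧ (σ c.1 c.2 ω : ℝ≥0∞) ≤ t := by
      intro c hc hcM
      by_cases ht : (σ c.1 c.2 ω : ℝ≥0∞) ≤ t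
      · have : cutWeight σ W t c.1 c.2 ω = W c.1 c.2 ω := by simp [cutWeight, ht]
        rw [this] at hc
        have hWM : (W c.1 c.2 ω : ℝ) ≤ M := by exact_mod_cast not_lt.1 hcM
        refine ⟨?_, ht⟩
        rw [hs, div_mul_eq_mul_div, div_lt_iff₀ hM0]
        exact hc.trans_le (by gcongr)
      · have : cutWeight σ W t c.1 c.2 ω = 0 := by simp [cutWeight, ht]
        rw [this] at hc
        have : 0 < δ * x := by positivity
        simp at hc
        linarith
    exact Or.inr ⟨⟨(key a h1 ha).1, (key b h2 hb).1⟩, (key a h1 ha).2⟩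
  refine (measure_mono hsub).trans ?_
  -- The event that the first of the two claims has arrived is kept: independence turns it into the
  -- factor that makes the bound comparable with `firstTerm` even when arrivals by time `t` are
  -- rare.
  have hind : μ ({ω | s * x < Z a.1 a.2 ω ∧ s * x < Z b.1 b.2 ω} ∩
      {ω | (σ a.1 a.2 ω : ℝ≥0∞) ≤ t}) =
      μ {ω | s * x < Z a.1 a.2 ω ∧ s * x < Z b.1 b.2 ω} * μ {ω | (σ a.1 a.2 ω : ℝ≥0∞) ≤ t} := by
    refine (Indep_iff _ _ μ).1 h.indep _ _ ?_ (h.measurableSet_time t a.1 a.2)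
    refine ⟨{z | s * x < z a ∧ s * x < z b}, ?_, rfl⟩
    exact (measurableSet_lt measurable_const (measurable_pi_apply a).coe_nnreal_real).inter
      (measurableSet_lt measurable_const (measurable_pi_apply b).coe_nnreal_real)
  have hjoint : μ {ω | s * x < Z a.1 a.2 ω ∧ s * x < Z b.1 b.2 ω} ≤
      (ε / 3 : ℝ≥0) * H a.1 (Ioi x) := by
    rw [← ofReal_measureReal]
    calc _ ≤ ENNReal.ofReal ((ε / 3 : ℝ) / r * tailProb (H a.1) (s * x)) :=
          ENNReal.ofReal_le_ofReal hxj
      _ = ENNReal.ofReal ((ε / 3 : ℝ) / r) * H a.1 (Ioi (s * x)) := by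
          rw [ENNReal.ofReal_mul (by positivity), ofReal_tailProb]
      _ ≤ ENNReal.ofReal ((ε / 3 : ℝ) / r) * (ENNReal.ofReal r * H a.1 (Ioi x)) := by gcongr
      _ = _ := by
        rw [← mul_assoc, ← ENNReal.ofReal_mul (by positivity), div_mul_cancel₀ _ hr0.ne']
        congr 1
        exact (ENNReal.ofReal_coe_nnreal (p := ε / 3))
  have e1 := mul_measure_le_firstTerm (μ := μ) (σ := σ) (H := H) x t a.1
  have e2 := mul_measure_le_firstTerm (μ := μ) (σ := σ) (H := H) x t b.1
  calc _ ≤ (μ {ω | δ * x < Z a.1 a.2 ω * cutWeight σ W t a.1 a.2 ω ∧ M < W a.1 a.2 ω} +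
      μ {ω | δ * x < Z b.1 b.2 ω * cutWeight σ W t b.1 b.2 ω ∧ M < W b.1 b.2 ω}) +
      μ ({ω | s * x < Z a.1 a.2 ω ∧ s * x < Z b.1 b.2 ω} ∩
        {ω | (σ a.1 a.2 ω : ℝ≥0∞) ≤ t}) :=
      (measure_union_le _ _).trans (add_le_add_left (measure_union_le _ _) _)
    _ ≤ ((ε / 3 : ℝ≥0) * firstTerm μ σ H x t + (ε / 3 : ℝ≥0) * firstTerm μ σ H x t) +
      (ε / 3 : ℝ≥0) * firstTerm μ σ H x t := by
      rw [hind]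
      gcongr ?_ + ?_ + ?_
      · exact (hxM a.1 a.2 t).trans (by gcongr)
      · exact (hxM b.1 b.2 t).trans (by gcongr)
      · calc _ ≤ (ε / 3 : ℝ≥0) * H a.1 (Ioi x) * μ {ω | (σ a.1 0 ω : ℝ≥0∞) ≤ t} :=
              mul_le_mul' hjoint (h.measure_time_le t a.1 a.2)
          _ ≤ _ := by
              rw [mul_assoc]
              gcongr
    _ = ε * firstTerm μ σ H x t := by
      rw [← add_mul, ← add_mul, ← ENNReal.coe_add, ← ENNReal.coe_add, add_thirds]

end WeightedClaims

/-! ### Two-sided bounds for the tail of the weighted sum -/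

namespace WeightedClaims

variable {Ω κ : Type*} [Fintype κ]

theorem weightedSum_eq_sum_add (Z θ : κ → ℕ → Ω → ℝ≥0) (N : ℕ) (ω : Ω) :
    weightedSum Z θ ω =
      ((∑ a ∈ Finset.univ ×ˢ Finset.range N, Z a.1 a.2 ω * θ a.1 a.2 ω : ℝ≥0) : ℝ≥0∞) +
        weightedSum Z (fun j i ω => if N ≤ i then θ j i ω else 0) ω := by
  rw [weightedSum, weightedSum, Finset.sum_product, ENNReal.ofNNReal_finsetSum,
    ← Finset.sum_add_distrib]
  refine Finset.sum_congr rfl fun j _ => ?_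
  rw [tsum_eq_sum_range_add_tsum_ite _ N, ENNReal.ofNNReal_finsetSum]
  congr 1
  refine tsum_congr fun i => ?_
  split_ifs <;> simp

theorem le_weightedSum (Z θ : κ → ℕ → Ω → ℝ≥0) (j : κ) (i : ℕ) (ω : Ω) :
    ((Z j i ω * θ j i ω : ℝ≥0) : ℝ≥0∞) ≤ weightedSum Z θ ω :=
  (ENNReal.le_tsum (f := fun i => ((Z j i ω * θ j i ω : ℝ≥0) : ℝ≥0∞)) i).trans
    (Finset.single_le_sum (f := fun j => ∑' i, ((Z j i ω * θ j i ω : ℝ≥0) : ℝ≥0∞))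
      (fun _ _ => zero_le) (Finset.mem_univ j))

variable {m : MeasurableSpace Ω} [mΩ : MeasurableSpace Ω] {μ : Measure Ω}
  {Z σ W : κ → ℕ → Ω → ℝ≥0} {H : κ → Measure ℝ} {α lo hi : ℝ}

theorem sum_moment_le {D : ℝ≥0}
    (hD : ∀ j t, ∑' i, ∫⁻ ω, powSum lo hi (cutWeight σ W t j i ω) ∂μ ≤
      D * μ {ω | (σ j 0 ω : ℝ≥0∞) ≤ t}) (N : ℕ) (x : ℝ) (t : ℝ≥0∞) :
    ∑ a ∈ Finset.univ ×ˢ Finset.range N,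
      H a.1 (Ioi x) * ∫⁻ ω, powSum lo hi (cutWeight σ W t a.1 a.2 ω) ∂μ ≤
      D * firstTerm μ σ H x t := by
  rw [Finset.sum_product, firstTerm, Finset.mul_sum]
  refine Finset.sum_le_sum fun j _ => ?_
  dsimp only
  rw [← Finset.mul_sum, mul_left_comm]
  gcongr
  exact (ENNReal.sum_le_tsum _).trans (hD j t)

theorem sum_le_mainTerm (N : ℕ) (x : ℝ) (t : ℝ≥0∞) :
    ∑ a ∈ Finset.univ ×ˢ Finset.range N,
      H a.1 (Ioi x) * ∫⁻ ω, (cutWeight σ W t a.1 a.2 ω : ℝ≥0∞) ^ α ∂μ ≤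
      mainTerm μ σ W H α x t := by
  rw [Finset.sum_product, mainTerm]
  refine Finset.sum_le_sum fun j _ => ?_
  dsimp only
  rw [← Finset.mul_sum]
  gcongr
  exact ENNReal.sum_le_tsum _

theorem exists_mainTerm_le_sum_add (h : WeightedClaims m μ Z σ W H α lo hi) {ε : ℝ≥0}
    (hε : 0 < ε) :
    ∃ N : ℕ, ∀ x t, mainTerm μ σ W H α x t ≤ ∑ a ∈ Finset.univ ×ˢ Finset.range N,
      H a.1 (Ioi x) * ∫⁻ ω, (cutWeight σ W t a.1 a.2 ω : ℝ≥0∞) ^ α ∂μ +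
        ε * firstTerm μ σ H x t := by
  obtain ⟨K, q, hq, hK⟩ := h.moment
  obtain ⟨N, hN⟩ := exists_tsum_pow_ite_le hq
    (show (0 : ℝ≥0∞) < (ε / (K + 1) : ℝ≥0) from ENNReal.coe_pos.2 (by positivity))
  refine ⟨N, fun x t => ?_⟩
  rw [Finset.sum_product, mainTerm, firstTerm, Finset.mul_sum, ← Finset.sum_add_distrib]
  refine Finset.sum_le_sum fun j _ => ?_
  rw [tsum_eq_sum_range_add_tsum_ite _ N, mul_add, Finset.mul_sum, mul_left_comm (ε : ℝ≥0∞)]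
  gcongr
  calc _ ≤ ∑' i, K * μ {ω | (σ j 0 ω : ℝ≥0∞) ≤ t} * (if N ≤ i then (q : ℝ≥0∞) ^ i else 0) := by
        refine ENNReal.tsum_le_tsum fun i => ?_
        split_ifs
        · refine (lintegral_mono fun ω => rpow_le_powSum h.lo_lt.le h.lt_hi.le _).trans ?_
          exact (h.lintegral_powSum_cutWeight t j i).trans_le (hK j i t)
        · simp
    _ ≤ K * μ {ω | (σ j 0 ω : ℝ≥0∞) ≤ t} * (ε / (K + 1) : ℝ≥0) := by
        rw [ENNReal.tsum_mul_left]
        gcongr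
    _ = ((K * (ε / (K + 1)) : ℝ≥0) : ℝ≥0∞) * μ {ω | (σ j 0 ω : ℝ≥0∞) ≤ t} := by
        push_cast; ring
    _ ≤ ε * μ {ω | (σ j 0 ω : ℝ≥0∞) ≤ t} := by
        gcongr
        rw [mul_div_left_comm]
        exact mul_le_of_le_one_right zero_le (div_le_one_of_le₀ (by simp) (by simp))

variable [IsProbabilityMeasure μ]

/-- The claims with large index contribute little to the tail of the weighted sum. -/
theorem exists_measure_tail_le (h : WeightedClaims m μ Z σ W H α lo hi) {δ ε : ℝ≥0}
    (hδ : 0 < δ) (hδ1 : δ ≤ 1) (hε : 0 < ε) :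
    ∃ N : ℕ, ∀ᶠ x : ℝ in atTop, ∀ t,
      μ {ω | ENNReal.ofReal (δ * x) <
        weightedSum Z (fun j i ω => if N ≤ i then cutWeight σ W t j i ω else 0) ω} ≤
      ε * firstTerm μ σ H x t := by
  obtain ⟨K, q, hq, hK⟩ := h.moment
  -- Any `r` with `1 < r` and `r * q < 1` would do; this choice also covers `q = 0`. The union bound
  -- inflates the i-th moment by `r ^ i`, and the product still decays geometrically.
  set r : ℝ≥0 := 2 / (1 + q) with hr
  have hr1 : 1 < r := by
    rw [hr, one_lt_div (by positivity), ← one_add_one_eq_two]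
    gcongr
  have hrq : r * q < 1 := by
    rw [hr, div_mul_eq_mul_div, div_lt_one (by positivity), two_mul]
    gcongr
  obtain ⟨C, hC⟩ := h.measure_weightedSum_le hr1 hδ hδ1
  obtain ⟨N, hN⟩ := exists_tsum_pow_ite_le hrq
    (show (0 : ℝ≥0∞) < (ε / (C * K + 1) : ℝ≥0) from ENNReal.coe_pos.2 (by positivity))
  refine ⟨N, ?_⟩
  filter_upwards [hC] with x hx t
  have hmeas : ∀ j i, Measurable[m] fun ω => if N ≤ i then cutWeight σ W t j i ω else 0 := by
    intro j i
    split_ifs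
    · exact h.measurable_cutWeight t j i
    · exact measurable_const
  refine (hx (fun j i ω => if N ≤ i then cutWeight σ W t j i ω else 0) hmeas).trans ?_
  rw [firstTerm, Finset.mul_sum]
  refine Finset.sum_le_sum fun j _ => ?_
  rw [mul_left_comm (ε : ℝ≥0∞)]
  refine mul_le_mul' le_rfl ?_
  calc _ ≤ (C : ℝ≥0∞) * ∑' i, K * μ {ω | (σ j 0 ω : ℝ≥0∞) ≤ t} *
          (if N ≤ i then ((r * q : ℝ≥0) : ℝ≥0∞) ^ i else 0) := by
        refine mul_le_mul' le_rfl (ENNReal.tsum_le_tsum fun i => ?_)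
        split_ifs
        · calc _ ≤ (r : ℝ≥0∞) ^ i * (K * μ {ω | (σ j 0 ω : ℝ≥0∞) ≤ t} * (q : ℝ≥0∞) ^ i) := by
                gcongr
                exact (h.lintegral_powSum_cutWeight t j i).trans_le (hK j i t)
            _ = _ := by push_cast; ring
        · simp [powSum_zero h.lo_pos h.hi_pos]
    _ ≤ C * (K * μ {ω | (σ j 0 ω : ℝ≥0∞) ≤ t} * (ε / (C * K + 1) : ℝ≥0)) := by
        rw [ENNReal.tsum_mul_left]
        gcongr
    _ = ((C * K * (ε / (C * K + 1)) : ℝ≥0) : ℝ≥0∞) * μ {ω | (σ j 0 ω : ℝ≥0∞) ≤ t} := by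
        push_cast; ring
    _ ≤ ε * μ {ω | (σ j 0 ω : ℝ≥0∞) ≤ t} := by
        gcongr
        rw [mul_div_left_comm]
        exact mul_le_of_le_one_right zero_le (div_le_one_of_le₀ (by simp) (by simp))

theorem sum_pair_le (h : WeightedClaims m μ Z σ W H α lo hi) {δ ε : ℝ≥0}
    (hδ : 0 < δ) (hδ1 : δ ≤ 1) (hε : 0 < ε) (A : Finset (κ × ℕ)) [DecidableEq (κ × ℕ)] :
    ∀ᶠ x : ℝ in atTop, ∀ t, ∑ p ∈ A.offDiag,
      μ ({ω | δ * x < Z p.1.1 p.1.2 ω * cutWeight σ W t p.1.1 p.1.2 ω} ∩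
        {ω | δ * x < Z p.2.1 p.2.2 ω * cutWeight σ W t p.2.1 p.2.2 ω}) ≤
      ε * firstTerm μ σ H x t := by
  have hε' : 0 < ε / (A.offDiag.card + 1) := by positivity
  have := (Filter.eventually_all_finset A.offDiag).2 fun p hp =>
    h.measure_pair_le hδ hδ1 hε' (Finset.mem_offDiag.1 hp).2.2
  filter_upwards [this] with x hx t
  refine (Finset.sum_le_card_nsmul _ _ _ fun p hp => hx p hp t).trans ?_
  rw [nsmul_eq_mul, ← mul_assoc]
  gcongr
  have : (A.offDiag.card : ℝ≥0) * (ε / (A.offDiag.card + 1)) ≤ ε := by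
    rw [mul_div_left_comm]
    exact mul_le_of_le_one_right zero_le (div_le_one_of_le₀ (by simp) (by simp))
  exact_mod_cast this

/-- One claim exceeding `x` suffices, so Bonferroni's inequality applies to the first `N` claims of
each line. The three errors (late arrivals, pairs, Breiman's lemma) are each at most `ε₁ *
firstTerm`, whence the 3 in the choice of `ε₁`. -/
theorem mainTerm_le_measure_add (h : WeightedClaims m μ Z σ W H α lo hi) {ε : ℝ≥0} (hε : 0 < ε) :
    ∀ᶠ x : ℝ in atTop, ∀ t, mainTerm μ σ W H α x t ≤
      μ {ω | ENNReal.ofReal x < weightedSum Z (cutWeight σ W t) ω} +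
        ε * mainTerm μ σ W H α x t := by
  classical
  obtain ⟨D, hD0, hD⟩ := h.exists_firstTerm_le
  obtain ⟨D', hD'⟩ := h.exists_tsum_moment_le
  set ε₁ := ε / (3 * D) with hε₁
  have hε₁0 : 0 < ε₁ := by positivity
  obtain ⟨N, hN⟩ := h.exists_mainTerm_le_sum_add hε₁0
  set A : Finset (κ × ℕ) := Finset.univ ×ˢ Finset.range N with hA
  have hε₂0 : 0 < ε₁ / (D' + 1) := by positivity
  filter_upwards [h.measure_lt_mul_approx hε₂0, h.sum_pair_le one_pos le_rfl hε₁0 A,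
    eventually_gt_atTop 0] with x hx1 hx2 hx0 t
  have hx2 := hx2 t
  simp only [NNReal.coe_one, one_mul] at hx2
  have hB := sum_measure_le_measure_biUnion_add (μ := μ) A
    (E := fun a => {ω | x < Z a.1 a.2 ω * cutWeight σ W t a.1 a.2 ω})
    fun a => h.measurableSet_lt_mul x t a.1 a.2
  have hU : (⋃ a ∈ A, {ω | x < Z a.1 a.2 ω * cutWeight σ W t a.1 a.2 ω}) ⊆
      {ω | ENNReal.ofReal x < weightedSum Z (cutWeight σ W t) ω} := by
    refine iUnion₂_subset fun a _ ω hω => ?_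
    refine lt_of_lt_of_le ?_ (le_weightedSum Z (cutWeight σ W t) a.1 a.2 ω)
    rw [← ENNReal.ofReal_coe_nnreal]
    exact (ENNReal.ofReal_lt_ofReal_iff_of_nonneg hx0.le).2 (by exact_mod_cast hω)
  calc mainTerm μ σ W H α x t
      ≤ ∑ a ∈ A, H a.1 (Ioi x) * ∫⁻ ω, (cutWeight σ W t a.1 a.2 ω : ℝ≥0∞) ^ α ∂μ +
        ε₁ * firstTerm μ σ H x t := hN x t
    _ ≤ ∑ a ∈ A, (μ {ω | x < Z a.1 a.2 ω * cutWeight σ W t a.1 a.2 ω} +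
        (ε₁ / (D' + 1) : ℝ≥0) *
          (H a.1 (Ioi x) * ∫⁻ ω, powSum lo hi (cutWeight σ W t a.1 a.2 ω) ∂μ)) +
        ε₁ * firstTerm μ σ H x t := by
      gcongr with a
      refine (hx1 a.1 a.2 _ (h.measurable_cutWeight t a.1 a.2)).2.trans_eq ?_
      rw [mul_left_comm]
    _ ≤ (μ {ω | ENNReal.ofReal x < weightedSum Z (cutWeight σ W t) ω} +
        ε₁ * firstTerm μ σ H x t +
        (ε₁ / (D' + 1) : ℝ≥0) * (D' * firstTerm μ σ H x t)) + ε₁ * firstTerm μ σ H x t := by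
      rw [Finset.sum_add_distrib, ← Finset.mul_sum]
      gcongr
      · exact hB.trans (add_le_add (measure_mono hU) hx2)
      · exact sum_moment_le hD' N x t
    _ ≤ (μ {ω | ENNReal.ofReal x < weightedSum Z (cutWeight σ W t) ω} +
        ε₁ * firstTerm μ σ H x t + ε₁ * firstTerm μ σ H x t) + ε₁ * firstTerm μ σ H x t := by
      gcongr _ + _ + ?_ + _
      rw [← mul_assoc]
      gcongr
      have : ε₁ / (D' + 1) * D' ≤ ε₁ := by
        rw [div_mul_eq_mul_div, mul_div_assoc]
        exact mul_le_of_le_one_right zero_le (div_le_one_of_le₀ (by simp) (by simp))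
      exact_mod_cast this
    _ = μ {ω | ENNReal.ofReal x < weightedSum Z (cutWeight σ W t) ω} +
        ((3 * ε₁ : ℝ≥0) : ℝ≥0∞) * firstTerm μ σ H x t := by
      push_cast; ring
    _ ≤ μ {ω | ENNReal.ofReal x < weightedSum Z (cutWeight σ W t) ω} +
        ((3 * ε₁ : ℝ≥0) : ℝ≥0∞) * (D * mainTerm μ σ W H α x t) := by
      gcongr
      exact hD x t
    _ = _ := by
      rw [← mul_assoc, ← ENNReal.coe_mul]
      congr 3
      rw [hε₁]
      field_simp

/-- If the sum exceeds `x`, then either the late claims contribute more than `δ / 2 * x`, or two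
early ones exceed `ρ * x`, or one early claim exceeds `(1 - δ) * x`. The first two cases are
negligible, and the third is governed by Breiman's lemma with slightly enlarged weights. -/
theorem measure_le_mainTerm (h : WeightedClaims m μ Z σ W H α lo hi) {ε : ℝ≥0} (hε : 0 < ε) :
    ∀ᶠ x : ℝ in atTop, ∀ t, μ {ω | ENNReal.ofReal x < weightedSum Z (cutWeight σ W t) ω} ≤
      (1 + ε) * mainTerm μ σ W H α x t := by
  classical
  have hα : 0 < α := h.lo_pos.trans h.lo_lt
  have hhi := h.hi_pos
  obtain ⟨D, hD0, hD⟩ := h.exists_firstTerm_le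
  obtain ⟨D', hD'⟩ := h.exists_tsum_moment_le
  set ε₁ := ε / (4 * D) with hε₁
  have hε₁0 : 0 < ε₁ := by positivity
  -- Replacing the threshold `x` by `(1 - δ) * x = x / s` multiplies the main term by `s ^ α = 1 + ε
  -- / 4`.
  set s : ℝ≥0 := (1 + ε / 4) ^ (1 / α) with hs
  have hsα : s ^ α = 1 + ε / 4 := by
    rw [hs, ← NNReal.rpow_mul, one_div_mul_cancel hα.ne', NNReal.rpow_one]
  have hs1 : 1 < s := NNReal.one_lt_rpow (by simp [hε]) (by positivity)
  have hs0 : (0 : ℝ) < s := by positivity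
  set δ : ℝ≥0 := 1 - s⁻¹ with hδ
  have hsi : s⁻¹ < 1 := inv_lt_one_of_one_lt₀ hs1
  have hδ0 : 0 < δ := tsub_pos_of_lt hsi
  have hδ1 : δ < 1 := tsub_lt_self one_pos (by positivity)
  have hδs : (1 - δ : ℝ) = (s : ℝ)⁻¹ := by
    rw [hδ, NNReal.coe_sub hsi.le]
    push_cast
    ring
  obtain ⟨N, hN⟩ := h.exists_measure_tail_le (show 0 < δ / 2 by positivity)
    ((half_le_self zero_le).trans hδ1.le) hε₁0
  set A : Finset (κ × ℕ) := Finset.univ ×ˢ Finset.range N with hA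
  -- Early claims that all stay below `ρ * x` add up to at most `δ / 2 * x`.
  set ρ : ℝ≥0 := δ / 2 / (A.card + 1) with hρ
  have hρ0 : 0 < ρ := by positivity
  have hρ1 : ρ ≤ 1 := (div_le_self zero_le (by simp)).trans ((half_le_self zero_le).trans hδ1.le)
  have hρA : (ρ : ℝ) * A.card ≤ δ / 2 := by
    have : ρ * A.card ≤ δ / 2 := by
      rw [hρ, div_mul_eq_mul_div, mul_div_assoc]
      exact mul_le_of_le_one_right zero_le (div_le_one_of_le₀ (by simp) (by simp))
    exact_mod_cast this
  -- Chosen to absorb both the scaling factor `s ^ hi` and the constant `D'` of the summed moments.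
  set ε₂ := ε₁ / (s ^ hi * D' + 1) with hε₂
  have hε₂0 : 0 < ε₂ := by positivity
  filter_upwards [h.measure_lt_mul_approx hε₂0, h.sum_pair_le hρ0 hρ1 hε₁0 A, hN,
    eventually_gt_atTop 0] with x hx1 hx2 hx3 hx0 t
  have hx2 := hx2 t
  have hx3 := hx3 t
  have hsub : {ω | ENNReal.ofReal x < weightedSum Z (cutWeight σ W t) ω} ⊆
      ((⋃ a ∈ A, {ω | x < Z a.1 a.2 ω * ((s * cutWeight σ W t a.1 a.2 ω : ℝ≥0) : ℝ)}) ∪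
      (⋃ p ∈ A.offDiag, ({ω | ρ * x < Z p.1.1 p.1.2 ω * cutWeight σ W t p.1.1 p.1.2 ω} ∩
        {ω | ρ * x < Z p.2.1 p.2.2 ω * cutWeight σ W t p.2.1 p.2.2 ω}))) ∪
      {ω | ENNReal.ofReal ((δ / 2 : ℝ≥0) * x) <
        weightedSum Z (fun j i ω => if N ≤ i then cutWeight σ W t j i ω else 0) ω} := by
    intro ω hω
    by_cases hT : ENNReal.ofReal ((δ / 2 : ℝ≥0) * x) <
        weightedSum Z (fun j i ω => if N ≤ i then cutWeight σ W t j i ω else 0) ω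
    · exact Or.inr hT
    refine Or.inl ?_
    by_cases hP : ω ∈ ⋃ p ∈ A.offDiag,
        ({ω | ρ * x < Z p.1.1 p.1.2 ω * cutWeight σ W t p.1.1 p.1.2 ω} ∩
        {ω | ρ * x < Z p.2.1 p.2.2 ω * cutWeight σ W t p.2.1 p.2.2 ω})
    · exact Or.inr hP
    refine Or.inl ?_
    have hsum : (1 - δ / 2 : ℝ) * x < ∑ a ∈ A, (Z a.1 a.2 ω * cutWeight σ W t a.1 a.2 ω : ℝ) := by
      have h1 : ENNReal.ofReal x < ENNReal.ofReal
          (∑ a ∈ A, (Z a.1 a.2 ω * cutWeight σ W t a.1 a.2 ω : ℝ) + (δ / 2 : ℝ≥0) * x) := by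
        rw [ENNReal.ofReal_add (by positivity) (by positivity)]
        refine lt_of_lt_of_le (mem_ofPred_eq ▸ hω) ?_
        rw [weightedSum_eq_sum_add _ _ N]
        refine add_le_add (le_of_eq ?_) (not_lt.1 hT)
        rw [← ENNReal.ofReal_coe_nnreal]
        push_cast
        rfl
      have h2 := (ENNReal.ofReal_lt_ofReal_iff_of_nonneg hx0.le).1 h1
      push_cast at h2
      linarith
    obtain ⟨a, ha, hav⟩ := exists_lt_of_lt_sum A
      (fun a => (Z a.1 a.2 ω * cutWeight σ W t a.1 a.2 ω : ℝ)) hx0 (by exact_mod_cast hδ1)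
      (NNReal.coe_pos.2 hρ0) hρA hsum (fun a ha b hb hab h1 h2 =>
        hP (mem_iUnion₂.2 ⟨(a, b), Finset.mem_offDiag.2 ⟨ha, hb, hab⟩, h1, h2⟩))
    refine mem_iUnion₂.2 ⟨a, ha, ?_⟩
    rw [hδs, inv_mul_lt_iff₀ hs0] at hav
    rw [mem_ofPred_eq]
    push_cast
    linarith
  have hE : ∀ a : κ × ℕ, μ {ω | x < Z a.1 a.2 ω * ((s * cutWeight σ W t a.1 a.2 ω : ℝ≥0) : ℝ)} ≤
      (1 + (ε / 4 : ℝ≥0)) *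
        (H a.1 (Ioi x) * ∫⁻ ω, (cutWeight σ W t a.1 a.2 ω : ℝ≥0∞) ^ α ∂μ) +
      (ε₂ * s ^ hi : ℝ≥0) *
        (H a.1 (Ioi x) * ∫⁻ ω, powSum lo hi (cutWeight σ W t a.1 a.2 ω) ∂μ) := by
    intro a
    have hmc := h.measurable_cutWeight t a.1 a.2
    have hmc' := hmc.mono h.le le_rfl
    refine (hx1 a.1 a.2 _ (hmc.const_mul s)).1.trans ?_
    have e1 : ∫⁻ ω, ((s * cutWeight σ W t a.1 a.2 ω : ℝ≥0) : ℝ≥0∞) ^ α ∂μ =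
        (1 + (ε / 4 : ℝ≥0)) * ∫⁻ ω, (cutWeight σ W t a.1 a.2 ω : ℝ≥0∞) ^ α ∂μ := by
      rw [← lintegral_const_mul _ (by fun_prop)]
      refine lintegral_congr fun ω => ?_
      rw [ENNReal.coe_mul, ENNReal.mul_rpow_of_nonneg _ _ hα.le,
        ← ENNReal.coe_rpow_of_nonneg _ hα.le, hsα]
      push_cast
      rfl
    have e2 : ∫⁻ ω, powSum lo hi (s * cutWeight σ W t a.1 a.2 ω) ∂μ ≤
        (s ^ hi : ℝ≥0) * ∫⁻ ω, powSum lo hi (cutWeight σ W t a.1 a.2 ω) ∂μ := by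
      rw [← lintegral_const_mul _ hmc'.powSum]
      refine lintegral_mono fun ω => ?_
      rw [ENNReal.coe_rpow_of_nonneg _ hhi.le]
      exact powSum_mul_le h.lo_pos.le (h.lo_lt.trans h.lt_hi).le hs1.le _
    calc _ ≤ H a.1 (Ioi x) * ((1 + (ε / 4 : ℝ≥0)) *
          ∫⁻ ω, (cutWeight σ W t a.1 a.2 ω : ℝ≥0∞) ^ α ∂μ + ε₂ * ((s ^ hi : ℝ≥0) *
          ∫⁻ ω, powSum lo hi (cutWeight σ W t a.1 a.2 ω) ∂μ)) := by
          rw [e1]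
          gcongr
      _ = _ := by push_cast; ring
  calc _ ≤ (∑ a ∈ A, μ {ω | x < Z a.1 a.2 ω * ((s * cutWeight σ W t a.1 a.2 ω : ℝ≥0) : ℝ)} +
      ∑ p ∈ A.offDiag, μ ({ω | ρ * x < Z p.1.1 p.1.2 ω * cutWeight σ W t p.1.1 p.1.2 ω} ∩
        {ω | ρ * x < Z p.2.1 p.2.2 ω * cutWeight σ W t p.2.1 p.2.2 ω})) +
      ε₁ * firstTerm μ σ H x t := by
        refine (measure_mono hsub).trans ((measure_union_le _ _).trans (add_le_add ?_ hx3))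
        refine (measure_union_le _ _).trans (add_le_add ?_ ?_)
        · exact measure_biUnion_finset_le _ _
        · exact measure_biUnion_finset_le _ _
    _ ≤ ((1 + (ε / 4 : ℝ≥0)) * mainTerm μ σ W H α x t +
        (ε₂ * s ^ hi : ℝ≥0) * (D' * firstTerm μ σ H x t) + ε₁ * firstTerm μ σ H x t) +
        ε₁ * firstTerm μ σ H x t := by
      gcongr ?_ + ?_ + _
      · refine (Finset.sum_le_sum fun a _ => hE a).trans ?_
        rw [Finset.sum_add_distrib, ← Finset.mul_sum, ← Finset.mul_sum]
        gcongr
        · exact sum_le_mainTerm N x t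
        · exact sum_moment_le hD' N x t
    _ ≤ ((1 + (ε / 4 : ℝ≥0)) * mainTerm μ σ W H α x t +
        ε₁ * firstTerm μ σ H x t + ε₁ * firstTerm μ σ H x t) + ε₁ * firstTerm μ σ H x t := by
      gcongr _ + ?_ + _ + _
      rw [← mul_assoc]
      gcongr
      have : ε₂ * s ^ hi * D' ≤ ε₁ := by
        rw [hε₂, mul_assoc, div_mul_eq_mul_div, mul_div_assoc]
        exact mul_le_of_le_one_right zero_le (div_le_one_of_le₀ (by simp) (by simp))
      exact_mod_cast this
    _ = (1 + (ε / 4 : ℝ≥0)) * mainTerm μ σ W H α x t +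
        ((3 * ε₁ : ℝ≥0) : ℝ≥0∞) * firstTerm μ σ H x t := by push_cast; ring
    _ ≤ (1 + (ε / 4 : ℝ≥0)) * mainTerm μ σ W H α x t +
        ((3 * ε₁ : ℝ≥0) : ℝ≥0∞) * (D * mainTerm μ σ W H α x t) := by
      gcongr
      exact hD x t
    _ = ((1 + ε / 4 + 3 * ε₁ * D : ℝ≥0) : ℝ≥0∞) * mainTerm μ σ W H α x t := by
      push_cast; ring
    _ = _ := by
      have : 1 + ε / 4 + 3 * ε₁ * D = 1 + ε := by
        rw [hε₁]
        field_simp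
        ring
      rw [this]
      push_cast
      rfl

end WeightedClaims

/-! ### Subtraction of a finite random variable independent of the claims -/

theorem exists_setLIntegral_le {Ω : Type*} [MeasurableSpace Ω] {μ : Measure Ω}
    [IsProbabilityMeasure μ] {J f : Ω → ℝ≥0∞} (hJ : Measurable J) (hJfin : ∀ᵐ ω ∂μ, J ω < ∞)
    (hf : ∫⁻ ω, f ω ∂μ ≠ ∞) {ε : ℝ≥0∞} (hε : 0 < ε) :
    ∃ M : ℕ, ∫⁻ ω in {ω | (M : ℝ≥0∞) < J ω}, f ω ∂μ ≤ ε := by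
  have h1 : Tendsto (fun M : ℕ => μ {ω | (M : ℝ≥0∞) < J ω}) atTop (𝓝 0) := by
    have h2 : μ (⋂ M : ℕ, {ω | (M : ℝ≥0∞) < J ω}) = 0 := by
      refine measure_mono_null ?_ hJfin
      intro ω hω
      rw [mem_iInter] at hω
      intro hlt
      obtain ⟨M, hM⟩ := ENNReal.exists_nat_gt hlt.ne
      exact lt_asymm hM (hω M)
    rw [← h2]
    refine tendsto_measure_iInter_atTop
      (fun M => (measurableSet_lt measurable_const hJ).nullMeasurableSet)
      (fun M N hMN ω hω => ?_) ⟨0, measure_ne_top _ _⟩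
    exact lt_of_le_of_lt (Nat.cast_le.2 hMN) (show (N : ℝ≥0∞) < J ω from hω)
  obtain ⟨M, hM⟩ := ((tendsto_setLIntegral_zero hf h1).eventually (gt_mem_nhds hε)).exists
  exact ⟨M, hM.le⟩

namespace WeightedClaims

variable {Ω κ : Type*} [Fintype κ] {m : MeasurableSpace Ω} [mΩ : MeasurableSpace Ω]
  {μ : Measure Ω} {Z σ W : κ → ℕ → Ω → ℝ≥0} {H : κ → Measure ℝ} {α lo hi : ℝ}

/-- From time `T` on, the arrival probabilities are bounded away from zero, so an error without the
arrival factor is still admissible. This is the reason for fixing `T`. -/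
theorem exists_sum_measure_le_firstTerm {T : ℝ≥0∞} [IsProbabilityMeasure μ]
    (hT : ∀ j, 0 < μ {ω | (σ j 0 ω : ℝ≥0∞) ≤ T}) :
    ∃ D : ℝ≥0, ∀ x t, T ≤ t → ∑ j, H j (Ioi x) ≤ D * firstTerm μ σ H x t := by
  refine ⟨∑ j, (μ {ω | (σ j 0 ω : ℝ≥0∞) ≤ T}).toNNReal⁻¹, fun x t hTt => ?_⟩
  rw [firstTerm, Finset.mul_sum]
  refine Finset.sum_le_sum fun j _ => ?_
  set p := μ {ω | (σ j 0 ω : ℝ≥0∞) ≤ T} with hp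
  have hp1 : p ≤ μ {ω | (σ j 0 ω : ℝ≥0∞) ≤ t} := measure_mono fun ω hω => le_trans hω hTt
  have hp2 : p = (p.toNNReal : ℝ≥0∞) := (ENNReal.coe_toNNReal (measure_ne_top _ _)).symm
  have hp3 : p.toNNReal ≠ 0 := by
    intro h0
    rw [h0] at hp2
    exact (hT j).ne' hp2
  calc H j (Ioi x) = (p.toNNReal⁻¹ : ℝ≥0) * (H j (Ioi x) * p) := by
        rw [mul_left_comm]
        have : ((p.toNNReal⁻¹ : ℝ≥0) : ℝ≥0∞) * p = 1 := by
          nth_rewrite 2 [hp2]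
          rw [← ENNReal.coe_mul, inv_mul_cancel₀ hp3, ENNReal.coe_one]
        rw [this, mul_one]
    _ ≤ _ := by
      gcongr
      exact Finset.single_le_sum (f := fun j => (μ {ω | (σ j 0 ω : ℝ≥0∞) ≤ T}).toNNReal⁻¹)
        (fun _ _ => zero_le) (Finset.mem_univ j)

variable [IsProbabilityMeasure μ]

/-- A large weighted sum hardly ever comes with a large value of a given finite random variable
that is independent of the claims. -/
theorem exists_measure_and_lt_le (h : WeightedClaims m μ Z σ W H α lo hi) {J : Ω → ℝ≥0∞}
    (hJ : Measurable[m] J) (hJfin : ∀ᵐ ω ∂μ, J ω < ∞) {ε : ℝ≥0} (hε : 0 < ε) :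
    ∃ M : ℕ, ∀ᶠ x : ℝ in atTop, ∀ t,
      μ {ω | ENNReal.ofReal x < weightedSum Z (cutWeight σ W t) ω ∧ (M : ℝ≥0∞) < J ω} ≤
        ε * ∑ j, H j (Ioi x) := by
  obtain ⟨K, q, hq, hK⟩ := h.moment
  set r : ℝ≥0 := 2 / (1 + q) with hr
  have hr1 : 1 < r := by
    rw [hr, one_lt_div (by positivity), ← one_add_one_eq_two]
    gcongr
  have hrq : r * q < 1 := by
    rw [hr, div_mul_eq_mul_div, div_lt_one (by positivity), two_mul]
    gcongr
  obtain ⟨C, hC⟩ := h.measure_weightedSum_le hr1 one_pos le_rfl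
  -- An integrable envelope of the union bound, valid for all times at once. Absolute continuity of
  -- its integral gives the level `M`, independently of `t`.
  set f : Ω → ℝ≥0∞ := fun ω => ∑ j, ∑' i, (r : ℝ≥0∞) ^ i * powSum lo hi (W j i ω) with hf
  have hmW : ∀ j i, Measurable fun ω => (r : ℝ≥0∞) ^ i * powSum lo hi (W j i ω) := fun j i =>
    ((h.measurable_weight j i).mono h.le le_rfl).powSum.const_mul _
  have hfint : ∫⁻ ω, f ω ∂μ ≠ ∞ := by
    rw [hf, lintegral_finsetSum _ fun j _ => Measurable.tsum (hmW j)]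
    refine ENNReal.sum_ne_top.2 fun j _ => ?_
    rw [lintegral_tsum fun i => (hmW j i).aemeasurable]
    refine ne_top_of_le_ne_top (b := ((K * (1 - r * q)⁻¹ : ℝ≥0) : ℝ≥0∞)) ENNReal.coe_ne_top ?_
    calc _ ≤ ∑' i, K * ((r * q : ℝ≥0) : ℝ≥0∞) ^ i := by
          refine ENNReal.tsum_le_tsum fun i => ?_
          have h1 := hK j i ∞
          simp only [le_top, ofPred_true, setLIntegral_univ, measure_univ, mul_one] at h1
          rw [lintegral_const_mul _ ((h.measurable_weight j i).mono h.le le_rfl).powSum]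
          calc _ ≤ (r : ℝ≥0∞) ^ i * (K * (q : ℝ≥0∞) ^ i) := by gcongr
            _ = _ := by push_cast; ring
      _ = _ := by
          rw [ENNReal.tsum_mul_left, tsum_pow_le_coe hrq, ENNReal.coe_mul]
  obtain ⟨M, hM⟩ := exists_setLIntegral_le (hJ.mono h.le le_rfl) hJfin hfint
    (show (0 : ℝ≥0∞) < (ε / (C + 1) : ℝ≥0) from ENNReal.coe_pos.2 (by positivity))
  refine ⟨M, ?_⟩
  filter_upwards [hC] with x hx t
  have hms : MeasurableSet[m] {ω | (M : ℝ≥0∞) < J ω} := hJ measurableSet_Ioi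
  -- The event `M < J` is measurable in `m`, so its indicator can be absorbed into the weights. `J`
  -- may depend on the weights and arrival times, hence no product of probabilities is available.
  have hsub : {ω | ENNReal.ofReal x < weightedSum Z (cutWeight σ W t) ω ∧ (M : ℝ≥0∞) < J ω} ⊆
      {ω | ENNReal.ofReal ((1 : ℝ≥0) * x) < weightedSum Z (fun j i =>
        {ω | (M : ℝ≥0∞) < J ω}.indicator (cutWeight σ W t j i)) ω} := by
    rintro ω ⟨h1, h2⟩
    have h2 : ω ∈ {ω | (M : ℝ≥0∞) < J ω} := h2
    simpa only [mem_ofPred_eq, weightedSum, indicator_of_mem h2, NNReal.coe_one, one_mul] using h1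
  refine (measure_mono hsub).trans ((hx _ fun j i =>
    Measurable.indicator (h.measurable_cutWeight t j i) hms).trans ?_)
  rw [Finset.mul_sum]
  refine Finset.sum_le_sum fun j _ => ?_
  rw [mul_comm]
  refine mul_le_mul' ?_ le_rfl
  have hstep : ∑' i, (r : ℝ≥0∞) ^ i * ∫⁻ ω, powSum lo hi
      ({ω | (M : ℝ≥0∞) < J ω}.indicator (cutWeight σ W t j i) ω) ∂μ ≤ (ε / (C + 1) : ℝ≥0) := by
    refine le_trans ?_ hM
    calc _ ≤ ∑' i, ∫⁻ ω in {ω | (M : ℝ≥0∞) < J ω},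
          (r : ℝ≥0∞) ^ i * powSum lo hi (W j i ω) ∂μ := by
          refine ENNReal.tsum_le_tsum fun i => ?_
          rw [lintegral_const_mul _ ((h.measurable_weight j i).mono h.le le_rfl).powSum,
            ← lintegral_indicator (h.le _ hms)]
          gcongr with ω
          by_cases hω : ω ∈ {ω | (M : ℝ≥0∞) < J ω}
          · rw [indicator_of_mem hω, indicator_of_mem hω]
            refine powSum_mono h.lo_pos.le (h.lo_lt.trans h.lt_hi).le ?_
            exact indicator_le_self' (fun _ _ => zero_le) ω
          · rw [indicator_of_notMem hω, indicator_of_notMem hω, powSum_zero h.lo_pos h.hi_pos]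
      _ = ∫⁻ ω in {ω | (M : ℝ≥0∞) < J ω}, ∑' i, (r : ℝ≥0∞) ^ i * powSum lo hi (W j i ω) ∂μ :=
          (lintegral_tsum fun i => (hmW j i).aemeasurable).symm
      _ ≤ _ := by
          refine lintegral_mono fun ω => ?_
          exact Finset.single_le_sum
            (f := fun j => ∑' i, (r : ℝ≥0∞) ^ i * powSum lo hi (W j i ω))
            (fun _ _ => zero_le) (Finset.mem_univ j)
  calc _ ≤ (C : ℝ≥0∞) * (ε / (C + 1) : ℝ≥0) := by gcongr
    _ ≤ ε := by
      have : C * (ε / (C + 1)) ≤ ε := by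
        rw [mul_div_left_comm]
        exact mul_le_of_le_one_right zero_le (div_le_one_of_le₀ (by simp) (by simp))
      exact_mod_cast this

/-- Since `s ^ (-α)` tends to 1 as `s` decreases to 1, the threshold can be raised from `x` to `s *
x` at little cost. The gap `(s - 1) * x` will absorb any bounded subtraction. -/
theorem exists_mainTerm_le_scaled (h : WeightedClaims m μ Z σ W H α lo hi) {ε : ℝ≥0}
    (hε : 0 < ε) :
    ∃ s : ℝ, 1 < s ∧ ∀ᶠ x : ℝ in atTop, ∀ t,
      mainTerm μ σ W H α x t ≤ (1 + ε) * mainTerm μ σ W H α (s * x) t := by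
  have hp := h.isProbabilityMeasure
  have hα : 0 < α := h.lo_pos.trans h.lo_lt
  have hε' : (0 : ℝ) < ε := hε
  have hc : ContinuousAt (fun s : ℝ => s ^ (-α)) 1 := Real.continuousAt_rpow_const _ _ (by simp)
  have h1 : ∀ᶠ s in 𝓝[>] (1 : ℝ), (1 + ε : ℝ)⁻¹ < s ^ (-α) := by
    refine eventually_nhdsWithin_of_eventually_nhds (hc.eventually (lt_mem_nhds ?_))
    simp only [Real.one_rpow]
    exact inv_lt_one_of_one_lt₀ (by linarith)
  obtain ⟨s, hs, hs1⟩ := (h1.and self_mem_nhdsWithin).exists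
  have hs1 : 1 < s := hs1
  refine ⟨s, hs1, ?_⟩
  have := fun j => (h.regVarying j).le_measure_Ioi_mul (by linarith) (by positivity) hs
  filter_upwards [eventually_all.2 this] with x hx t
  rw [mainTerm, mainTerm, Finset.mul_sum]
  refine Finset.sum_le_sum fun j _ => ?_
  rw [← mul_assoc]
  refine mul_le_mul' ?_ le_rfl
  have e : (1 + ε : ℝ≥0∞) = ENNReal.ofReal (1 + ε) := by
    rw [ENNReal.ofReal_add zero_le_one hε'.le]; simp
  calc H j (Ioi x) = (1 + ε) * (ENNReal.ofReal (1 + ε : ℝ)⁻¹ * H j (Ioi x)) := by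
        rw [e, ← mul_assoc, ← ENNReal.ofReal_mul (by positivity),
          mul_inv_cancel₀ (by positivity), ENNReal.ofReal_one, one_mul]
    _ ≤ _ := by
      gcongr
      exact hx j

/-- The lower bound for the tail of the weighted sum is not affected by the subtraction of a finite
random variable that is independent of the claims. -/
theorem mainTerm_le_measure_add_lt (h : WeightedClaims m μ Z σ W H α lo hi) {J : Ω → ℝ≥0∞}
    (hJ : Measurable[m] J) (hJfin : ∀ᵐ ω ∂μ, J ω < ∞) {T : ℝ≥0∞}
    (hT : ∀ j, 0 < μ {ω | (σ j 0 ω : ℝ≥0∞) ≤ T}) {ε : ℝ≥0} (hε : 0 < ε) :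
    ∀ᶠ x : ℝ in atTop, ∀ t, T ≤ t → mainTerm μ σ W H α x t ≤
      (1 + ε) * μ {ω | ENNReal.ofReal x + J ω < weightedSum Z (cutWeight σ W t) ω} +
        ε * mainTerm μ σ W H α x t := by
  obtain ⟨D, hD0, hD⟩ := h.exists_firstTerm_le
  obtain ⟨D', hD'⟩ := exists_sum_measure_le_firstTerm (H := H) hT
  -- Two errors occur, and each is magnified by the factor `1 + ε` from the change of threshold.
  set ε₁ : ℝ≥0 := ε / (2 * (1 + ε)) with hε₁
  have hε₁0 : 0 < ε₁ := by positivity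
  obtain ⟨s, hs1, hs⟩ := h.exists_mainTerm_le_scaled hε
  have hs0 : 0 < s := by linarith
  obtain ⟨M, hM⟩ := h.exists_measure_and_lt_le hJ hJfin
    (show 0 < ε₁ / (D' * D + 1) by positivity)
  have htend : Tendsto (fun x : ℝ => s * x) atTop atTop := tendsto_id.const_mul_atTop hs0
  -- The last condition says `x + M ≤ s * x`.
  filter_upwards [hs, htend.eventually hM, htend.eventually (h.mainTerm_le_measure_add hε₁0),
    eventually_gt_atTop 0, eventually_ge_atTop (M / (s - 1))] with x hx1 hx2 hx3 hx0 hxM t hTt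
  have hanti : mainTerm μ σ W H α (s * x) t ≤ mainTerm μ σ W H α x t := by
    unfold mainTerm
    gcongr
    nlinarith
  have hsub : {ω | ENNReal.ofReal (s * x) < weightedSum Z (cutWeight σ W t) ω} ⊆
      {ω | ENNReal.ofReal x + J ω < weightedSum Z (cutWeight σ W t) ω} ∪
      {ω | ENNReal.ofReal (s * x) < weightedSum Z (cutWeight σ W t) ω ∧ (M : ℝ≥0∞) < J ω} := by
    intro ω hω
    by_cases hJω : (M : ℝ≥0∞) < J ω
    · exact Or.inr ⟨hω, hJω⟩
    · refine Or.inl (lt_of_le_of_lt ?_ (mem_ofPred_eq ▸ hω))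
      calc ENNReal.ofReal x + J ω ≤ ENNReal.ofReal x + ENNReal.ofReal M := by
            gcongr
            simpa using hJω
        _ = ENNReal.ofReal (x + M) := (ENNReal.ofReal_add hx0.le (by positivity)).symm
        _ ≤ _ := by
            refine ENNReal.ofReal_le_ofReal ?_
            rw [div_le_iff₀ (by linarith)] at hxM
            linarith
  have hsmall : μ {ω | ENNReal.ofReal (s * x) < weightedSum Z (cutWeight σ W t) ω ∧
      (M : ℝ≥0∞) < J ω} ≤ ε₁ * mainTerm μ σ W H α x t := by
    calc _ ≤ (ε₁ / (D' * D + 1) : ℝ≥0) * ∑ j, H j (Ioi (s * x)) := hx2 t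
      _ ≤ (ε₁ / (D' * D + 1) : ℝ≥0) * (D' * (D * mainTerm μ σ W H α (s * x) t)) := by
        gcongr
        exact (hD' _ t hTt).trans (by gcongr; exact hD _ t)
      _ = ((ε₁ / (D' * D + 1) * (D' * D) : ℝ≥0) : ℝ≥0∞) * mainTerm μ σ W H α (s * x) t := by
        push_cast; ring
      _ ≤ _ := by
        gcongr
        rw [div_mul_eq_mul_div, mul_div_assoc]
        exact mul_le_of_le_one_right zero_le (div_le_one_of_le₀ (by simp) (by simp))
  calc mainTerm μ σ W H α x t ≤ (1 + ε) * mainTerm μ σ W H α (s * x) t := hx1 t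
    _ ≤ (1 + ε) * ((μ {ω | ENNReal.ofReal x + J ω < weightedSum Z (cutWeight σ W t) ω} +
        ε₁ * mainTerm μ σ W H α x t) + ε₁ * mainTerm μ σ W H α x t) := by
      gcongr
      refine (hx3 t).trans ?_
      gcongr
      refine (measure_mono hsub).trans ((measure_union_le _ _).trans ?_)
      gcongr
    _ = (1 + ε) * μ {ω | ENNReal.ofReal x + J ω < weightedSum Z (cutWeight σ W t) ω} +
        ((2 * ((1 + ε) * ε₁) : ℝ≥0) : ℝ≥0∞) * mainTerm μ σ W H α x t := by
      push_cast; ring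
    _ = _ := by
      congr 3
      rw [hε₁]
      field_simp

end WeightedClaims

/-! ### A maximal inequality for products of independent factors -/

section Maximal

variable {Ω : Type*} [mΩ : MeasurableSpace Ω] {μ : Measure Ω} [IsProbabilityMeasure μ]

theorem measure_le_mul_of_indepFun {ξ V : Ω → ℝ≥0} (hξ : Measurable ξ) (hV : Measurable V)
    (h : IndepFun ξ V μ) (c : ℝ≥0) :
    μ {ω | c ≤ ξ ω * V ω} = ∫⁻ ω, μ {ω' | c ≤ ξ ω * V ω'} ∂μ := by
  have hs : MeasurableSet {p : ℝ≥0 × ℝ≥0 | c ≤ p.1 * p.2} :=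
    measurableSet_le measurable_const (by fun_prop)
  have hmap := (indepFun_iff_map_prod_eq_prod_map_map hξ.aemeasurable hV.aemeasurable).1 h
  have h1 : μ {ω | c ≤ ξ ω * V ω} =
      (μ.map fun ω => (ξ ω, V ω)) {p : ℝ≥0 × ℝ≥0 | c ≤ p.1 * p.2} :=
    (Measure.map_apply (hξ.prodMk hV) hs).symm
  have := Measure.isProbabilityMeasure_map (μ := μ) hV.aemeasurable
  rw [h1, hmap, Measure.prod_apply hs, lintegral_map (measurable_measure_prodMk_left hs) hξ]
  refine lintegral_congr fun ω => ?_
  rw [Measure.map_apply hV (measurable_prodMk_left hs)]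
  rfl

/-- Doob's maximal inequality for a product supermartingale, proved by conditioning on the first
factor: the later products are `ξ i` times products started at `i + 1`, so the induction hypothesis
is used at the random level `c / ξ i`. This is why start and level are quantified inside the
induction. -/
theorem mul_measure_le_prod_le_one {ξ : ℕ → Ω → ℝ≥0} (hm : ∀ i, Measurable (ξ i))
    (hind : iIndepFun ξ μ) (hle : ∀ i, ∫⁻ ω, ξ i ω ∂μ ≤ 1) (n : ℕ) :
    ∀ (i : ℕ) (c : ℝ≥0), c * μ {ω | ∃ k ≤ n, c ≤ ∏ j ∈ Finset.range k, ξ (i + j) ω} ≤ 1 := by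
  induction n with
  | zero =>
    intro i c
    rcases le_or_gt c 1 with hc | hc
    · exact mul_le_one' (by exact_mod_cast hc) prob_le_one
    · simp [hc.not_ge]
  | succ n ih =>
    intro i c
    -- The empty product equals 1, so it reaches level `c` only in the trivial case `c ≤ 1`.
    rcases le_or_gt c 1 with hc | hc
    · exact mul_le_one' (by exact_mod_cast hc) prob_le_one
    have hc0 : 0 < c := zero_lt_one.trans hc
    set V : Ω → ℝ≥0 := fun ω =>
      (Finset.range (n + 1)).sup fun k => ∏ j ∈ Finset.range k, ξ (i + 1 + j) ω with hV
    have hVle : ∀ (a : ℝ≥0) ω, 0 < a →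
        (a ≤ V ω ↔ ∃ k ≤ n, a ≤ ∏ j ∈ Finset.range k, ξ (i + 1 + j) ω) := by
      intro a ω ha
      rw [hV]
      simp only
      rw [Finset.le_sup_iff (by simpa using ha)]
      simp
    have hset : {ω | ∃ k ≤ n + 1, c ≤ ∏ j ∈ Finset.range k, ξ (i + j) ω} ⊆
        {ω | c ≤ ξ i ω * V ω} := by
      rintro ω ⟨k, hk, hck⟩
      rcases k with _ | k
      · simp only [Finset.range_zero, Finset.prod_empty] at hck
        exact absurd hck hc.not_ge
      · refine le_trans hck ?_
        rw [Finset.prod_range_succ']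
        rw [mul_comm, add_zero]
        refine mul_le_mul' le_rfl (le_trans (le_of_eq ?_) (Finset.le_sup
          (f := fun k => ∏ j ∈ Finset.range k, ξ (i + 1 + j) ω) (b := k)
          (by simp; omega)))
        refine Finset.prod_congr rfl fun j _ => ?_
        rw [add_assoc, add_comm 1 j]
    let m : ℕ → MeasurableSpace Ω := fun j => MeasurableSpace.comap (ξ j) inferInstance
    have hVm : Measurable[⨆ j ∈ Ioi i, m j] V := by
      have h0 : ∀ k ≤ n, Measurable[⨆ j ∈ Ioi i, m j]
          fun ω => ∏ j ∈ Finset.range k, ξ (i + 1 + j) ω := ?_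
      · have h1 := @Finset.measurable_range_sup'' ℝ≥0 _ Ω (⨆ j ∈ Ioi i, m j) _ _ _ _ h0
        simpa only [Finset.sup'_eq_sup] using h1
      intro k _
      refine Finset.measurable_fun_prod _ fun j _ => ?_
      have h1 : m (i + 1 + j) ≤ ⨆ j ∈ Ioi i, m j :=
        le_iSup₂_of_le (f := fun j (_ : j ∈ Ioi i) => m j) (i + 1 + j)
          (by simp only [mem_Ioi]; omega) le_rfl
      exact (comap_measurable (ξ (i + 1 + j))).mono h1 le_rfl
    -- `V` is a function of the factors with index above `i` only.
    have hindV : IndepFun (ξ i) V μ := by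
      rw [IndepFun_iff_Indep]
      have h2 := indep_iSup_of_disjoint (fun j => (hm j).comap_le) hind
        (S := {i}) (T := Ioi i) (by simp)
      refine indep_of_indep_of_le_left (indep_of_indep_of_le_right h2 hVm.comap_le) ?_
      exact le_iSup₂_of_le (f := fun j (_ : j ∈ ({i} : Set ℕ)) => m j) i rfl le_rfl
    have hVm' : Measurable V := hVm.mono (iSup₂_le fun j _ => (hm j).comap_le) le_rfl
    calc c * μ {ω | ∃ k ≤ n + 1, c ≤ ∏ j ∈ Finset.range k, ξ (i + j) ω}
        ≤ c * μ {ω | c ≤ ξ i ω * V ω} := by gcongr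
      _ = c * ∫⁻ ω, μ {ω' | c ≤ ξ i ω * V ω'} ∂μ := by
        rw [measure_le_mul_of_indepFun (hm i) hVm' hindV]
      _ ≤ c * ∫⁻ ω, ((c⁻¹ : ℝ≥0) : ℝ≥0∞) * ξ i ω ∂μ := by
        gcongr with ω
        rcases eq_or_ne (ξ i ω) 0 with h0 | h0
        · simp [h0, hc0.not_ge]
        · have hx : 0 < ξ i ω := pos_iff_ne_zero.2 h0
          have h3 : {ω' | c ≤ ξ i ω * V ω'} =
              {ω' | ∃ k ≤ n, c / ξ i ω ≤ ∏ j ∈ Finset.range k, ξ (i + 1 + j) ω'} := by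
            ext ω'
            rw [mem_ofPred_eq, mem_ofPred_eq, ← hVle _ _ (div_pos hc0 hx), div_le_iff₀ hx, mul_comm]
          rw [h3]
          have h4 := ih (i + 1) (c / ξ i ω)
          set p := μ {ω' | ∃ k ≤ n, c / ξ i ω ≤ ∏ j ∈ Finset.range k, ξ (i + 1 + j) ω'}
          calc p = ((c⁻¹ * ξ i ω : ℝ≥0) : ℝ≥0∞) * (((c / ξ i ω : ℝ≥0) : ℝ≥0∞) * p) := by
                rw [← mul_assoc, ← ENNReal.coe_mul]
                have : c⁻¹ * ξ i ω * (c / ξ i ω) = 1 := by field_simp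
                rw [this, ENNReal.coe_one, one_mul]
            _ ≤ ((c⁻¹ * ξ i ω : ℝ≥0) : ℝ≥0∞) * 1 := by gcongr
            _ = _ := by rw [mul_one, ENNReal.coe_mul]
      _ = ∫⁻ ω, ξ i ω ∂μ := by
        rw [lintegral_const_mul _ (hm i).coe_nnreal_ennreal, ← mul_assoc, ← ENNReal.coe_mul,
          mul_inv_cancel₀ hc0.ne', ENNReal.coe_one, one_mul]
      _ ≤ 1 := hle i

end Maximal

/-! ### Regularization of right-continuous paths -/

section Regularize

/-- The smallest point of the grid of mesh `2 ^ (-n)` to the right of `t`. -/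
noncomputable def dyadicAbove (n : ℕ) (t : ℝ≥0) : ℝ≥0 := ((⌊2 ^ n * t⌋₊ + 1 : ℕ) : ℝ≥0) / 2 ^ n

theorem lt_dyadicAbove (n : ℕ) (t : ℝ≥0) : t < dyadicAbove n t := by
  rw [dyadicAbove, lt_div_iff₀ (by positivity), mul_comm]
  exact_mod_cast Nat.lt_floor_add_one _

theorem dyadicAbove_le (n : ℕ) (t : ℝ≥0) : dyadicAbove n t ≤ t + (1 / 2) ^ n := by
  rw [dyadicAbove, div_le_iff₀ (by positivity), add_mul, ← mul_pow]
  push_cast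
  gcongr
  · rw [mul_comm]; exact Nat.floor_le zero_le
  · simp

theorem tendsto_dyadicAbove (t : ℝ≥0) :
    Tendsto (fun n => dyadicAbove n t) atTop (𝓝[≥] t) := by
  refine tendsto_nhdsWithin_iff.2 ⟨?_, Eventually.of_forall fun n => (lt_dyadicAbove n t).le⟩
  refine tendsto_of_tendsto_of_tendsto_of_le_of_le tendsto_const_nhds ?_
    (fun n => (lt_dyadicAbove n t).le) fun n => dyadicAbove_le n t
  have h : Tendsto (fun n : ℕ => ((1 / 2 : ℝ≥0)) ^ n) atTop (𝓝 0) :=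
    NNReal.tendsto_pow_atTop_nhds_zero_of_lt_one (by
      rw [div_lt_one two_pos]; exact one_lt_two)
  simpa using h.const_add t

/-- The values of a path, recovered from its values on dyadic grids. -/
noncomputable def regularize (r : ℝ≥0 → ℝ) (t : ℝ≥0) : ℝ :=
  limsup (fun n => r (dyadicAbove n t)) atTop

theorem regularize_eq {r : ℝ≥0 → ℝ} {t : ℝ≥0} (h : ContinuousWithinAt r (Ici t) t) :
    regularize r t = r t :=
  (h.tendsto.comp (tendsto_dyadicAbove t)).limsup_eq

/-- Evaluation of a path at a time is not jointly measurable on the space of all paths. On the n-th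
grid only countably many coordinates occur, selected by an integer-valued measurable function, and
the limit superior preserves measurability. -/
theorem measurable_regularize :
    Measurable fun p : ℝ≥0 × (ℝ≥0 → ℝ) => regularize p.2 p.1 := by
  refine Measurable.limsup fun n => ?_
  have h1 : Measurable fun q : ℕ × (ℝ≥0 → ℝ) => q.2 (((q.1 + 1 : ℕ) : ℝ≥0) / 2 ^ n) :=
    measurable_from_prod_countable_right fun k =>
      measurable_pi_apply (((k + 1 : ℕ) : ℝ≥0) / 2 ^ n)
  have h2 : Measurable fun p : ℝ≥0 × (ℝ≥0 → ℝ) => (⌊2 ^ n * p.1⌋₊, p.2) :=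
    (Nat.measurable_floor.comp (measurable_fst.const_mul _)).prodMk measurable_snd
  exact h1.comp h2

theorem measurable_regularize_of {A : Type*} [MeasurableSpace A] {f : A → ℝ≥0}
    {g : A → ℝ≥0 → ℝ} (hf : Measurable f) (hg : Measurable g) :
    Measurable fun a => regularize (g a) (f a) := by
  have h : Measurable fun a => (f a, g a) := hf.prodMk hg
  have h' : Measurable ((fun p : ℝ≥0 × (ℝ≥0 → ℝ) => regularize p.2 p.1) ∘ fun a => (f a, g a)) :=
    measurable_regularize.comp h
  exact h'

end Regularize

/-! ### Exponential moments and lower bounds of Lévy processes -/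

namespace IsLevyProcess

variable {Ω : Type*} [mΩ : MeasurableSpace Ω] {μ : Measure Ω}
  {R : ℝ≥0 → Ω → ℝ} {β a : ℝ}

/-- A divergent integral has the default value 0, and `Real.log 0 = 0` is not negative. -/
theorem integrable_exp_of_laplaceExponent_neg (hφ : laplaceExponent μ R a < 0) :
    Integrable (fun ω => Real.exp (-a * R 1 ω)) μ := by
  by_contra hno
  rw [laplaceExponent, integral_undef hno, Real.log_zero] at hφ
  exact lt_irrefl _ hφ

theorem lintegral_exp_increment (h : IsLevyProcess μ R) (β : ℝ) (s t : ℝ≥0) :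
    ∫⁻ ω, ENNReal.ofReal (Real.exp (-β * (R (s + t) ω - R s ω))) ∂μ =
      ∫⁻ ω, ENNReal.ofReal (Real.exp (-β * R t ω)) ∂μ :=
  ((h.stationary s t).comp (u := fun x => ENNReal.ofReal (Real.exp (-β * x)))
    (by fun_prop)).lintegral_eq

theorem lintegral_exp_add (h : IsLevyProcess μ R) (β : ℝ) (s t : ℝ≥0) :
    ∫⁻ ω, ENNReal.ofReal (Real.exp (-β * R (s + t) ω)) ∂μ =
      (∫⁻ ω, ENNReal.ofReal (Real.exp (-β * R s ω)) ∂μ) *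
        ∫⁻ ω, ENNReal.ofReal (Real.exp (-β * R t ω)) ∂μ := by
  have hind : IndepFun (R s) (fun ω => R (s + t) ω - R s ω) μ :=
    h.indep_increments.indepFun_eval_sub (r := 0) zero_le le_self_add h.start
  have hm : Measurable fun x : ℝ => ENNReal.ofReal (Real.exp (-β * x)) := by fun_prop
  have hs := h.measurable s
  have hst := h.measurable (s + t)
  rw [← h.lintegral_exp_increment β s t,
    ← lintegral_mul_eq_lintegral_mul_lintegral_of_indepFun
      (f := fun ω => ENNReal.ofReal (Real.exp (-β * R s ω)))
      (g := fun ω => ENNReal.ofReal (Real.exp (-β * (R (s + t) ω - R s ω))))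
      (hm.comp hs) (hm.comp (hst.sub hs)) (hind.comp hm hm)]
  refine lintegral_congr fun ω => ?_
  simp only [Pi.mul_apply]
  rw [← ENNReal.ofReal_mul (Real.exp_nonneg _), ← Real.exp_add]
  ring_nf

variable [IsProbabilityMeasure μ]

/-- Convexity of the exponential bounds `exp (-β R)` by `(1 - p) + p * exp (-a R)` with `p = β / a`,
and the mean of the right side is below 1. Negativity at `a` is thus inherited by all smaller
positive exponents. -/
theorem integrable_exp_of_le (h : IsLevyProcess μ R) (hφ : laplaceExponent μ R a < 0)
    (hβ : 0 < β) (hβa : β ≤ a) :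
    Integrable (fun ω => Real.exp (-β * R 1 ω)) μ ∧ laplaceExponent μ R β < 0 := by
  have hI := integrable_exp_of_laplaceExponent_neg hφ
  have ha : 0 < a := hβ.trans_le hβa
  set p := β / a with hp
  have hp0 : 0 < p := by positivity
  have hp1 : p ≤ 1 := (div_le_one ha).2 hβa
  have hpt : ∀ ω, Real.exp (-β * R 1 ω) ≤ (1 - p) + p * Real.exp (-a * R 1 ω) := by
    intro ω
    have := convexOn_exp.2 (mem_univ 0) (mem_univ (-a * R 1 ω)) (sub_nonneg.2 hp1) hp0.le
      (by ring)
    simp only [smul_eq_mul, mul_zero, zero_add, Real.exp_zero, mul_one] at this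
    refine le_trans (le_of_eq ?_) this
    rw [hp]
    field_simp
  have hm := h.measurable 1
  have hI2 : Integrable (fun ω => (1 - p) + p * Real.exp (-a * R 1 ω)) μ :=
    (integrable_const _).add (hI.const_mul p)
  have hI3 : Integrable (fun ω => Real.exp (-β * R 1 ω)) μ := by
    refine hI2.mono' (by fun_prop) (Eventually.of_forall fun ω => ?_)
    rw [Real.norm_of_nonneg (Real.exp_nonneg _)]
    exact hpt ω
  have hpos : 0 < ∫ ω, Real.exp (-a * R 1 ω) ∂μ := integral_exp_pos hI
  have hlt : ∫ ω, Real.exp (-a * R 1 ω) ∂μ < 1 := (Real.log_neg_iff hpos).1 hφ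
  refine ⟨hI3, (Real.log_neg_iff (integral_exp_pos hI3)).2 ?_⟩
  calc _ ≤ ∫ ω, ((1 - p) + p * Real.exp (-a * R 1 ω)) ∂μ := integral_mono hI3 hI2 hpt
    _ = (1 - p) + p * ∫ ω, Real.exp (-a * R 1 ω) ∂μ := by
      rw [integral_add (integrable_const _) (hI.const_mul p), integral_const_mul]
      simp
    _ < 1 := by nlinarith

theorem lintegral_exp_one (hI : Integrable (fun ω => Real.exp (-β * R 1 ω)) μ) :
    ∫⁻ ω, ENNReal.ofReal (Real.exp (-β * R 1 ω)) ∂μ =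
      ENNReal.ofReal (Real.exp (laplaceExponent μ R β)) := by
  rw [laplaceExponent, Real.exp_log (integral_exp_pos hI),
    ofReal_integral_eq_lintegral_ofReal hI (Eventually.of_forall fun ω => (Real.exp_nonneg _))]

theorem lintegral_exp_zero (h : IsLevyProcess μ R) (β : ℝ) :
    ∫⁻ ω, ENNReal.ofReal (Real.exp (-β * R 0 ω)) ∂μ = 1 := by
  have : (fun ω => ENNReal.ofReal (Real.exp (-β * R 0 ω))) =ᵐ[μ] fun _ => 1 := by
    filter_upwards [h.start] with ω hω
    simp [hω]
  rw [lintegral_congr_ae this]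
  simp

theorem lintegral_exp_nsmul (h : IsLevyProcess μ R) (β : ℝ) (s : ℝ≥0) (n : ℕ) :
    ∫⁻ ω, ENNReal.ofReal (Real.exp (-β * R (n * s) ω)) ∂μ =
      (∫⁻ ω, ENNReal.ofReal (Real.exp (-β * R s ω)) ∂μ) ^ n := by
  induction n with
  | zero => simpa using h.lintegral_exp_zero β
  | succ n ih =>
    rw [Nat.cast_succ, add_one_mul, h.lintegral_exp_add, ih, pow_succ]

theorem lintegral_exp_dyadic (h : IsLevyProcess μ R)
    (hI : Integrable (fun ω => Real.exp (-β * R 1 ω)) μ) (m n : ℕ) :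
    ∫⁻ ω, ENNReal.ofReal (Real.exp (-β * R ((m : ℝ≥0) / 2 ^ n) ω)) ∂μ =
      ENNReal.ofReal (Real.exp ((m : ℝ) / 2 ^ n * laplaceExponent μ R β)) := by
  -- Over `2 ^ n` steps of length `1 / 2 ^ n` the moments multiply to the moment at time 1; roots in
  -- `ℝ≥0∞` are unique.
  have hroot : ∫⁻ ω, ENNReal.ofReal (Real.exp (-β * R (1 / 2 ^ n) ω)) ∂μ =
      ENNReal.ofReal (Real.exp (laplaceExponent μ R β / 2 ^ n)) := by
    have h1 := h.lintegral_exp_nsmul β (1 / 2 ^ n) (2 ^ n)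
    have h2 : ((2 ^ n : ℕ) : ℝ≥0) * (1 / 2 ^ n) = 1 := by push_cast; field_simp
    rw [h2, lintegral_exp_one hI] at h1
    have h3 : ENNReal.ofReal (Real.exp (laplaceExponent μ R β)) =
        ENNReal.ofReal (Real.exp (laplaceExponent μ R β / 2 ^ n)) ^ 2 ^ n := by
      rw [← ENNReal.ofReal_pow (Real.exp_nonneg _), ← Real.exp_nat_mul]
      congr 2
      push_cast
      field_simp
    rw [h3] at h1
    exact ((ENNReal.pow_right_strictMono (pow_pos two_pos n).ne').injective h1).symm
  have := h.lintegral_exp_nsmul β (1 / 2 ^ n) m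
  rw [mul_one_div] at this
  rw [this, hroot, ← ENNReal.ofReal_pow (Real.exp_nonneg _), ← Real.exp_nat_mul]
  congr 2
  ring

/-- Right-continuity and Fatou's lemma along dyadic times give only one inequality; the reverse
needs a separate argument. -/
theorem lintegral_exp_le (h : IsLevyProcess μ R)
    (hI : Integrable (fun ω => Real.exp (-β * R 1 ω)) μ) (t : ℝ≥0) :
    ∫⁻ ω, ENNReal.ofReal (Real.exp (-β * R t ω)) ∂μ ≤
      ENNReal.ofReal (Real.exp (t * laplaceExponent μ R β)) := by
  have h1 : (fun ω => ENNReal.ofReal (Real.exp (-β * R t ω))) =ᵐ[μ]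
      fun ω => liminf (fun n => ENNReal.ofReal (Real.exp (-β * R (dyadicAbove n t) ω))) atTop := by
    filter_upwards [h.cadlag] with ω hω
    have h2 := (hω t).1.tendsto.comp (tendsto_dyadicAbove t)
    have h3 : Continuous fun x : ℝ => ENNReal.ofReal (Real.exp (-β * x)) :=
      ENNReal.continuous_ofReal.comp (by fun_prop)
    exact ((h3.tendsto _).comp h2).liminf_eq.symm
  rw [lintegral_congr_ae h1]
  refine (lintegral_liminf_le fun n => ?_).trans (le_of_eq ?_)
  · have := h.measurable (dyadicAbove n t)
    fun_prop
  · refine Tendsto.liminf_eq ?_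
    have h2 : ∀ n, ∫⁻ ω, ENNReal.ofReal (Real.exp (-β * R (dyadicAbove n t) ω)) ∂μ =
        ENNReal.ofReal (Real.exp ((dyadicAbove n t : ℝ≥0) * laplaceExponent μ R β)) := by
      intro n
      rw [dyadicAbove, h.lintegral_exp_dyadic hI]
      push_cast
      rfl
    simp_rw [h2]
    have h3 : Continuous fun x : ℝ≥0 =>
        ENNReal.ofReal (Real.exp (x * laplaceExponent μ R β)) :=
      ENNReal.continuous_ofReal.comp (by fun_prop)
    exact (h3.tendsto t).comp ((tendsto_dyadicAbove t).mono_right nhdsWithin_le_nhds)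

/-- The exponential moments of a Lévy process. -/
theorem lintegral_exp_eq (h : IsLevyProcess μ R)
    (hI : Integrable (fun ω => Real.exp (-β * R 1 ω)) μ) (t : ℝ≥0) :
    ∫⁻ ω, ENNReal.ofReal (Real.exp (-β * R t ω)) ∂μ =
      ENNReal.ofReal (Real.exp (t * laplaceExponent μ R β)) := by
  refine le_antisymm (h.lintegral_exp_le hI t) ?_
  obtain ⟨n, hn⟩ := exists_nat_ge t
  obtain ⟨s, hs⟩ := exists_add_of_le hn
  set e := fun u : ℝ≥0 => ENNReal.ofReal (Real.exp (u * laplaceExponent μ R β)) with he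
  -- With `t + s = n` the product of the two moments is exactly `e 1 ^ n`, so a strict inequality at
  -- `t` could not be compensated at `s`.
  have h1 : e t * e s ≤ (∫⁻ ω, ENNReal.ofReal (Real.exp (-β * R t ω)) ∂μ) * e s := by
    calc e t * e s = e 1 ^ n := by
          simp only [he]
          rw [← ENNReal.ofReal_mul (Real.exp_nonneg _), ← Real.exp_add,
            ← ENNReal.ofReal_pow (Real.exp_nonneg _), ← Real.exp_nat_mul, ← add_mul,
            ← NNReal.coe_add, ← hs]
          simp
      _ = ∫⁻ ω, ENNReal.ofReal (Real.exp (-β * R (t + s) ω)) ∂μ := by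
          have := h.lintegral_exp_nsmul β 1 n
          rw [mul_one, lintegral_exp_one hI] at this
          rw [← hs, this]
          simp [he]
      _ ≤ _ := by
          rw [h.lintegral_exp_add]
          gcongr
          exact h.lintegral_exp_le hI s
  have h0 : e s ≠ 0 := by simp [he, Real.exp_pos]
  exact (ENNReal.mul_le_mul_iff_left h0 ENNReal.ofReal_ne_top).1 h1

/-- Along a grid, `exp (-a R)` is a product of independent factors of mean at most 1, since the
exponent is negative. The bound depends on neither the mesh nor the number of points, which allows
passage to all times. -/
theorem mul_measure_grid_le (h : IsLevyProcess μ R) (hφ : laplaceExponent μ R a < 0)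
    (s : ℝ≥0) (n : ℕ) (c : ℝ≥0) :
    c * μ {ω | ∃ k ≤ n, (c : ℝ) ≤ Real.exp (-a * R (k * s) ω)} ≤ 1 := by
  have hI := integrable_exp_of_laplaceExponent_neg hφ
  set ξ : ℕ → Ω → ℝ≥0 := fun i ω =>
    Real.toNNReal (Real.exp (-a * (R ((i + 1 : ℕ) * s) ω - R (i * s) ω))) with hξ
  have hm : ∀ i, Measurable (ξ i) := fun i => by
    have h1 := h.measurable ((i + 1 : ℕ) * s)
    have h2 := h.measurable (i * s)
    fun_prop
  have hind : iIndepFun ξ μ := by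
    have hmono : Monotone fun i : ℕ => (i : ℝ≥0) * s := fun i j hij => by
      dsimp only
      gcongr
    exact (h.indep_increments.nat hmono).comp
      (fun _ x => Real.toNNReal (Real.exp (-a * x))) fun _ => by fun_prop
  have hle : ∀ i, ∫⁻ ω, ξ i ω ∂μ ≤ 1 := by
    intro i
    have h1 := h.lintegral_exp_increment a (i * s) s
    have h2 : (i : ℝ≥0) * s + s = (i + 1 : ℕ) * s := by push_cast; ring
    rw [h2] at h1
    change ∫⁻ ω, ENNReal.ofReal (Real.exp (-a * (R ((i + 1 : ℕ) * s) ω - R (i * s) ω))) ∂μ ≤ 1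
    rw [h1, h.lintegral_exp_eq hI, ENNReal.ofReal_le_one, Real.exp_le_one_iff]
    exact mul_nonpos_of_nonneg_of_nonpos s.2 hφ.le
  refine le_trans ?_ (mul_measure_le_prod_le_one hm hind hle n 0 c)
  refine mul_le_mul' le_rfl (measure_mono_ae ?_)
  filter_upwards [h.start] with ω hω
  rintro ⟨k, hk, hck⟩
  refine ⟨k, hk, ?_⟩
  have hprod : ((∏ j ∈ Finset.range k, ξ (0 + j) ω : ℝ≥0) : ℝ) = Real.exp (-a * R (k * s) ω) := by
    push_cast
    simp only [hξ, zero_add, Real.coe_toNNReal _ (Real.exp_nonneg _)]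
    rw [← Real.exp_sum, ← Finset.mul_sum, Finset.sum_range_sub fun i => R ((i : ℕ) * s) ω]
    simp [hω]
  rw [← NNReal.coe_le_coe, hprod]
  exact hck

/-- The paths of a Lévy process with a negative Laplace exponent are bounded from below. -/
theorem ae_exists_forall_exp_le (h : IsLevyProcess μ R) (hφ : laplaceExponent μ R a < 0) :
    ∀ᵐ ω ∂μ, ∃ c : ℝ, ∀ t, Real.exp (-a * R t ω) ≤ c := by
  -- The event that level `c` is reached on the grid of mesh `1 / 2 ^ N` up to time `N`. These
  -- events increase with `N`, so the union over `N` obeys the same bound.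
  set B : ℕ → ℕ → Set Ω := fun c N =>
    {ω | ∃ k ≤ N * 2 ^ N, (c : ℝ) ≤ Real.exp (-a * R (k * (1 / 2 ^ N)) ω)} with hB
  have hmono : ∀ c, Monotone (B c) := by
    intro c N N' hNN
    rintro ω ⟨k, hk, hck⟩
    obtain ⟨l, rfl⟩ := exists_add_of_le hNN
    refine ⟨k * 2 ^ l, ?_, ?_⟩
    · calc k * 2 ^ l ≤ N * 2 ^ N * 2 ^ l := by gcongr
        _ = N * 2 ^ (N + l) := by rw [pow_add, mul_assoc]
        _ ≤ _ := by gcongr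
    · have : ((k * 2 ^ l : ℕ) : ℝ≥0) * (1 / 2 ^ (N + l)) = k * (1 / 2 ^ N) := by
        push_cast
        field_simp
        ring
      rwa [this]
  have hle : ∀ c : ℕ, c * μ (⋃ N, B c N) ≤ 1 := by
    intro c
    rw [(hmono c).measure_iUnion, ENNReal.mul_iSup]
    refine iSup_le fun N => ?_
    have := h.mul_measure_grid_le hφ (1 / 2 ^ N) (N * 2 ^ N) c
    rwa [ENNReal.coe_natCast] at this
  have hzero : μ (⋂ c : ℕ, ⋃ N, B c N) = 0 := by
    by_contra hne
    obtain ⟨c, hc⟩ := ENNReal.exists_nat_mul_gt hne ENNReal.one_ne_top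
    refine absurd (hle c) (not_le.2 (hc.trans_le ?_))
    gcongr
    exact iInter_subset _ c
  have hae : ∀ᵐ ω ∂μ, ω ∉ ⋂ c : ℕ, ⋃ N, B c N := measure_eq_zero_iff_ae_notMem.1 hzero
  filter_upwards [hae, h.cadlag] with ω hω hcad
  simp only [mem_iInter, mem_iUnion, not_forall, not_exists] at hω
  obtain ⟨c, hc⟩ := hω
  refine ⟨c, fun t => ?_⟩
  have h1 := (hcad t).1.tendsto.comp (tendsto_dyadicAbove t)
  have h2 : Continuous fun x : ℝ => Real.exp (-a * x) := by fun_prop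
  refine le_of_tendsto ((h2.tendsto _).comp h1) ?_
  -- One unit beyond `t` guarantees that the grid point just to the right of `t` still lies in the
  -- n-th grid.
  obtain ⟨N₀, hN₀⟩ := exists_nat_ge (t + 1)
  filter_upwards [eventually_ge_atTop N₀] with n hn
  by_contra hlt
  refine hc n ⟨⌊2 ^ n * t⌋₊ + 1, ?_, ?_⟩
  · have h3 := (Nat.floor_le (show 0 ≤ 2 ^ n * t from zero_le))
    have h4 : ((⌊2 ^ n * t⌋₊ + 1 : ℕ) : ℝ≥0) ≤ ((n * 2 ^ n : ℕ) : ℝ≥0) := by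
      push_cast
      have hn' : (t + 1 : ℝ≥0) ≤ n := hN₀.trans (by exact_mod_cast hn)
      calc (⌊2 ^ n * t⌋₊ : ℝ≥0) + 1 ≤ 2 ^ n * t + 2 ^ n * 1 := by
            gcongr
            rw [mul_one]
            exact one_le_pow₀ one_le_two
        _ = (t + 1) * 2 ^ n := by ring
        _ ≤ _ := by gcongr
    exact_mod_cast h4
  · rw [mul_one_div]
    exact (not_le.1 hlt).le

/-- The integral of `exp (-R)` over `[0, ∞)`, in terms of the regularized path. -/
theorem ae_lintegral_exp_lt_top (h : IsLevyProcess μ R) (ha : 0 < a)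
    (hφ : laplaceExponent μ R a < 0) :
    ∀ᵐ ω ∂μ, ∫⁻ s in Ici (0 : ℝ),
      ENNReal.ofReal (Real.exp (-regularize (fun t => R t ω) s.toNNReal)) < ∞ := by
  -- The first moment of `exp (-R)` may be infinite when `a < 1`. With `b ≤ 1`, `exp (-R)` is `exp
  -- (-b R)` times a nonnegative power of `exp (-b R)`; the power is bounded along the path, and
  -- `exp (-b R)` has an integral over time of finite mean.
  set b := min a 1 with hb
  have hb0 : 0 < b := lt_min ha one_pos
  have hb1 : b ≤ 1 := min_le_right _ _
  obtain ⟨hI, hφb⟩ := h.integrable_exp_of_le hφ hb0 (min_le_left _ _)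
  have hmeas : Measurable fun p : Ω × ℝ => ENNReal.ofReal
      (Real.exp (-b * regularize (fun t => R t p.1) p.2.toNNReal)) := by
    have h1 : Measurable fun p : Ω × ℝ => regularize (fun t => R t p.1) p.2.toNNReal :=
      measurable_regularize_of measurable_snd.real_toNNReal
        (measurable_pi_lambda _ fun t => (h.measurable t).comp measurable_fst)
    exact ENNReal.measurable_ofReal.comp (Real.measurable_exp.comp (h1.const_mul (-b)))
  have hfin : ∫⁻ ω, (∫⁻ s in Ici (0 : ℝ), ENNReal.ofReal
      (Real.exp (-b * regularize (fun t => R t ω) s.toNNReal))) ∂μ ≠ ∞ := by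
    rw [lintegral_lintegral_swap hmeas.aemeasurable]
    have h3 : ∀ s : ℝ, 0 ≤ s → ∫⁻ ω, ENNReal.ofReal
        (Real.exp (-b * regularize (fun t => R t ω) s.toNNReal)) ∂μ =
        ENNReal.ofReal (Real.exp (laplaceExponent μ R b * s)) := by
      intro s hs
      have h4 : (fun ω => ENNReal.ofReal
          (Real.exp (-b * regularize (fun t => R t ω) s.toNNReal))) =ᵐ[μ]
          fun ω => ENNReal.ofReal (Real.exp (-b * R s.toNNReal ω)) := by
        filter_upwards [h.cadlag] with ω hω
        rw [regularize_eq (hω _).1]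
      rw [lintegral_congr_ae h4, h.lintegral_exp_eq hI, Real.coe_toNNReal _ hs, mul_comm]
    rw [setLIntegral_congr_fun measurableSet_Ici fun s hs => h3 s hs]
    have h5 : IntegrableOn (fun s => Real.exp (laplaceExponent μ R b * s)) (Ici 0) :=
      integrableOn_Ici_iff_integrableOn_Ioi (by finiteness) |>.2 (integrableOn_exp_mul_Ioi hφb 0)
    exact h5.lintegral_lt_top.ne
  have hae := ae_lt_top' (hmeas.lintegral_prod_right'
    (ν := volume.restrict (Ici (0 : ℝ)))).aemeasurable hfin
  filter_upwards [hae, h.ae_exists_forall_exp_le hφb, h.cadlag] with ω h1 ⟨c, hc⟩ hcad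
  have hc0 : 0 < c := (Real.exp_pos _).trans_le (hc 0)
  refine lt_of_le_of_lt (b := ∫⁻ s in Ici (0 : ℝ), ENNReal.ofReal (c ^ ((1 - b) / b)) *
    ENNReal.ofReal (Real.exp (-b * regularize (fun t => R t ω) s.toNNReal))) ?_ ?_
  · refine lintegral_mono fun s => ?_
    rw [← ENNReal.ofReal_mul (by positivity)]
    refine ENNReal.ofReal_le_ofReal ?_
    rw [regularize_eq (hcad _).1]
    calc Real.exp (-R s.toNNReal ω) = Real.exp (-b * R s.toNNReal ω) ^ ((1 - b) / b) *
          Real.exp (-b * R s.toNNReal ω) := by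
          rw [← Real.exp_mul, ← Real.exp_add]
          congr 1
          field_simp
          ring
      _ ≤ _ := by
          refine mul_le_mul_of_nonneg_right ?_ (Real.exp_nonneg _)
          exact Real.rpow_le_rpow (Real.exp_nonneg _) (hc _) (div_nonneg (by linarith) hb0.le)
  · have hmeas' : Measurable fun s : ℝ => ENNReal.ofReal
        (Real.exp (-b * regularize (fun t => R t ω) s.toNNReal)) :=
      ENNReal.measurable_ofReal.comp (Real.measurable_exp.comp
        ((measurable_regularize_of measurable_real_toNNReal measurable_const).const_mul (-b)))
    rw [lintegral_const_mul _ hmeas']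
    exact ENNReal.mul_lt_top ENNReal.ofReal_lt_top h1

end IsLevyProcess

/-! ### Renewal sequences and discounting -/

section Discount

variable {Ω : Type*}

/-- The discount factor at a random time. -/
noncomputable def discountWeight (R : ℝ≥0 → Ω → ℝ) (σ : Ω → ℝ≥0) (ω : Ω) : ℝ≥0 :=
  (Real.exp (-regularize (fun t => R t ω) (σ ω))).toNNReal

theorem coe_discountWeight_rpow (R : ℝ≥0 → Ω → ℝ) (σ : Ω → ℝ≥0) (β : ℝ) (ω : Ω) :
    (discountWeight R σ ω : ℝ≥0∞) ^ β =
      ENNReal.ofReal (Real.exp (-β * regularize (fun t => R t ω) (σ ω))) := by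
  change (ENNReal.ofReal (Real.exp _)) ^ β = _
  rw [ENNReal.ofReal_rpow_of_pos (Real.exp_pos _), ← Real.exp_mul]
  ring_nf

variable [mΩ : MeasurableSpace Ω] {μ : Measure Ω} [IsProbabilityMeasure μ]

theorem lintegral_of_indepFun {A B : Type*} [MeasurableSpace A] [MeasurableSpace B] {f : Ω → A}
    {g : Ω → B} (hf : Measurable f) (hg : Measurable g) (h : IndepFun f g μ) {F : A × B → ℝ≥0∞}
    (hF : Measurable F) :
    ∫⁻ ω, F (f ω, g ω) ∂μ = ∫⁻ ω, ∫⁻ ω', F (f ω, g ω') ∂μ ∂μ := by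
  have hmap := (indepFun_iff_map_prod_eq_prod_map_map hf.aemeasurable hg.aemeasurable).1 h
  have := Measure.isProbabilityMeasure_map (μ := μ) hf.aemeasurable
  have := Measure.isProbabilityMeasure_map (μ := μ) hg.aemeasurable
  rw [← lintegral_map hF (hf.prodMk hg), hmap, lintegral_prod _ hF.aemeasurable,
    lintegral_map hF.lintegral_prod_right' hf]
  refine lintegral_congr fun ω => ?_
  exact lintegral_map (f := fun y => F (f ω, y)) (hF.comp measurable_prodMk_left) hg

/-- The moments of the discount factor at an independent random time. -/
theorem IsLevyProcess.setLIntegral_discountWeight {R : ℝ≥0 → Ω → ℝ} (h : IsLevyProcess μ R)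
    {β : ℝ} (hI : Integrable (fun ω => Real.exp (-β * R 1 ω)) μ) {σ : Ω → ℝ≥0}
    (hσ : Measurable σ) (hind : IndepFun σ (fun ω t => R t ω) μ) (t : ℝ≥0∞) :
    ∫⁻ ω in {ω | (σ ω : ℝ≥0∞) ≤ t}, (discountWeight R σ ω : ℝ≥0∞) ^ β ∂μ =
      ∫⁻ ω in {ω | (σ ω : ℝ≥0∞) ≤ t},
        ENNReal.ofReal (Real.exp (σ ω * laplaceExponent μ R β)) ∂μ := by
  have hS : MeasurableSet {s : ℝ≥0 | (s : ℝ≥0∞) ≤ t} :=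
    measurableSet_le measurable_coe_nnreal_ennreal measurable_const
  set F : ℝ≥0 × (ℝ≥0 → ℝ) → ℝ≥0∞ := fun p => {s : ℝ≥0 | (s : ℝ≥0∞) ≤ t}.indicator
    (fun _ => ENNReal.ofReal (Real.exp (-β * regularize p.2 p.1))) p.1 with hF
  have hFm : Measurable F := by
    have h1 : Measurable fun p : ℝ≥0 × (ℝ≥0 → ℝ) =>
        ENNReal.ofReal (Real.exp (-β * regularize p.2 p.1)) :=
      ENNReal.measurable_ofReal.comp (Real.measurable_exp.comp
        (measurable_regularize.const_mul (-β)))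
    have h2 := h1.indicator (measurable_fst (β := ℝ≥0 → ℝ) hS)
    exact h2
  have hpath : Measurable fun ω t => R t ω := measurable_pi_lambda _ h.measurable
  have h1 := lintegral_of_indepFun hσ hpath hind hFm
  have hS' : MeasurableSet {ω | (σ ω : ℝ≥0∞) ≤ t} := hσ hS
  rw [← lintegral_indicator hS', ← lintegral_indicator hS']
  have e1 : ∀ ω, {ω | (σ ω : ℝ≥0∞) ≤ t}.indicator
      (fun ω => (discountWeight R σ ω : ℝ≥0∞) ^ β) ω = F (σ ω, fun t => R t ω) := by
    intro ω
    by_cases hω : (σ ω : ℝ≥0∞) ≤ t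
    · simp [hF, hω, coe_discountWeight_rpow]
    · simp [hF, hω]
  refine (lintegral_congr e1).trans (h1.trans (lintegral_congr fun ω => ?_))
  by_cases hω : (σ ω : ℝ≥0∞) ≤ t
  · rw [indicator_of_mem (show ω ∈ {ω | (σ ω : ℝ≥0∞) ≤ t} from hω), ← h.lintegral_exp_eq hI]
    refine lintegral_congr_ae ?_
    filter_upwards [h.cadlag] with ω' hω'
    simp [hF, hω, regularize_eq (hω' (σ ω)).1]
  · simp [hF, hω]

end Discount

/-! ### Exponential moments of arrival times -/

namespace IsRenewalSequence

variable {Ω : Type*} [mΩ : MeasurableSpace Ω] {μ : Measure Ω} {τ : ℕ → Ω → ℝ≥0}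

theorem indepFun_increment (h : IsRenewalSequence μ τ) (i : ℕ) :
    IndepFun (τ (i + 1)) (fun ω => τ (i + 2) ω - τ (i + 1) ω) μ := by
  have h1 := h.indep.indepFun_finsetSum_of_notMem (fun j => (h.measurable (j + 1)).sub
    (h.measurable j)) (s := Finset.range (i + 1)) (i := i + 1) (by simp)
  refine h1.congr ?_ (Eventually.of_forall fun ω => rfl)
  refine Eventually.of_forall fun ω => ?_
  rw [Finset.sum_apply]
  have : ∀ n, ∑ j ∈ Finset.range n, (τ (j + 1) ω - τ j ω) = τ n ω := by
    intro n
    induction n with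
    | zero => simp [h.zero]
    | succ n ih => rw [Finset.sum_range_succ, ih, add_tsub_cancel_of_le (h.mono ω (Nat.le_succ n))]
  exact this (i + 1)

theorem renewalIntegral_eq (h : IsRenewalSequence μ τ) (r : ℝ) (t : ℝ≥0∞) :
    renewalIntegral μ τ r t = (∑' i, ∫⁻ ω in {ω | (τ (i + 1) ω : ℝ≥0∞) ≤ t},
      ENNReal.ofReal (Real.exp (τ (i + 1) ω * r)) ∂μ).toReal := by
  have hS : MeasurableSet {s : ℝ≥0 | (s : ℝ≥0∞) ≤ t} :=
    measurableSet_le measurable_coe_nnreal_ennreal measurable_const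
  rw [renewalIntegral, integral_eq_lintegral_of_nonneg_ae
    (Eventually.of_forall fun s => Real.exp_nonneg _) (by fun_prop), renewalMeasure,
    Measure.restrict_sum _ hS, lintegral_sum_measure]
  congr 1
  refine tsum_congr fun i => ?_
  rw [setLIntegral_map hS (by fun_prop) (h.measurable (i + 1))]
  rfl

theorem measure_pos_of_renewalFunction_pos (h : IsRenewalSequence μ τ) {t : ℝ≥0∞}
    (ht : 0 < renewalFunction μ τ t) : 0 < μ {ω | (τ 1 ω : ℝ≥0∞) ≤ t} := by
  by_contra hno
  have h0 : μ {ω | (τ 1 ω : ℝ≥0∞) ≤ t} = 0 := by simpa using hno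
  have hS : MeasurableSet {s : ℝ≥0 | (s : ℝ≥0∞) ≤ t} :=
    measurableSet_le measurable_coe_nnreal_ennreal measurable_const
  rw [← renewalMeasure_apply h, renewalMeasure, Measure.sum_apply _ hS] at ht
  refine ht.ne' (ENNReal.tsum_eq_zero.2 fun i => ?_)
  rw [Measure.map_apply (h.measurable _) hS]
  refine measure_mono_null (fun ω hω => ?_) h0
  exact le_trans (ENNReal.coe_le_coe.2 (h.mono ω (Nat.le_add_left 1 i)))
    (show (τ (i + 1) ω : ℝ≥0∞) ≤ t from hω)

/-- An arrival by time `t` forces the previous one by time `t`, and the exponential splits over the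
independent increment. Only that last increment is released from the constraint, so the factor for
the first arrival survives next to the geometric decay. -/
theorem setLIntegral_exp_le {r : ℝ} (h : IsRenewalSequence μ τ) (hr : r < 0) (i : ℕ) (t : ℝ≥0∞) :
    ∫⁻ ω in {ω | (τ (i + 1) ω : ℝ≥0∞) ≤ t}, ENNReal.ofReal (Real.exp (τ (i + 1) ω * r)) ∂μ ≤
      μ {ω | (τ 1 ω : ℝ≥0∞) ≤ t} * (∫⁻ ω, ENNReal.ofReal (Real.exp (τ 1 ω * r)) ∂μ) ^ i := by
  have hS : ∀ i, MeasurableSet {ω | (τ i ω : ℝ≥0∞) ≤ t} := fun i =>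
    measurableSet_le (h.measurable i).coe_nnreal_ennreal measurable_const
  induction i with
  | zero =>
    rw [pow_zero, mul_one, zero_add]
    calc _ ≤ ∫⁻ ω in {ω | (τ 1 ω : ℝ≥0∞) ≤ t}, 1 ∂μ := by
          refine lintegral_mono fun ω => ?_
          rw [ENNReal.ofReal_le_one, Real.exp_le_one_iff]
          exact mul_nonpos_of_nonneg_of_nonpos (τ 1 ω).2 hr.le
      _ = _ := by simp
  | succ i ih =>
    set e : ℝ≥0 → ℝ≥0∞ := fun s => ENNReal.ofReal (Real.exp (s * r)) with he
    have hem : Measurable e := by fun_prop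
    set g : ℝ≥0 → ℝ≥0∞ := {s : ℝ≥0 | (s : ℝ≥0∞) ≤ t}.indicator e with hg
    have hgm : Measurable g :=
      hem.indicator (measurableSet_le measurable_coe_nnreal_ennreal measurable_const)
    have hm1 := h.measurable (i + 1)
    have hm2 := (h.measurable (i + 2)).sub hm1
    have hpt : ∀ ω, {ω | (τ (i + 2) ω : ℝ≥0∞) ≤ t}.indicator (fun ω => e (τ (i + 2) ω)) ω ≤
        g (τ (i + 1) ω) * e (τ (i + 2) ω - τ (i + 1) ω) := by
      intro ω
      by_cases hω : (τ (i + 2) ω : ℝ≥0∞) ≤ t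
      · have hle : τ (i + 1) ω ≤ τ (i + 2) ω := h.mono ω (Nat.le_succ _)
        have hω1 : (τ (i + 1) ω : ℝ≥0∞) ≤ t := le_trans (ENNReal.coe_le_coe.2 hle) hω
        rw [indicator_of_mem (show ω ∈ {ω | (τ (i + 2) ω : ℝ≥0∞) ≤ t} from hω), hg,
          indicator_of_mem (show τ (i + 1) ω ∈ {s : ℝ≥0 | (s : ℝ≥0∞) ≤ t} from hω1)]
        simp only [he]
        rw [← ENNReal.ofReal_mul (Real.exp_nonneg _), ← Real.exp_add, ← add_mul, ← NNReal.coe_add,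
          add_tsub_cancel_of_le hle]
      · rw [indicator_of_notMem (show ω ∉ {ω | (τ (i + 2) ω : ℝ≥0∞) ≤ t} from hω)]
        exact zero_le
    have hid := ((h.ident (i + 1)).comp hem).lintegral_eq
    rw [← lintegral_indicator (hS _)]
    calc _ ≤ ∫⁻ ω, g (τ (i + 1) ω) * e (τ (i + 2) ω - τ (i + 1) ω) ∂μ := lintegral_mono hpt
      _ = (∫⁻ ω, g (τ (i + 1) ω) ∂μ) * ∫⁻ ω, e (τ (i + 2) ω - τ (i + 1) ω) ∂μ :=
        lintegral_mul_eq_lintegral_mul_lintegral_of_indepFun (hgm.comp hm1) (hem.comp hm2)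
          ((h.indepFun_increment i).comp hgm hem)
      _ = (∫⁻ ω in {ω | (τ (i + 1) ω : ℝ≥0∞) ≤ t}, e (τ (i + 1) ω) ∂μ) *
          ∫⁻ ω, e (τ 1 ω) ∂μ := by
        rw [← lintegral_indicator (hS _)]
        congr 1
      _ ≤ _ := by
        rw [pow_succ, ← mul_assoc]
        gcongr

variable [IsProbabilityMeasure μ] {r : ℝ}

/-- Equality would make the integrand 1 almost surely, that is, `τ 1 = 0` almost surely, contrary to
non-degeneracy. -/
theorem lintegral_exp_lt_one (h : IsRenewalSequence μ τ) (hr : r < 0) :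
    ∫⁻ ω, ENNReal.ofReal (Real.exp (τ 1 ω * r)) ∂μ < 1 := by
  have hm := h.measurable 1
  have hle : ∀ ω, ENNReal.ofReal (Real.exp (τ 1 ω * r)) ≤ 1 := fun ω => by
    rw [ENNReal.ofReal_le_one, Real.exp_le_one_iff]
    exact mul_nonpos_of_nonneg_of_nonpos (τ 1 ω).2 hr.le
  have h1 : ∫⁻ ω, ENNReal.ofReal (Real.exp (τ 1 ω * r)) ∂μ ≤ 1 :=
    (lintegral_mono hle).trans (by simp)
  refine lt_of_le_of_ne h1 fun heq => h.nondegenerate ?_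
  have h2 := ae_eq_of_ae_le_of_lintegral_le (f := fun ω => ENNReal.ofReal (Real.exp (τ 1 ω * r)))
    (g := fun _ => 1) (Eventually.of_forall hle) (heq ▸ ENNReal.one_ne_top)
    aemeasurable_const (by simp [heq])
  filter_upwards [h2] with ω hω
  have h3 : Real.exp (τ 1 ω * r) = 1 := by
    have := congrArg ENNReal.toReal hω
    simpa [ENNReal.toReal_ofReal (Real.exp_nonneg _)] using this
  rw [Real.exp_eq_one_iff, mul_eq_zero] at h3
  rcases h3 with h3 | h3
  · exact_mod_cast h3
  · exact absurd h3 hr.ne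

/-- The exponential has no positive lower bound over all times. Up to a time `n` with positive
arrival probability `p` it is at least `exp (n * r)`; beyond `n`, the integral over arrivals by time
`n` already suffices, whence the constant `exp (n * r) * p`. -/
theorem exists_mul_measure_le_setLIntegral (h : IsRenewalSequence μ τ) (hr : r < 0) :
    ∃ c : ℝ≥0, 0 < c ∧ ∀ t : ℝ≥0∞, c * μ {ω | (τ 1 ω : ℝ≥0∞) ≤ t} ≤
      ∫⁻ ω in {ω | (τ 1 ω : ℝ≥0∞) ≤ t}, ENNReal.ofReal (Real.exp (τ 1 ω * r)) ∂μ := by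
  have hS : ∀ t, MeasurableSet {ω | (τ 1 ω : ℝ≥0∞) ≤ t} := fun t =>
    measurableSet_le (h.measurable 1).coe_nnreal_ennreal measurable_const
  obtain ⟨n, hn⟩ : ∃ n : ℕ, 0 < μ {ω | (τ 1 ω : ℝ≥0∞) ≤ (n : ℝ≥0∞)} := by
    refine exists_measure_pos_of_not_measure_iUnion_null ?_
    have : ⋃ n : ℕ, {ω | (τ 1 ω : ℝ≥0∞) ≤ (n : ℝ≥0∞)} = univ := by
      refine eq_univ_of_forall fun ω => mem_iUnion.2 ?_
      obtain ⟨n, hn⟩ := exists_nat_ge (τ 1 ω)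
      exact ⟨n, by simpa using (by exact_mod_cast hn : (τ 1 ω : ℝ≥0∞) ≤ ((n : ℝ≥0) : ℝ≥0∞))⟩
    rw [this, measure_univ]
    exact one_ne_zero
  set p := μ {ω | (τ 1 ω : ℝ≥0∞) ≤ (n : ℝ≥0∞)} with hp
  have hp1 : p ≤ 1 := prob_le_one
  have hptop : p ≠ ∞ := measure_ne_top _ _
  have hlow : ∀ t : ℝ≥0∞, t ≤ n → ENNReal.ofReal (Real.exp (n * r)) *
      μ {ω | (τ 1 ω : ℝ≥0∞) ≤ t} ≤
      ∫⁻ ω in {ω | (τ 1 ω : ℝ≥0∞) ≤ t}, ENNReal.ofReal (Real.exp (τ 1 ω * r)) ∂μ := by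
    intro t ht
    rw [← setLIntegral_const]
    refine setLIntegral_mono' (hS t) fun ω hω => ENNReal.ofReal_le_ofReal (Real.exp_le_exp.2 ?_)
    have h1 : (τ 1 ω : ℝ≥0∞) ≤ ((n : ℝ≥0) : ℝ≥0∞) := by
      simpa using le_trans (show (τ 1 ω : ℝ≥0∞) ≤ t from hω) ht
    have h2 : (τ 1 ω : ℝ) ≤ n := by exact_mod_cast h1
    exact mul_le_mul_of_nonpos_right h2 hr.le
  refine ⟨(Real.exp (n * r)).toNNReal * p.toNNReal, mul_pos (Real.toNNReal_pos.2 (Real.exp_pos _))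
    (ENNReal.toNNReal_pos hn.ne' hptop), fun t => ?_⟩
  rw [ENNReal.coe_mul, ENNReal.coe_toNNReal hptop]
  change ENNReal.ofReal (Real.exp (n * r)) * p * _ ≤ _
  rcases le_total t n with ht | ht
  · refine le_trans ?_ (hlow t ht)
    gcongr
    exact mul_le_of_le_one_right zero_le hp1
  · calc _ ≤ ENNReal.ofReal (Real.exp (n * r)) * p * 1 := by gcongr; exact prob_le_one
      _ ≤ _ := by
        rw [mul_one]
        refine (hlow n le_rfl).trans (lintegral_mono_set fun ω hω => ?_)
        exact le_trans (show (τ 1 ω : ℝ≥0∞) ≤ (n : ℝ≥0∞) from hω) ht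

end IsRenewalSequence

/-! ### Uniform asymptotic equivalence from two-sided bounds -/

/-- With both bounds at level `ε`, the ratio lies between `(1 - ε) / (1 + ε)` and `1 + ε`, hence
within `3 * ε` of 1. The additive error in the lower bound avoids truncated subtraction. -/
theorem UnifAsymp.of_le {T : Type*} {P G : ℝ → T → ℝ≥0∞} {Δ : Set T}
    (hG : ∀ᶠ x in atTop, ∀ t ∈ Δ, G x t ≠ 0 ∧ G x t ≠ ∞)
    (hup : ∀ ε : ℝ≥0, 0 < ε → ∀ᶠ x in atTop, ∀ t ∈ Δ, P x t ≤ (1 + ε) * G x t)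
    (hlow : ∀ ε : ℝ≥0, 0 < ε → ∀ᶠ x in atTop, ∀ t ∈ Δ,
      G x t ≤ (1 + ε) * P x t + ε * G x t) :
    UnifAsymp (fun x t => (P x t).toReal) (fun x t => (G x t).toReal) Δ := by
  rw [UnifAsymp, Metric.tendstoUniformlyOn_iff]
  intro δ hδ
  obtain ⟨ε, hε, hεδ⟩ : ∃ ε : ℝ≥0, 0 < ε ∧ (3 * ε : ℝ) = δ :=
    ⟨(δ / 3).toNNReal, Real.toNNReal_pos.2 (by positivity),
      by rw [Real.coe_toNNReal _ (by positivity)]; ring⟩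
  filter_upwards [hG, hup ε hε, hlow ε hε] with x h1 h2 h3 t ht
  obtain ⟨hG0, hGtop⟩ := h1 t ht
  have hε' : (0 : ℝ) < ε := hε
  have hg : 0 < (G x t).toReal := ENNReal.toReal_pos hG0 hGtop
  have hfin : (1 + (ε : ℝ≥0∞)) * G x t ≠ ∞ := by finiteness
  have hPtop : P x t ≠ ∞ := ne_top_of_le_ne_top hfin (h2 t ht)
  have e2 : (P x t).toReal ≤ (1 + ε) * (G x t).toReal := by
    have := ENNReal.toReal_mono hfin (h2 t ht)
    rwa [ENNReal.toReal_mul, ENNReal.toReal_add ENNReal.one_ne_top ENNReal.coe_ne_top] at this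
  have e3 : (G x t).toReal ≤ (1 + ε) * (P x t).toReal + ε * (G x t).toReal := by
    have := ENNReal.toReal_mono (by finiteness) (h3 t ht)
    rwa [ENNReal.toReal_add (by finiteness) (by finiteness), ENNReal.toReal_mul,
      ENNReal.toReal_mul, ENNReal.toReal_add ENNReal.one_ne_top ENNReal.coe_ne_top] at this
  have hp : 0 ≤ (P x t).toReal := ENNReal.toReal_nonneg
  rw [dist_comm, Real.dist_eq, abs_lt]
  constructor
  · rw [lt_sub_iff_add_lt, lt_div_iff₀ hg]
    nlinarith [mul_pos hε' hg]
  · rw [sub_lt_iff_lt_add, div_lt_iff₀ hg]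
    nlinarith [mul_pos hε' hg]

/-! ### Discounted claims at renewal times as weighted claims -/

theorem measurable_discountWeight {Ω : Type*} [MeasurableSpace Ω] {R : ℝ≥0 → Ω → ℝ}
    {σ : Ω → ℝ≥0} (hσ : Measurable σ) (hR : ∀ t, Measurable (R t)) :
    Measurable (discountWeight R σ) :=
  measurable_real_toNNReal.comp (Real.measurable_exp.comp
    (measurable_regularize_of hσ (measurable_pi_lambda (fun ω t => R t ω) hR)).neg)

section Renewal

variable {Ω κ : Type*} {m : MeasurableSpace Ω} [mΩ : MeasurableSpace Ω] {μ : Measure Ω}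
  {Z A : κ → ℕ → Ω → ℝ≥0} {R : ℝ≥0 → Ω → ℝ} {H : κ → Measure ℝ}
  {α αs : ℝ}

theorem indepFun_arrival {A : ℕ → Ω → ℝ≥0}
    (h : IndepFun (fun ω i => A i ω) (fun ω t => R t ω) μ) (i : ℕ) :
    IndepFun (A i) (fun ω t => R t ω) μ :=
  h.comp (φ := fun a : ℕ → ℝ≥0 => a i) (measurable_pi_apply i) measurable_id

theorem exists_powSum_discountWeight_le [Fintype κ] [IsProbabilityMeasure μ]
    (hA : ∀ j, IsRenewalSequence μ (A j)) (hR : IsLevyProcess μ R)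
    (hAR : ∀ j, IndepFun (fun ω i => A j i ω) (fun ω t => R t ω) μ)
    (hφ : laplaceExponent μ R αs < 0) {lo : ℝ} (hlo : 0 < lo) (hle : lo ≤ αs) :
    ∃ q : ℝ≥0, q < 1 ∧ ∀ j i (t : ℝ≥0∞), ∫⁻ ω in {ω | (A j (i + 1) ω : ℝ≥0∞) ≤ t},
      powSum lo αs (discountWeight R (A j (i + 1)) ω) ∂μ ≤
        (2 : ℝ≥0) * μ {ω | (A j 1 ω : ℝ≥0∞) ≤ t} * (q : ℝ≥0∞) ^ i := by
  obtain ⟨hI1, hφ1⟩ := hR.integrable_exp_of_le hφ hlo hle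
  have hI2 := IsLevyProcess.integrable_exp_of_laplaceExponent_neg hφ
  set e : ℝ → κ → ℝ≥0∞ := fun β j =>
    ∫⁻ ω, ENNReal.ofReal (Real.exp (A j 1 ω * laplaceExponent μ R β)) ∂μ with he
  -- A common ratio for the finitely many lines and both exponents; the supremum over no lines is 0,
  -- so `Q < 1` in every case.
  set Q : ℝ≥0∞ := Finset.univ.sup fun j => max (e lo j) (e αs j) with hQ
  have hQ1 : Q < 1 := (Finset.sup_lt_iff (by simp)).2 fun j _ =>
    max_lt ((hA j).lintegral_exp_lt_one hφ1) ((hA j).lintegral_exp_lt_one hφ)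
  have hQle : ∀ j, max (e lo j) (e αs j) ≤ Q := fun j =>
    Finset.le_sup (f := fun j => max (e lo j) (e αs j)) (Finset.mem_univ j)
  refine ⟨Q.toNNReal, ?_, fun j i t => ?_⟩
  · rw [← ENNReal.coe_lt_coe, ENNReal.coe_toNNReal hQ1.ne_top]
    exact hQ1
  · rw [ENNReal.coe_toNNReal hQ1.ne_top]
    have hm := measurable_discountWeight ((hA j).measurable (i + 1)) hR.measurable
    have hb : ∀ β, Integrable (fun ω => Real.exp (-β * R 1 ω)) μ → laplaceExponent μ R β < 0 →
        e β j ≤ Q → ∫⁻ ω in {ω | (A j (i + 1) ω : ℝ≥0∞) ≤ t},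
          (discountWeight R (A j (i + 1)) ω : ℝ≥0∞) ^ β ∂μ ≤
            μ {ω | (A j 1 ω : ℝ≥0∞) ≤ t} * Q ^ i := by
      intro β hI hn hq
      rw [hR.setLIntegral_discountWeight hI ((hA j).measurable _) (indepFun_arrival (hAR j) _)]
      exact ((hA j).setLIntegral_exp_le hn i t).trans (by gcongr)
    calc _ = ∫⁻ ω in {ω | (A j (i + 1) ω : ℝ≥0∞) ≤ t},
            (discountWeight R (A j (i + 1)) ω : ℝ≥0∞) ^ lo ∂μ +
          ∫⁻ ω in {ω | (A j (i + 1) ω : ℝ≥0∞) ≤ t},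
            (discountWeight R (A j (i + 1)) ω : ℝ≥0∞) ^ αs ∂μ :=
          lintegral_add_left (by fun_prop) _
      _ ≤ μ {ω | (A j 1 ω : ℝ≥0∞) ≤ t} * Q ^ i + μ {ω | (A j 1 ω : ℝ≥0∞) ≤ t} * Q ^ i :=
          add_le_add (hb lo hI1 hφ1 ((le_max_left _ _).trans (hQle j)))
            (hb αs hI2 hφ ((le_max_right _ _).trans (hQle j)))
      _ = _ := by rw [ENNReal.coe_ofNat]; ring

theorem exists_mul_measure_le_tsum_discountWeight [Fintype κ] [IsProbabilityMeasure μ]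
    (hA : ∀ j, IsRenewalSequence μ (A j)) (hR : IsLevyProcess μ R)
    (hAR : ∀ j, IndepFun (fun ω i => A j i ω) (fun ω t => R t ω) μ)
    (hI : Integrable (fun ω => Real.exp (-α * R 1 ω)) μ) (hφ : laplaceExponent μ R α < 0) :
    ∃ c : ℝ≥0, 0 < c ∧ ∀ j (t : ℝ≥0∞), c * μ {ω | (A j 1 ω : ℝ≥0∞) ≤ t} ≤
      ∑' i, ∫⁻ ω in {ω | (A j (i + 1) ω : ℝ≥0∞) ≤ t},
        (discountWeight R (A j (i + 1)) ω : ℝ≥0∞) ^ α ∂μ := by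
  choose c hc hle using fun j => (hA j).exists_mul_measure_le_setLIntegral hφ
  obtain ⟨b, hb, hbc⟩ : ∃ b : ℝ≥0, 0 < b ∧ ∀ j, b ≤ c j := by
    rcases isEmpty_or_nonempty κ with _ | _
    · exact ⟨1, one_pos, isEmptyElim⟩
    · obtain ⟨j, hj⟩ := Finite.exists_min c
      exact ⟨c j, hc j, hj⟩
  refine ⟨b, hb, fun j t => ?_⟩
  -- The first arrival alone provides the lower bound.
  refine le_trans ?_ (ENNReal.le_tsum 0)
  rw [hR.setLIntegral_discountWeight hI ((hA j).measurable _) (indepFun_arrival (hAR j) _)]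
  refine le_trans ?_ (hle j t)
  gcongr
  exact hbc j

/-- For the lower exponent any number strictly between 0 and `α` would do; the upper one is the
exponent at which the Laplace exponent is assumed negative. -/
theorem weightedClaims_discountWeight [Fintype κ] [IsProbabilityMeasure μ] (hm : m ≤ mΩ)
    (hZ : ∀ j i, Measurable (Z j i))
    (hind : Indep (MeasurableSpace.comap (fun ω (a : κ × ℕ) => Z a.1 a.2 ω) inferInstance) m μ)
    (hlaw : ∀ j i, lawOf μ (Z j i) = H j) (hreg : ∀ j, RegVarying (tailProb (H j)) (-α))
    (hO : ∀ j l, tailProb (H j) =O[atTop] tailProb (H l))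
    (hAI : ∀ a b : κ × ℕ, a ≠ b → AsympIndep μ (Z a.1 a.2) (Z b.1 b.2))
    (hA : ∀ j, IsRenewalSequence μ (A j)) (hAm : ∀ j i, Measurable[m] (A j i))
    (hR : IsLevyProcess μ R) (hRm : ∀ t, Measurable[m] (R t))
    (hAR : ∀ j, IndepFun (fun ω i => A j i ω) (fun ω t => R t ω) μ)
    (hα : 0 < α) (hααs : α < αs) (hφ : laplaceExponent μ R αs < 0) :
    WeightedClaims m μ Z (fun j i => A j (i + 1)) (fun j i => discountWeight R (A j (i + 1))) H
      α (α / 2) αs where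
  le := hm
  measurable_claim := hZ
  indep := hind
  law := hlaw
  regVarying := hreg
  isBigO := hO
  asympIndep := hAI
  measurable_time j i := hAm j (i + 1)
  time_le j i ω := (hA j).mono ω (Nat.le_add_left 1 i)
  measurable_weight j i := @measurable_discountWeight Ω m R _ (hAm j (i + 1)) hRm
  lo_pos := half_pos hα
  lo_lt := half_lt_self hα
  lt_hi := hααs
  moment := ⟨2, exists_powSum_discountWeight_le hA hR hAR hφ (half_pos hα)
    ((half_lt_self hα).trans hααs).le⟩
  lower := by
    obtain ⟨hI, hn⟩ := hR.integrable_exp_of_le hφ hα hααs.le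
    exact exists_mul_measure_le_tsum_discountWeight hA hR hAR hI hn

end Renewal

/-! ### Losses -/

section Loss

variable {Ω : Type*} {d : ℕ} {X Y τ η : Fin d → ℕ → Ω → ℝ≥0}
  {R : ℝ≥0 → Ω → ℝ} {c : Fin d → ℝ≥0} {t : ℝ≥0∞} {ω : Ω} {x : ℝ}

theorem coe_ennreal_finsetSum {ι : Type*} (s : Finset ι) (f : ι → ℝ≥0∞) :
    ((∑ k ∈ s, f k : ℝ≥0∞) : EReal) = ∑ k ∈ s, (f k : EReal) := by
  classical
  induction s using Finset.induction_on with
  | empty => simp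
  | insert a s ha ih => rw [Finset.sum_insert ha, Finset.sum_insert ha, EReal.coe_ennreal_add, ih]

theorem discountedClaims_eq {X τ : ℕ → Ω → ℝ≥0}
    (h : ∀ t : ℝ≥0, ContinuousWithinAt (fun s => R s ω) (Ici t) t) :
    discountedClaims X τ R t ω = ∑' i, ((X i ω * {ω | (τ (i + 1) ω : ℝ≥0∞) ≤ t}.indicator
      (discountWeight R (τ (i + 1))) ω : ℝ≥0) : ℝ≥0∞) := by
  refine tsum_congr fun i => ?_
  by_cases hi : (τ (i + 1) ω : ℝ≥0∞) ≤ t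
  · simp [hi, discountWeight, regularize_eq (h (τ (i + 1) ω)), ENNReal.ofReal]
  · simp [hi]

theorem aggregateClaims_eq_weightedSum
    (h : ∀ t : ℝ≥0, ContinuousWithinAt (fun s => R s ω) (Ici t) t) :
    aggregateClaims X Y τ η R t ω = weightedSum (Sum.elim X Y)
      (cutWeight (fun j i => Sum.elim τ η j (i + 1))
        (fun j i => discountWeight R (Sum.elim τ η j (i + 1))) t) ω := by
  rw [weightedSum, Fintype.sum_sum_type, aggregateClaims]
  simp only [lineClaims, discountedClaims_eq h, Finset.sum_add_distrib]
  rfl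

theorem discountIntegral_le (h : ∀ t : ℝ≥0, ContinuousWithinAt (fun s => R s ω) (Ici t) t) :
    discountIntegral R t ω ≤ ∫⁻ s in Ici (0 : ℝ),
      ENNReal.ofReal (Real.exp (-regularize (fun t => R t ω) s.toNNReal)) := by
  simp only [fun s : ℝ => regularize_eq (h s.toNNReal)]
  exact lintegral_mono_set fun s hs => hs.1

theorem totalLoss_le : totalLoss X Y τ η R c t ω ≤ (aggregateClaims X Y τ η R t ω : EReal) := by
  rw [aggregateClaims, coe_ennreal_finsetSum]
  refine Finset.sum_le_sum fun k _ => ?_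
  exact EReal.sub_le_of_le_add (le_add_of_nonneg_right (EReal.coe_ennreal_nonneg _))

theorem ofReal_lt_aggregateClaims (hx : 0 ≤ x) (h : (x : EReal) < totalLoss X Y τ η R c t ω) :
    ENNReal.ofReal x < aggregateClaims X Y τ η R t ω := by
  rw [← EReal.coe_ennreal_lt_coe_ennreal_iff, EReal.coe_ennreal_ofReal, max_eq_left hx]
  exact h.trans_le totalLoss_le

/-- A finite premium integral excludes `∞ - ∞`, so the subtraction can be undone even where the
claims are infinite. -/
theorem totalLoss_add (h : discountIntegral R t ω < ∞) :
    totalLoss X Y τ η R c t ω + (((∑ k, (c k : ℝ≥0∞)) * discountIntegral R t ω : ℝ≥0∞) : EReal) =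
      (aggregateClaims X Y τ η R t ω : EReal) := by
  rw [Finset.sum_mul, aggregateClaims, coe_ennreal_finsetSum, coe_ennreal_finsetSum, totalLoss,
    ← Finset.sum_add_distrib]
  refine Finset.sum_congr rfl fun k _ => ?_
  lift discountIntegral R t ω to ℝ≥0 using h.ne with I hI
  rw [lineLoss, ← hI, ← ENNReal.coe_mul]
  exact EReal.sub_add_cancel

theorem lt_totalLoss (hx : 0 ≤ x) {J : ℝ≥0∞} (hJ : (∑ k, (c k : ℝ≥0∞)) * discountIntegral R t ω ≤ J)
    (hI : discountIntegral R t ω < ∞)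
    (h : ENNReal.ofReal x + J < aggregateClaims X Y τ η R t ω) :
    (x : EReal) < totalLoss X Y τ η R c t ω := by
  by_contra! hle
  refine h.not_ge ?_
  rw [← EReal.coe_ennreal_le_coe_ennreal_iff, ← totalLoss_add (c := c) hI, EReal.coe_ennreal_add,
    EReal.coe_ennreal_ofReal, max_eq_left hx]
  exact add_le_add hle (EReal.coe_ennreal_le_coe_ennreal_iff.2 hJ)

end Loss

/-! ### The asymptotic expression -/

namespace WeightedClaims

variable {Ω κ : Type*} {m : MeasurableSpace Ω} [mΩ : MeasurableSpace Ω] {μ : Measure Ω}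
  {Z σ W : κ → ℕ → Ω → ℝ≥0} {H : κ → Measure ℝ} {α lo hi : ℝ} [IsProbabilityMeasure μ]

theorem tsum_lintegral_cutWeight_lt_top (h : WeightedClaims m μ Z σ W H α lo hi) (j : κ)
    (t : ℝ≥0∞) : ∑' i, ∫⁻ ω, (cutWeight σ W t j i ω : ℝ≥0∞) ^ α ∂μ < ∞ := by
  obtain ⟨D, hD⟩ := h.exists_tsum_moment_le
  calc _ ≤ ∑' i, ∫⁻ ω, powSum lo hi (cutWeight σ W t j i ω) ∂μ :=
        ENNReal.tsum_le_tsum fun i => lintegral_mono fun ω =>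
          rpow_le_powSum h.lo_lt.le h.lt_hi.le _
    _ ≤ D * μ {ω | (σ j 0 ω : ℝ≥0∞) ≤ t} := hD j t
    _ < ∞ := ENNReal.mul_lt_top ENNReal.coe_lt_top (measure_lt_top _ _)

variable [Fintype κ]

theorem mainTerm_ne_top (h : WeightedClaims m μ Z σ W H α lo hi) (x : ℝ) (t : ℝ≥0∞) :
    mainTerm μ σ W H α x t ≠ ∞ := by
  have hp := h.isProbabilityMeasure
  exact (ENNReal.sum_lt_top.2 fun j _ =>
    ENNReal.mul_lt_top (measure_lt_top _ _) (h.tsum_lintegral_cutWeight_lt_top j t)).ne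

theorem toReal_mainTerm (h : WeightedClaims m μ Z σ W H α lo hi) (x : ℝ) (t : ℝ≥0∞) :
    (mainTerm μ σ W H α x t).toReal = ∑ j, tailProb (H j) x *
      (∑' i, ∫⁻ ω in {ω | (σ j i ω : ℝ≥0∞) ≤ t}, (W j i ω : ℝ≥0∞) ^ α ∂μ).toReal := by
  have hp := h.isProbabilityMeasure
  have hα : 0 < α := h.lo_pos.trans h.lo_lt
  rw [mainTerm, ENNReal.toReal_sum fun j _ => (ENNReal.mul_lt_top (measure_lt_top _ _)
    (h.tsum_lintegral_cutWeight_lt_top j t)).ne]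
  refine Finset.sum_congr rfl fun j _ => ?_
  rw [ENNReal.toReal_mul, tsum_congr fun i =>
    h.lintegral_cutWeight t j i (g := fun w => (w : ℝ≥0∞) ^ α) (by simp [hα])]
  rfl

theorem mainTerm_ne_zero [Nonempty κ] (h : WeightedClaims m μ Z σ W H α lo hi) (x : ℝ) {t : ℝ≥0∞}
    (ht : ∀ j, 0 < μ {ω | (σ j 0 ω : ℝ≥0∞) ≤ t}) : mainTerm μ σ W H α x t ≠ 0 := by
  have hp := h.isProbabilityMeasure
  obtain ⟨D, -, hD⟩ := h.exists_firstTerm_le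
  obtain ⟨j⟩ := ‹Nonempty κ›
  intro h0
  have h1 : firstTerm μ σ H x t = 0 := by simpa [h0] using hD x t
  have h2 := le_trans (mul_measure_le_firstTerm x t j) h1.le
  rw [nonpos_iff_eq_zero, mul_eq_zero, or_iff_left (ht j).ne'] at h2
  exact ((h.regVarying j).tailProb_pos x).ne' (by simp [tailProb, measureReal_def, h2])

end WeightedClaims

/-! ### The sources of randomness -/

section Sources

variable {Ω : Type*} {d : ℕ} {X Y τ η : Fin d → ℕ → Ω → ℝ≥0} {R : ℝ≥0 → Ω → ℝ}

/-- The sigma-algebra generated by all arrival times and the discount process. -/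
@[reducible]
def timeSigma (X Y τ η : Fin d → ℕ → Ω → ℝ≥0) (R : ℝ≥0 → Ω → ℝ) : MeasurableSpace Ω :=
  ⨆ s ∈ ({Source.claims}ᶜ : Set (Source d)), sourceSigma X Y τ η R s

theorem measurable_timeSigma_arrival (j : Fin d ⊕ Fin d) (i : ℕ) :
    Measurable[timeSigma X Y τ η R] (Sum.elim τ η j i) := by
  cases j with
  | inl k =>
    refine Measurable.mono (ma := sourceSigma X Y τ η R (.firstArrivals k)) ?_
      (le_iSup₂_of_le (Source.firstArrivals k) (by simp) le_rfl) le_rfl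
    exact (measurable_pi_apply i).comp (comap_measurable fun ω i => τ k i ω)
  | inr k =>
    refine Measurable.mono (ma := sourceSigma X Y τ η R (.secondArrivals k)) ?_
      (le_iSup₂_of_le (Source.secondArrivals k) (by simp) le_rfl) le_rfl
    exact (measurable_pi_apply i).comp (comap_measurable fun ω i => η k i ω)

theorem measurable_timeSigma_discount (t : ℝ≥0) : Measurable[timeSigma X Y τ η R] (R t) := by
  refine Measurable.mono (ma := sourceSigma X Y τ η R .discount) ?_
    (le_iSup₂_of_le Source.discount (by simp) le_rfl) le_rfl
  exact (measurable_pi_apply t).comp (comap_measurable fun ω t => R t ω)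

theorem comap_claims_le :
    MeasurableSpace.comap (fun ω (a : (Fin d ⊕ Fin d) × ℕ) => Sum.elim X Y a.1 a.2 ω)
      inferInstance ≤ sourceSigma X Y τ η R .claims := by
  set g : ((Fin d × ℕ) ⊕ (Fin d × ℕ) → ℝ≥0) → (Fin d ⊕ Fin d) × ℕ → ℝ≥0 :=
    fun f a => f (Equiv.sumProdDistrib (Fin d) (Fin d) ℕ a) with hg
  have hgm : Measurable g := measurable_pi_lambda _ fun a => measurable_pi_apply _
  have he : (fun ω (a : (Fin d ⊕ Fin d) × ℕ) => Sum.elim X Y a.1 a.2 ω) =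
      g ∘ fun ω a => allClaims X Y a ω := by
    funext ω a
    obtain ⟨k | k, i⟩ := a <;> rfl
  rw [he, ← MeasurableSpace.comap_comp]
  exact MeasurableSpace.comap_mono hgm.comap_le

/-- The present value of a perpetuity, measurably in the discount process. -/
noncomputable def perpetuity (R : ℝ≥0 → Ω → ℝ) (ω : Ω) : ℝ≥0∞ :=
  ∫⁻ s in Ici (0 : ℝ), ENNReal.ofReal (Real.exp (-regularize (fun t => R t ω) s.toNNReal))

variable [mΩ : MeasurableSpace Ω] {μ : Measure Ω}

theorem sourceSigma_le (hX : ∀ k i, Measurable (X k i)) (hY : ∀ k i, Measurable (Y k i))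
    (hτ : ∀ k i, Measurable (τ k i)) (hη : ∀ k i, Measurable (η k i)) (hR : ∀ t, Measurable (R t))
    (s : Source d) : sourceSigma X Y τ η R s ≤ mΩ := by
  cases s with
  | claims =>
    refine Measurable.comap_le (measurable_pi_lambda _ fun a => ?_)
    cases a with
    | inl p => exact hX p.1 p.2
    | inr p => exact hY p.1 p.2
  | firstArrivals k => exact Measurable.comap_le (measurable_pi_lambda _ (hτ k))
  | secondArrivals k => exact Measurable.comap_le (measurable_pi_lambda _ (hη k))
  | discount => exact Measurable.comap_le (measurable_pi_lambda _ hR)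

theorem measurable_perpetuity (hR : ∀ t, Measurable (R t)) : Measurable (perpetuity R) := by
  have h : Measurable fun p : Ω × ℝ =>
      ENNReal.ofReal (Real.exp (-regularize (fun t => R t p.1) p.2.toNNReal)) := by
    refine ENNReal.measurable_ofReal.comp (Real.measurable_exp.comp (Measurable.neg ?_))
    exact measurable_regularize_of (measurable_real_toNNReal.comp measurable_snd)
      (measurable_pi_lambda _ fun t => (hR t).comp measurable_fst)
  exact h.lintegral_prod_right'

/-- Grouping the independent sources into the claims and all the others gives the independence
required of weighted claims. Independence among the claims is never involved. -/
theorem indep_claims_timeSigma (hle : ∀ s, sourceSigma X Y τ η R s ≤ mΩ)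
    (hindep : iIndep (sourceSigma X Y τ η R) μ) :
    Indep (MeasurableSpace.comap (fun ω (a : (Fin d ⊕ Fin d) × ℕ) => Sum.elim X Y a.1 a.2 ω)
      inferInstance) (timeSigma X Y τ η R) μ :=
  indep_of_indep_of_le_left (indep_iSup_of_disjoint hle hindep
    (disjoint_compl_right (a := ({Source.claims} : Set (Source d)))))
    (comap_claims_le.trans
      (le_iSup₂_of_le (f := fun s (_ : s ∈ ({Source.claims} : Set (Source d))) =>
        sourceSigma X Y τ η R s) Source.claims rfl le_rfl))

theorem indepFun_arrivals_discount (hindep : iIndep (sourceSigma X Y τ η R) μ)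
    (j : Fin d ⊕ Fin d) : IndepFun (fun ω i => Sum.elim τ η j i ω) (fun ω t => R t ω) μ := by
  rw [IndepFun_iff_Indep]
  cases j with
  | inl k => exact hindep.indep (i := .firstArrivals k) (j := .discount) (by simp)
  | inr k => exact hindep.indep (i := .secondArrivals k) (j := .discount) (by simp)

theorem asympIndep_sumElim
    (h : Pairwise fun a b => AsympIndep μ (allClaims X Y a) (allClaims X Y b))
    {a b : (Fin d ⊕ Fin d) × ℕ} (hab : a ≠ b) :
    AsympIndep μ (Sum.elim X Y a.1 a.2) (Sum.elim X Y b.1 b.2) := by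
  set e := Equiv.sumProdDistrib (Fin d) (Fin d) ℕ
  have he : ∀ a : (Fin d ⊕ Fin d) × ℕ, allClaims X Y (e a) = Sum.elim X Y a.1 a.2 := by
    rintro ⟨k | k, i⟩ <;> rfl
  simpa only [he] using h (e.injective.ne hab)

end Sources

/-! ### The main theorem -/

section Model

variable {Ω : Type*} {m : MeasurableSpace Ω} [mΩ : MeasurableSpace Ω] {μ : Measure Ω}
  [IsProbabilityMeasure μ] {d : ℕ}
  {X Y τ η : Fin d → ℕ → Ω → ℝ≥0} {R : ℝ≥0 → Ω → ℝ} {F G : Fin d → Measure ℝ} {α αs : ℝ}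

/-- All claims of the model, with their arrival times and discount factors. -/
theorem weightedClaims_model (hX : ∀ k i, Measurable (X k i)) (hY : ∀ k j, Measurable (Y k j))
    (hτ : ∀ k, IsRenewalSequence μ (τ k)) (hη : ∀ k, IsRenewalSequence μ (η k))
    (hR : IsLevyProcess μ R) (hindep : iIndep (sourceSigma X Y τ η R) μ)
    (hPAI : Pairwise fun a b => AsympIndep μ (allClaims X Y a) (allClaims X Y b))
    (hF : ∀ k i, lawOf μ (X k i) = F k) (hG : ∀ k j, lawOf μ (Y k j) = G k)
    (hα : 0 < α)
    (hFα : ∀ k, RegVarying (tailProb (F k)) (-α)) (hGα : ∀ k, RegVarying (tailProb (G k)) (-α))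
    (hFF : ∀ p q, tailProb (F p) =Θ[atTop] tailProb (F q))
    (hGG : ∀ p q, tailProb (G p) =Θ[atTop] tailProb (G q))
    (hFG : ∀ p q, tailProb (F p) =Θ[atTop] tailProb (G q))
    (hααs : α < αs) (hφ : laplaceExponent μ R αs < 0) :
    WeightedClaims (timeSigma X Y τ η R) μ (Sum.elim X Y) (fun j i => Sum.elim τ η j (i + 1))
      (fun j i => discountWeight R (Sum.elim τ η j (i + 1))) (Sum.elim F G) α (α / 2) αs := by
  have hle := sourceSigma_le hX hY (fun k => (hτ k).measurable) (fun k => (hη k).measurable)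
    hR.measurable
  exact weightedClaims_discountWeight (iSup₂_le fun s _ => hle s) (Sum.rec hX hY)
    (indep_claims_timeSigma hle hindep) (Sum.rec hF hG) (Sum.rec hFα hGα)
    (Sum.rec (fun p => Sum.rec (fun q => (hFF p q).isBigO) fun q => (hFG p q).isBigO)
      fun p => Sum.rec (fun q => (hFG q p).symm.isBigO) fun q => (hGG p q).isBigO)
    (fun _ _ => asympIndep_sumElim hPAI) (Sum.rec hτ hη) measurable_timeSigma_arrival hR
    measurable_timeSigma_discount (indepFun_arrivals_discount hindep) hα hααs hφ

theorem toReal_mainTerm_model {lo hi : ℝ}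
    (h : WeightedClaims m μ (Sum.elim X Y) (fun j i => Sum.elim τ η j (i + 1))
      (fun j i => discountWeight R (Sum.elim τ η j (i + 1))) (Sum.elim F G) α lo hi)
    (hτ : ∀ k, IsRenewalSequence μ (τ k)) (hη : ∀ k, IsRenewalSequence μ (η k))
    (hR : IsLevyProcess μ R) (hindep : iIndep (sourceSigma X Y τ η R) μ)
    (hI : Integrable (fun ω => Real.exp (-α * R 1 ω)) μ) (x : ℝ) (t : ℝ≥0∞) :
    (mainTerm μ (fun j i => Sum.elim τ η j (i + 1))
      (fun j i => discountWeight R (Sum.elim τ η j (i + 1))) (Sum.elim F G) α x t).toReal =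
      tailApprox μ F G τ η (laplaceExponent μ R α) x t := by
  have hren : ∀ j, IsRenewalSequence μ (Sum.elim τ η j) := Sum.rec hτ hη
  have key : ∀ j, (∑' i, ∫⁻ ω in {ω | (Sum.elim τ η j (i + 1) ω : ℝ≥0∞) ≤ t},
      (discountWeight R (Sum.elim τ η j (i + 1)) ω : ℝ≥0∞) ^ α ∂μ).toReal =
      renewalIntegral μ (Sum.elim τ η j) (laplaceExponent μ R α) t := fun j => by
    rw [(hren j).renewalIntegral_eq]
    congr 1
    exact tsum_congr fun i => hR.setLIntegral_discountWeight hI ((hren j).measurable _)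
      (indepFun_arrival (indepFun_arrivals_discount hindep j) _) t
  rw [h.toReal_mainTerm]
  simp only [key]
  rw [Fintype.sum_sum_type, tailApprox, Finset.sum_add_distrib]
  rfl

end Model

end LevyRenewal

theorem theorem3p1 {Ω : Type*} [MeasurableSpace Ω] (μ : Measure Ω) [IsProbabilityMeasure μ]
    (d : ℕ) (hd : 1 ≤ d)
    (X Y : Fin d → ℕ → Ω → ℝ≥0) (τ η : Fin d → ℕ → Ω → ℝ≥0) (R : ℝ≥0 → Ω → ℝ) (c : Fin d → ℝ≥0)
    (F G : Fin d → Measure ℝ) (α αs : ℝ)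
    (hX : ∀ k i, Measurable (X k i)) (hY : ∀ k j, Measurable (Y k j))
    (hτ : ∀ k, IsRenewalSequence μ (τ k)) (hη : ∀ k, IsRenewalSequence μ (η k))
    (hR : IsLevyProcess μ R)
    -- the mean of `R 1` is positive (possibly infinite)
    (hmean : ∫⁻ ω, ENNReal.ofReal (-R 1 ω) ∂μ < ∫⁻ ω, ENNReal.ofReal (R 1 ω) ∂μ)
    (hindep : iIndep (sourceSigma X Y τ η R) μ)
    (hPAI : Pairwise fun a b => AsympIndep μ (allClaims X Y a) (allClaims X Y b))
    (hF : ∀ k i, lawOf μ (X k i) = F k) (hG : ∀ k j, lawOf μ (Y k j) = G k)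
    (hα : 0 < α)
    (hFα : ∀ k, RegVarying (tailProb (F k)) (-α)) (hGα : ∀ k, RegVarying (tailProb (G k)) (-α))
    (hFF : ∀ p q, tailProb (F p) =Θ[atTop] tailProb (F q))
    (hGG : ∀ p q, tailProb (G p) =Θ[atTop] tailProb (G q))
    (hFG : ∀ p q, tailProb (F p) =Θ[atTop] tailProb (G q))
    (hααs : α < αs) (hφ : laplaceExponent μ R αs < 0) :
    UnifAsymp (fun x t => μ.real {ω | ENNReal.ofReal x < aggregateClaims X Y τ η R t ω})
      (tailApprox μ F G τ η (laplaceExponent μ R α)) (timeSet μ τ η) ∧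
    ∀ T ∈ timeSet μ τ η,
      UnifAsymp (fun x t => μ.real {ω | (x : EReal) < totalLoss X Y τ η R c t ω})
        (tailApprox μ F G τ η (laplaceExponent μ R α)) (timeSet μ τ η ∩ Ici T) := by
  have h := weightedClaims_model hX hY hτ hη hR hindep hPAI hF hG hα hFα hGα hFF hGG hFG hααs hφ
  have hI := (hR.integrable_exp_of_le hφ hα hααs.le).1
  -- Without any line the main term would vanish and the ratio would be meaningless.
  have hne : Nonempty (Fin d ⊕ Fin d) := ⟨Sum.inl ⟨0, hd⟩⟩
  set g : ℝ → ℝ≥0∞ → ℝ≥0∞ := mainTerm μ (fun j i => Sum.elim τ η j (i + 1))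
    (fun j i => discountWeight R (Sum.elim τ η j (i + 1))) (Sum.elim F G) α with hg
  have hgeq : tailApprox μ F G τ η (laplaceExponent μ R α) = fun x t => (g x t).toReal := by
    funext x t
    exact (toReal_mainTerm_model h hτ hη hR hindep hI x t).symm
  have hpos : ∀ t ∈ timeSet μ τ η, ∀ j, 0 < μ {ω | (Sum.elim τ η j 1 ω : ℝ≥0∞) ≤ t} := by
    rintro t ht (k | k)
    · exact (hτ k).measure_pos_of_renewalFunction_pos (ht k).1
    · exact (hη k).measure_pos_of_renewalFunction_pos (ht k).2
  have hg0 : ∀ x, ∀ t ∈ timeSet μ τ η, g x t ≠ 0 ∧ g x t ≠ ∞ := fun x t ht =>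
    ⟨h.mainTerm_ne_zero x (hpos t ht), h.mainTerm_ne_top x t⟩
  have hcad : ∀ᵐ ω ∂μ, ∀ t : ℝ≥0, ContinuousWithinAt (fun s => R s ω) (Ici t) t := by
    filter_upwards [hR.cadlag] with ω hω t using (hω t).1
  -- Off a null set the paths are right-continuous, and the regularized discount factors agree with
  -- the actual ones.
  have hS : ∀ x t, μ {ω | ENNReal.ofReal x < aggregateClaims X Y τ η R t ω} =
      μ {ω | ENNReal.ofReal x < weightedSum (Sum.elim X Y)
        (cutWeight (fun j i => Sum.elim τ η j (i + 1))
          (fun j i => discountWeight R (Sum.elim τ η j (i + 1))) t) ω} := fun x t => by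
    refine measure_congr ?_
    filter_upwards [hcad] with ω hω
    exact congrArg (fun s => ENNReal.ofReal x < s) (aggregateClaims_eq_weightedSum hω)
  have hup : ∀ ε : ℝ≥0, 0 < ε → ∀ᶠ x : ℝ in atTop, ∀ t,
      μ {ω | ENNReal.ofReal x < aggregateClaims X Y τ η R t ω} ≤ (1 + ε) * g x t := fun ε hε => by
    simpa only [hS] using h.measure_le_mainTerm hε
  rw [hgeq]
  refine ⟨UnifAsymp.of_le (Eventually.of_forall hg0) (fun ε hε => ?_) fun ε hε => ?_,
    fun T hT => UnifAsymp.of_le (Eventually.of_forall fun x t ht => hg0 x t ht.1)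
      (fun ε hε => ?_) fun ε hε => ?_⟩
  · filter_upwards [hup ε hε] with x hx t _ using hx t
  · filter_upwards [h.mainTerm_le_measure_add hε] with x hx t _
    rw [hS]
    exact (hx t).trans (add_le_add (le_mul_of_one_le_left zero_le le_self_add) le_rfl)
  · filter_upwards [hup ε hε, eventually_ge_atTop 0] with x hx hx0 t _
    exact (measure_mono fun ω hω => ofReal_lt_aggregateClaims hx0 hω).trans (hx t)
  -- The premiums over the whole of `[0, ∞)` dominate those up to any `t`, so one random variable
  -- serves all times.
  · have hJm : Measurable[timeSigma X Y τ η R]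
        fun ω => (∑ k, (c k : ℝ≥0∞)) * perpetuity R ω :=
      Measurable.const_mul (@measurable_perpetuity Ω R (timeSigma X Y τ η R)
        measurable_timeSigma_discount) _
    have hfin := hR.ae_lintegral_exp_lt_top (hα.trans hααs) hφ
    have hJfin : ∀ᵐ ω ∂μ, (∑ k, (c k : ℝ≥0∞)) * perpetuity R ω < ∞ := by
      filter_upwards [hfin] with ω hω
      exact ENNReal.mul_lt_top (ENNReal.sum_lt_top.2 fun k _ => ENNReal.coe_lt_top) hω
    filter_upwards [h.mainTerm_le_measure_add_lt hJm hJfin (hpos T hT) hε,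
      eventually_ge_atTop 0] with x hx hx0 t ht
    refine (hx t ht.2).trans ?_
    gcongr (1 + ε) * ?_ + _
    refine measure_mono_ae ?_
    filter_upwards [hcad, hfin] with ω hω hωfin
    change ENNReal.ofReal x + _ < weightedSum _ _ ω → (x : EReal) < totalLoss X Y τ η R c t ω
    rw [← aggregateClaims_eq_weightedSum hω]
    intro hlt
    have hle := discountIntegral_le (t := t) hω
    exact lt_totalLoss hx0 (by gcongr; exact hle) (hle.trans_lt hωfin) hlt
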